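/- All graphs are finite and simple. For positive integers $s,t$ let $P_t$ be the path with $t$ vertices, let $SDK_s$ be the 1-subdivision of the star $K_{1,s}$ (every edge $uv$ is replaced by two edges $uw$, $vw$ through a new vertex $w$), and let $$M_{s,t}=\bigl(1+R(4,R(4,s))\bigr)^{\max(t-2,0)},$$ where the Ramsey number $R(k,l)$ is the least integer $N$ such that every graph with at least $N$ vertices contains a clique of size $k$ or an independent set of size $l$. A 3-list assignment for a graph $G=(V,E)$ is a map $L:V\to 2^{\{1,2,3\}}$, and a coloring of $(G,L)$ is a map $c:V\to\{1,2,3\}$ with $c(u)\ne c(v)$ for every edge $uv$ of $G$ and $c(v)\in L(v)$ for every $v\in V$. There is an absolute constant $C$ such that for all positive integers $s$ and $t$ there is an algorithm with the following property. Given a graph $G=(V,E)$ with no induced subgraph isomorphic to $P_t$ or to $SDK_s$, and a 3-list assignment $L$ for $G$, it either returns a coloring of $(G,L)$ or correctly reports that none exists, and its running time is at most $$C\cdot\bigl(1+|V|^4+t\,|V|^2+3^{M_{s,t}}(|V|+|E|)\bigr).$$ In particular, for fixed $s$ and $t$ its running time is bounded by a polynomial in $|V|$. Here an algorithm is a program for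 a random access machine with unit-cost instructions (constants, copying, addition and truncated subtraction of natural numbers, indirect reading and writing in arrays, comparison tests, branching and while-loops), and the running time is the number of instructions and tests executed; $G$ is given by the number of its vertices and its adjacency matrix, and $L$ by the table of its $3|V|$ membership bits. -/

import Mathlib

/-- The 1-subdivision of a graph `H`: the vertices are those of `H` together with one new vertex
per edge of `H`, and every edge `uv` is replaced by the two edges joining `u` and `v` to the new
vertex of `uv`. -/
def oneSubdivision {V : Type*} (H : SimpleGraph V) : SimpleGraph (V ⊕ H.edgeSet) :=
  SimpleGraph.fromRel fun x y =>
    ∃ (v : V) (e : H.edgeSet), x = Sum.inl v ∧ y = Sum.inr e ∧ v ∈ (e : Sym2 V)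

/-- The 1-subdivision of the star `K_{1,s}`. -/
def SDK (s : ℕ) :
    SimpleGraph ((Fin 1 ⊕ Fin s) ⊕ (completeBipartiteGraph (Fin 1) (Fin s)).edgeSet) :=
  oneSubdivision (completeBipartiteGraph (Fin 1) (Fin s))

/-- `G` has no induced subgraph isomorphic to `H`. -/
def InducedFree {V W : Type*} (H : SimpleGraph W) (G : SimpleGraph V) : Prop :=
  ¬ H.IsIndContained G

/-- The Ramsey number `R(k, l)`: the least `N` such that every graph with at least `N` vertices
has a clique of size `k` or an independent set of size `l`. -/
noncomputable def ramseyNumber (k l : ℕ) : ℕ :=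
  sInf {N : ℕ | ∀ n : ℕ, N ≤ n → ∀ G : SimpleGraph (Fin n),
    (∃ A : Finset (Fin n), G.IsNClique k A) ∨ (∃ A : Finset (Fin n), G.IsNIndepSet l A)}

/-- The number `M_{s,t} = (1 + R(4, R(4, s)))^(t-2)`.  (For `t = 1` the exponent is read as `0`;
only the graph without vertices has no induced `P_1`.) -/
noncomputable def domBound (s t : ℕ) : ℕ :=
  (1 + ramseyNumber 4 (ramseyNumber 4 s)) ^ (t - 2)

/-- `c` is a coloring of `(G, L)`, where `L` is a 3-list assignment: a proper 3-coloring of `G`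
that takes the color of each vertex from the list of that vertex. -/
def IsListColoring {n : ℕ} (G : SimpleGraph (Fin n)) (L : Fin n → Finset (Fin 3))
    (c : Fin n → Fin 3) : Prop :=
  (∀ u v, G.Adj u v → c u ≠ c v) ∧ ∀ v, c v ∈ L v

/-! ### Random access machines

The machine has registers and arrays, both indexed by natural numbers and all of whose cells hold
natural numbers.  Registers and arrays are named by constants of the program, so that one program
uses only finitely many of them; the cells of an array are addressed indirectly, through the
content of a register.  The only arithmetic is addition and truncated subtraction.  Every
instruction and every evaluation of a test takes one time unit. -/

namespace RAM

/-- A state of the memory. -/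
structure State where
  /-- the content of each register -/
  reg : ℕ → ℕ
  /-- the content of each cell of each array -/
  arr : ℕ → ℕ → ℕ

/-- Elementary instructions. -/
inductive Instr where
  /-- `reg r := k` -/
  | const (r k : ℕ)
  /-- `reg r := reg a` -/
  | copy (r a : ℕ)
  /-- `reg r := reg a + reg b` -/
  | add (r a b : ℕ)
  /-- `reg r := max (reg a - reg b) 0` -/
  | sub (r a b : ℕ)
  /-- `reg r := arr A [reg a]` -/
  | load (r A a : ℕ)
  /-- `arr A [reg a] := reg b` -/
  | store (A a b : ℕ)

/-- The effect of an elementary instruction. -/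
def Instr.apply (σ : State) : Instr → State
  | .const r k => { σ with reg := Function.update σ.reg r k }
  | .copy r a => { σ with reg := Function.update σ.reg r (σ.reg a) }
  | .add r a b => { σ with reg := Function.update σ.reg r (σ.reg a + σ.reg b) }
  | .sub r a b => { σ with reg := Function.update σ.reg r (σ.reg a - σ.reg b) }
  | .load r A a => { σ with reg := Function.update σ.reg r (σ.arr A (σ.reg a)) }
  | .store A a b =>
      { σ with
        arr := Function.update σ.arr A (Function.update (σ.arr A) (σ.reg a) (σ.reg b)) }

/-- Elementary tests, comparing two registers. -/
inductive Test where
  /-- `reg a = reg b` -/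
  | eq (a b : ℕ)
  /-- `reg a < reg b` -/
  | lt (a b : ℕ)

/-- The truth value of a test. -/
def Test.Holds (σ : State) : Test → Prop
  | .eq a b => σ.reg a = σ.reg b
  | .lt a b => σ.reg a < σ.reg b

/-- Programs. -/
inductive Program where
  /-- one instruction -/
  | instr (i : Instr)
  /-- first `P`, then `Q` -/
  | seq (P Q : Program)
  /-- if `b` then `P` else `Q` -/
  | cond (b : Test) (P Q : Program)
  /-- while `b` do `P` -/
  | loop (b : Test) (P : Program)

/-- `Exec P σ T σ'`: started in `σ`, the program `P` halts after exactly `T` time units, in the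
state `σ'`. -/
inductive Exec : Program → State → ℕ → State → Prop where
  | instr (i : Instr) (σ : State) : Exec (.instr i) σ 1 (i.apply σ)
  | seq {P Q : Program} {σ σ₁ σ₂ : State} {T₁ T₂ : ℕ} :
      Exec P σ T₁ σ₁ → Exec Q σ₁ T₂ σ₂ → Exec (.seq P Q) σ (T₁ + T₂) σ₂
  | cond_true {b : Test} {P Q : Program} {σ σ' : State} {T : ℕ} :
      b.Holds σ → Exec P σ T σ' → Exec (.cond b P Q) σ (1 + T) σ'
  | cond_false {b : Test} {P Q : Program} {σ σ' : State} {T : ℕ} :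
      ¬ b.Holds σ → Exec Q σ T σ' → Exec (.cond b P Q) σ (1 + T) σ'
  | loop_true {b : Test} {P : Program} {σ σ₁ σ₂ : State} {T₁ T₂ : ℕ} :
      b.Holds σ → Exec P σ T₁ σ₁ → Exec (.loop b P) σ₁ T₂ σ₂ →
        Exec (.loop b P) σ (1 + T₁ + T₂) σ₂
  | loop_false {b : Test} {P : Program} {σ : State} :
      ¬ b.Holds σ → Exec (.loop b P) σ 1 σ

/-- Programs are deterministic: the running time and the final state are unique. -/
theorem Exec.unique {P : Program} {σ : State} {T : ℕ} {σ' : State} (h : Exec P σ T σ') :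
    ∀ {T₂ : ℕ} {σ₂ : State}, Exec P σ T₂ σ₂ → T = T₂ ∧ σ' = σ₂ := by
  induction h with
  | instr i σ => intro _ _ h; cases h; exact ⟨rfl, rfl⟩
  | seq _ _ ih₁ ih₂ =>
    intro _ _ h
    cases h with
    | seq h₁ h₂ =>
      obtain ⟨rfl, rfl⟩ := ih₁ h₁
      obtain ⟨rfl, rfl⟩ := ih₂ h₂
      exact ⟨rfl, rfl⟩
  | cond_true hb _ ih =>
    intro _ _ h
    cases h with
    | cond_true _ h₁ => obtain ⟨rfl, rfl⟩ := ih h₁; exact ⟨rfl, rfl⟩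
    | cond_false hb' _ => exact absurd hb hb'
  | cond_false hb _ ih =>
    intro _ _ h
    cases h with
    | cond_true hb' _ => exact absurd hb' hb
    | cond_false _ h₁ => obtain ⟨rfl, rfl⟩ := ih h₁; exact ⟨rfl, rfl⟩
  | loop_true hb _ _ ih₁ ih₂ =>
    intro _ _ h
    cases h with
    | loop_true _ h₁ h₂ =>
      obtain ⟨rfl, rfl⟩ := ih₁ h₁
      obtain ⟨rfl, rfl⟩ := ih₂ h₂
      exact ⟨rfl, rfl⟩
    | loop_false hb' => exact absurd hb hb'
  | loop_false hb =>
    intro _ _ h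
    cases h with
    | loop_true hb' _ _ => exact absurd hb' hb
    | loop_false _ => exact ⟨rfl, rfl⟩

open Classical in
/-- The initial state for the input `(G, L)`: register `0` holds the number `n` of vertices,
array `0` the adjacency matrix of `G`, row by row (entry `u * n + v`), array `1` the lists (entry
`3 * v + c` is `1` if the color `c` is in `L v`), and everything else is `0`. -/
noncomputable def inputState {n : ℕ} (G : SimpleGraph (Fin n)) (L : Fin n → Finset (Fin 3)) :
    State where
  reg r := if r = 0 then n else 0
  arr A i :=
    if A = 0 then
      if ∃ u v : Fin n, i = (u : ℕ) * n + (v : ℕ) ∧ G.Adj u v then 1 else 0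
    else if A = 1 then
      if ∃ (v : Fin n) (c : Fin 3), i = 3 * (v : ℕ) + (c : ℕ) ∧ c ∈ L v then 1 else 0
    else 0

/-- The answer in the final state `σ` is right: either register `0` holds `1` and array `0` holds
a coloring of `(G, L)`, or register `0` holds `0` and `(G, L)` has no coloring. -/
def CorrectOutput {n : ℕ} (G : SimpleGraph (Fin n)) (L : Fin n → Finset (Fin 3))
    (σ : State) : Prop :=
  (σ.reg 0 = 1 ∧ ∃ c : Fin n → Fin 3, IsListColoring G L c ∧
      ∀ v : Fin n, σ.arr 0 (v : ℕ) = (c v : ℕ)) ∨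
  (σ.reg 0 = 0 ∧ ¬ ∃ c : Fin n → Fin 3, IsListColoring G L c)

/-- On input `(G, L)` the program `P` halts after exactly `T` time units, with a right answer. -/
def SolvesIn (P : Program) {n : ℕ} (G : SimpleGraph (Fin n)) (L : Fin n → Finset (Fin 3))
    (T : ℕ) : Prop :=
  ∃ σ : State, Exec P (inputState G L) T σ ∧ CorrectOutput G L σ

end RAM

set_option linter.unusedSectionVars false
set_option linter.constructorNameAsVariable false

/-! The components of `G` can be colored independently. In a component `C` with root `r`, the
program finds a connected dominating set `D` containing `r` such that, for every `u ≠ r` in `D`, the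
part of `D \ {u}` still connected to `r` no longer dominates `C`. Every such `u` has a private
neighbour `w`, neither in that part nor adjacent to it (`exists_private`). Private neighbours are
what turns a large `D` into a forbidden induced subgraph. A geodesic of `D` from `r`, prolonged by
the private neighbour of its end, is an induced path, so all distances from `r` in `D` are at most
`t - 3` (`dist_le_of_inducedFree`). If a vertex had `R = R(4, R(4, s))` neighbours on the next
distance level, two applications of Ramsey's theorem would give independent children with
independent private neighbours, an induced `SDK s` (`card_children_lt`). Hence `D` has at most `R ^
(t - 3)` vertices whenever `G` has no `K₄` (`card_le`). A graph with a `K₄` has no 3-coloring, so a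
larger `D` is itself a proof that no coloring exists.

The program runs through all guesses of the colors on a small `D`. A guess forbids one color at
every vertex of `C`, namely that of a neighbour in `D`, so at most two colors per vertex remain. The
remaining problem has binary constraints and domains of size at most two. Blocks of literals are
eliminated from last to first, each elimination recording on the earlier literals which pairs have a
common continuation. Afterwards a greedy choice can fail only if there is no solution, because for
two candidate values pairwise consistency implies joint consistency (`not_stuck`).

The time for a component with `k` vertices is of order `k * (n + 1) ^ 3 + 3 ^ B * k ^ 3` with `B = R
^ (t - 3)`. Here `3 ^ B * k ^ 3 ≤ (3 ^ B) ^ 4 + k ^ 4` and `4 * B ≤ M + 4`, so summation over the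
components gives order `n ^ 4 + 3 ^ M * n` (`guess_time_le`, `four_mul_pow_le_domBound`).

The program is written in a small language with bounded loops, compiled to machine code with exact
preservation of the running time (`Stmt.exec_code`), and verified by triples that carry a time bound
(`Tri`). -/

namespace RAM

/-! ### A structured language with bounded loops: syntax, effect and running time. -/

/-- Arithmetic expressions over variables `ι` and arrays `κ`. -/
inductive Expr (ι κ : Type) where
  | lit (k : ℕ)
  | var (v : ι)
  | add (e f : Expr ι κ)
  | sub (e f : Expr ι κ)
  | get (a : κ) (e : Expr ι κ)

/-- Memories with named variables and arrays. -/
structure Mem (ι κ : Type) where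
  /-- the values of the variables -/
  reg : ι → ℕ
  /-- the cells of the arrays -/
  arr : κ → ℕ → ℕ

/-- A structured language without unbounded loops. -/
inductive Stmt (ι κ : Type) where
  | skip
  | set (v : ι) (e : Expr ι κ)
  | put (a : κ) (i e : Expr ι κ)
  | seq (P Q : Stmt ι κ)
  | ifEq (e f : Expr ι κ) (P Q : Stmt ι κ)
  | ifLt (e f : Expr ι κ) (P Q : Stmt ι κ)
  | for_ (v : ι) (e : Expr ι κ) (P : Stmt ι κ)

/-- Sequential composition. -/
infixr:60 " ;; " => Stmt.seq

variable {ι κ : Type}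

/-- The value of an expression. -/
def Expr.eval (μ : Mem ι κ) : Expr ι κ → ℕ
  | .lit k => k
  | .var v => μ.reg v
  | .add e f => e.eval μ + f.eval μ
  | .sub e f => e.eval μ - f.eval μ
  | .get a e => μ.arr a (e.eval μ)

/-- The number of instructions that evaluate an expression. -/
def Expr.cost : Expr ι κ → ℕ
  | .lit _ => 1
  | .var _ => 1
  | .add e f => e.cost + (f.cost + 1)
  | .sub e f => e.cost + (f.cost + 1)
  | .get _ e => e.cost + 1

section Semantics

variable [DecidableEq ι] [DecidableEq κ]

/-- Assignment to a variable. -/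
def Mem.setReg (μ : Mem ι κ) (v : ι) (x : ℕ) : Mem ι κ :=
  { μ with reg := Function.update μ.reg v x }

/-- Assignment to an array cell. -/
def Mem.setArr (μ : Mem ι κ) (a : κ) (i x : ℕ) : Mem ι κ :=
  { μ with arr := Function.update μ.arr a (Function.update (μ.arr a) i x) }

@[simp] theorem Mem.setReg_reg (μ : Mem ι κ) (v w : ι) (x : ℕ) :
    (μ.setReg v x).reg w = if w = v then x else μ.reg w := by
  simp [Mem.setReg, Function.update_apply]

@[simp] theorem Mem.setReg_arr (μ : Mem ι κ) (v : ι) (x : ℕ) :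
    (μ.setReg v x).arr = μ.arr := by rw [Mem.setReg]

@[simp] theorem Mem.setArr_reg (μ : Mem ι κ) (a : κ) (i x : ℕ) :
    (μ.setArr a i x).reg = μ.reg := by rw [Mem.setArr]

@[simp] theorem Mem.setArr_arr (μ : Mem ι κ) (a b : κ) (i j x : ℕ) :
    (μ.setArr a i x).arr b j = if b = a then (if j = i then x else μ.arr a j) else μ.arr b j := by
  by_cases h : b = a
  · subst h; simp [Mem.setArr, Function.update_apply]
  · simp [Mem.setArr, h]

/-- `ν` if `a = b`, otherwise `ξ`. -/
def Mem.ifEq (a b : ℕ) (ν ξ : Mem ι κ) : Mem ι κ := if a = b then ν else ξ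

/-- `ν` if `a < b`, otherwise `ξ`. -/
def Mem.ifLt (a b : ℕ) (ν ξ : Mem ι κ) : Mem ι κ := if a < b then ν else ξ

@[simp] theorem Mem.ifEq_reg (a b : ℕ) (ν ξ : Mem ι κ) (v : ι) :
    (ν.ifEq a b ξ).reg v = if a = b then ν.reg v else ξ.reg v := by
  unfold Mem.ifEq; split_ifs <;> rfl

@[simp] theorem Mem.ifEq_arr (a b : ℕ) (ν ξ : Mem ι κ) (c : κ) (i : ℕ) :
    (ν.ifEq a b ξ).arr c i = if a = b then ν.arr c i else ξ.arr c i := by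
  unfold Mem.ifEq; split_ifs <;> rfl

/-- Iterates the effect of a loop body. -/
def iterate (v : ι) (f : Mem ι κ → Mem ι κ) (μ : Mem ι κ) : ℕ → Mem ι κ
  | 0 => μ
  | j + 1 => f ((iterate v f μ j).setReg v j)

/-- The effect of a statement. -/
def Stmt.run : Stmt ι κ → Mem ι κ → Mem ι κ
  | .skip, μ => μ
  | .set v e, μ => μ.setReg v (e.eval μ)
  | .put a i e, μ => μ.setArr a (i.eval μ) (e.eval μ)
  | .seq P Q, μ => Q.run (P.run μ)
  | .ifEq e f P Q, μ => (P.run μ).ifEq (e.eval μ) (f.eval μ) (Q.run μ)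
  | .ifLt e f P Q, μ => (P.run μ).ifLt (e.eval μ) (f.eval μ) (Q.run μ)
  | .for_ v e P, μ => iterate v P.run μ (e.eval μ)

@[simp] theorem Expr.eval_lit (μ : Mem ι κ) (k : ℕ) : (Expr.lit k).eval μ = k := by
  rw [Expr.eval]

@[simp] theorem Expr.eval_var (μ : Mem ι κ) (v : ι) : (Expr.var v).eval μ = μ.reg v := by
  rw [Expr.eval]

@[simp] theorem Expr.eval_add (μ : Mem ι κ) (e f : Expr ι κ) :
    (e.add f).eval μ = e.eval μ + f.eval μ := by
  rw [Expr.eval]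

@[simp] theorem Expr.eval_sub (μ : Mem ι κ) (e f : Expr ι κ) :
    (e.sub f).eval μ = e.eval μ - f.eval μ := by
  rw [Expr.eval]

@[simp] theorem Expr.eval_get (μ : Mem ι κ) (a : κ) (e : Expr ι κ) :
    (Expr.get a e).eval μ = μ.arr a (e.eval μ) := by
  rw [Expr.eval]

@[simp] theorem Stmt.run_skip (μ : Mem ι κ) : Stmt.skip.run μ = μ := by
  rw [Stmt.run]

@[simp] theorem Stmt.run_set (μ : Mem ι κ) (v : ι) (e : Expr ι κ) :
    (Stmt.set v e).run μ = μ.setReg v (e.eval μ) := by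
  rw [Stmt.run]

@[simp] theorem Stmt.run_put (μ : Mem ι κ) (a : κ) (i e : Expr ι κ) :
    (Stmt.put a i e).run μ = μ.setArr a (i.eval μ) (e.eval μ) := by
  rw [Stmt.run]

@[simp] theorem Stmt.run_seq (μ : Mem ι κ) (P Q : Stmt ι κ) :
    (P ;; Q).run μ = Q.run (P.run μ) := by
  rw [Stmt.run]

@[simp] theorem Stmt.run_ifEq (μ : Mem ι κ) (e f : Expr ι κ) (P Q : Stmt ι κ) :
    (Stmt.ifEq e f P Q).run μ = (P.run μ).ifEq (e.eval μ) (f.eval μ) (Q.run μ) := by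
  rw [Stmt.run]

/-- The number of time units that a statement takes. -/
def Stmt.time : Stmt ι κ → Mem ι κ → ℕ
  | .skip, _ => 1
  | .set _ e, _ => e.cost + 1
  | .put _ i e, _ => i.cost + (e.cost + 1)
  | .seq P Q, μ => P.time μ + Q.time (P.run μ)
  | .ifEq e f P Q, μ =>
    e.cost + (f.cost + (1 + if e.eval μ = f.eval μ then P.time μ else Q.time μ))
  | .ifLt e f P Q, μ =>
    e.cost + (f.cost + (1 + if e.eval μ < f.eval μ then P.time μ else Q.time μ))
  | .for_ v e P, μ => e.cost + (1 + ((∑ j ∈ Finset.range (e.eval μ),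
      (P.time ((iterate v P.run μ j).setReg v j) + 4)) + 1))

end Semantics

/-! ### Compilation -/

/-- Code that evaluates an expression into register `b`, using no registers below `b`. -/
def Expr.code (ρ : ι → ℕ) (α : κ → ℕ) : ℕ → Expr ι κ → Program
  | b, .lit k => .instr (.const b k)
  | b, .var v => .instr (.copy b (ρ v))
  | b, .add e f => .seq (e.code ρ α b) (.seq (f.code ρ α (b + 1)) (.instr (.add b b (b + 1))))
  | b, .sub e f => .seq (e.code ρ α b) (.seq (f.code ρ α (b + 1)) (.instr (.sub b b (b + 1))))
  | b, .get a e => .seq (e.code ρ α b) (.instr (.load b (α a) b))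

/-- Code that executes a statement, using registers from `b` on for intermediate values. -/
def Stmt.code (ρ : ι → ℕ) (α : κ → ℕ) : ℕ → Stmt ι κ → Program
  | b, .skip => .instr (.copy b b)
  | b, .set v e => .seq (e.code ρ α b) (.instr (.copy (ρ v) b))
  | b, .put a i e =>
    .seq (i.code ρ α b) (.seq (e.code ρ α (b + 1)) (.instr (.store (α a) b (b + 1))))
  | b, .seq P Q => .seq (P.code ρ α b) (Q.code ρ α b)
  | b, .ifEq e f P Q => .seq (e.code ρ α b) (.seq (f.code ρ α (b + 1))
      (.cond (.eq b (b + 1)) (P.code ρ α b) (Q.code ρ α b)))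
  | b, .ifLt e f P Q => .seq (e.code ρ α b) (.seq (f.code ρ α (b + 1))
      (.cond (.lt b (b + 1)) (P.code ρ α b) (Q.code ρ α b)))
  | b, .for_ v e P => .seq (e.code ρ α b) (.seq (.instr (.const (b + 1) 0))
      (.loop (.lt (b + 1) b) (.seq (.instr (.copy (ρ v) (b + 1))) (.seq (P.code ρ α (b + 2))
        (.seq (.instr (.const (b + 2) 1)) (.instr (.add (b + 1) (b + 1) (b + 2))))))))

/-- The machine state `σ` represents the memory `μ`. -/
def Represents (ρ : ι → ℕ) (α : κ → ℕ) (σ : State) (μ : Mem ι κ) : Prop :=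
  (∀ v, σ.reg (ρ v) = μ.reg v) ∧ ∀ a, σ.arr (α a) = μ.arr a

/-- Variables live below `b` and temporaries from `b` on. The second operand is evaluated at `b +
1`, so it cannot destroy the first result in `b`. -/
theorem Expr.exec_code {ρ : ι → ℕ} {α : κ → ℕ} (e : Expr ι κ) :
    ∀ {b : ℕ} {σ : State} {μ : Mem ι κ}, (∀ v, ρ v < b) → Represents ρ α σ μ →
      ∃ σ', Exec (e.code ρ α b) σ e.cost σ' ∧ σ'.reg b = e.eval μ ∧
        (∀ r < b, σ'.reg r = σ.reg r) ∧ σ'.arr = σ.arr := by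
  induction e with
  | lit k =>
    intro b σ μ hb h
    refine ⟨_, Exec.instr _ _, ?_, ?_, rfl⟩
    · simp [Instr.apply, Expr.eval]
    · intro r hr; simp [Instr.apply, hr.ne]
  | var v =>
    intro b σ μ hb h
    refine ⟨_, Exec.instr _ _, ?_, ?_, rfl⟩
    · simp [Instr.apply, Expr.eval, h.1]
    · intro r hr; simp [Instr.apply, hr.ne]
  | add e f ihe ihf =>
    intro b σ μ hb h
    obtain ⟨σ₁, h₁, e₁, k₁, a₁⟩ := ihe hb h
    have r₁ : Represents ρ α σ₁ μ := ⟨fun v => (k₁ _ (hb v)).trans (h.1 v), by rw [a₁]; exact h.2⟩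
    obtain ⟨σ₂, h₂, e₂, k₂, a₂⟩ := ihf (b := b + 1) (fun v => (hb v).trans b.lt_succ_self) r₁
    refine ⟨_, .seq h₁ (.seq h₂ (.instr _ _)), ?_, ?_, a₂.trans a₁⟩
    · simp [Instr.apply, Expr.eval, e₂, k₂ b b.lt_succ_self, e₁]
    · intro r hr
      simp [Instr.apply, hr.ne, k₂ r (hr.trans b.lt_succ_self), k₁ r hr]
  | sub e f ihe ihf =>
    intro b σ μ hb h
    obtain ⟨σ₁, h₁, e₁, k₁, a₁⟩ := ihe hb h
    have r₁ : Represents ρ α σ₁ μ := ⟨fun v => (k₁ _ (hb v)).trans (h.1 v), by rw [a₁]; exact h.2⟩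
    obtain ⟨σ₂, h₂, e₂, k₂, a₂⟩ := ihf (b := b + 1) (fun v => (hb v).trans b.lt_succ_self) r₁
    refine ⟨_, .seq h₁ (.seq h₂ (.instr _ _)), ?_, ?_, a₂.trans a₁⟩
    · simp [Instr.apply, Expr.eval, e₂, k₂ b b.lt_succ_self, e₁]
    · intro r hr
      simp [Instr.apply, hr.ne, k₂ r (hr.trans b.lt_succ_self), k₁ r hr]
  | get a e ihe =>
    intro b σ μ hb h
    obtain ⟨σ₁, h₁, e₁, k₁, a₁⟩ := ihe hb h
    refine ⟨_, .seq h₁ (.instr _ _), ?_, ?_, a₁⟩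
    · simp [Instr.apply, Expr.eval, e₁, a₁, h.2]
    · intro r hr; simp [Instr.apply, hr.ne, k₁ r hr]

/-- Evaluation of two expressions into consecutive registers. -/
theorem Expr.exec_code_pair {ρ : ι → ℕ} {α : κ → ℕ} (e f : Expr ι κ) {b : ℕ} {σ : State}
    {μ : Mem ι κ} (hb : ∀ v, ρ v < b) (h : Represents ρ α σ μ) :
    ∃ σ₁ σ₂, Exec (e.code ρ α b) σ e.cost σ₁ ∧ Exec (f.code ρ α (b + 1)) σ₁ f.cost σ₂ ∧
      σ₂.reg b = e.eval μ ∧ σ₂.reg (b + 1) = f.eval μ ∧ (∀ r < b, σ₂.reg r = σ.reg r) ∧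
      Represents ρ α σ₂ μ := by
  obtain ⟨σ₁, h₁, e₁, k₁, a₁⟩ := e.exec_code hb h
  have r₁ : Represents ρ α σ₁ μ := ⟨fun v => (k₁ _ (hb v)).trans (h.1 v), by rw [a₁]; exact h.2⟩
  obtain ⟨σ₂, h₂, e₂, k₂, a₂⟩ :=
    f.exec_code (b := b + 1) (fun v => (hb v).trans b.lt_succ_self) r₁
  exact ⟨σ₁, σ₂, h₁, h₂, (k₂ b b.lt_succ_self).trans e₁, e₂,
    fun r hr => (k₂ r (hr.trans b.lt_succ_self)).trans (k₁ r hr),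
    fun v => (k₂ _ ((hb v).trans b.lt_succ_self)).trans (r₁.1 v), by rw [a₂]; exact r₁.2⟩

section Compile

variable [DecidableEq ι] [DecidableEq κ] {ρ : ι → ℕ} {α : κ → ℕ}

theorem Represents.setReg (hρ : Function.Injective ρ) {σ : State} {μ : Mem ι κ}
    (h : Represents ρ α σ μ) (v : ι) (x : ℕ) :
    Represents ρ α { σ with reg := Function.update σ.reg (ρ v) x } (μ.setReg v x) := by
  refine ⟨fun w => ?_, h.2⟩
  simp [Function.update_apply, hρ.eq_iff, h.1]

theorem Represents.setArr (hα : Function.Injective α) {σ : State} {μ : Mem ι κ}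
    (h : Represents ρ α σ μ) (a : κ) (i x : ℕ) :
    Represents ρ α
      { σ with arr := Function.update σ.arr (α a) (Function.update (σ.arr (α a)) i x) }
      (μ.setArr a i x) := by
  refine ⟨h.1, fun c => ?_⟩
  funext j
  by_cases hc : c = a
  · subst hc; simp [h.2, Function.update_apply]
  · simp [hα.eq_iff, hc, h.2]

theorem Represents.of_eq {σ σ' : State} {μ : Mem ι κ} (h : Represents ρ α σ μ) {b : ℕ}
    (hb : ∀ v, ρ v < b) (hr : ∀ r < b, σ'.reg r = σ.reg r) (ha : σ'.arr = σ.arr) :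
    Represents ρ α σ' μ :=
  ⟨fun v => (hr _ (hb v)).trans (h.1 v), by rw [ha]; exact h.2⟩

/-- The compiled code has the effect and the running time of the statement. -/
theorem Stmt.exec_code (hρ : Function.Injective ρ) (hα : Function.Injective α) (P : Stmt ι κ) :
    ∀ {b : ℕ} {σ : State} {μ : Mem ι κ}, (∀ v, ρ v < b) → Represents ρ α σ μ →
      ∃ σ', Exec (P.code ρ α b) σ (P.time μ) σ' ∧ Represents ρ α σ' (P.run μ) ∧
        ∀ r < b, (∀ v, r ≠ ρ v) → σ'.reg r = σ.reg r := by
  induction P with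
  | skip =>
    intro b σ μ hb h
    refine ⟨_, .instr _ _, ?_, ?_⟩
    · simpa [Instr.apply, Stmt.run] using h
    · intro r hr _; simp [Instr.apply]
  | set v e =>
    intro b σ μ hb h
    obtain ⟨σ₁, h₁, e₁, k₁, a₁⟩ := e.exec_code hb h
    refine ⟨_, .seq h₁ (.instr _ _), ?_, ?_⟩
    · simpa [Instr.apply, Stmt.run, e₁] using (h.of_eq hb k₁ a₁).setReg hρ v (e.eval μ)
    · intro r hr hv; simp [Instr.apply, hv v, k₁ r hr]
  | put a i e =>
    intro b σ μ hb h
    obtain ⟨σ₁, σ₂, h₁, h₂, e₁, e₂, k₂, r₂⟩ := Expr.exec_code_pair i e hb h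
    refine ⟨_, .seq h₁ (.seq h₂ (.instr _ _)), ?_, ?_⟩
    · simpa [Instr.apply, Stmt.run, e₁, e₂] using r₂.setArr hα a (i.eval μ) (e.eval μ)
    · intro r hr _; simp [Instr.apply, k₂ r hr]
  | seq P Q ihP ihQ =>
    intro b σ μ hb h
    obtain ⟨σ₁, h₁, r₁, k₁⟩ := ihP hb h
    obtain ⟨σ₂, h₂, r₂, k₂⟩ := ihQ hb r₁
    exact ⟨σ₂, .seq h₁ h₂, r₂, fun r hr hv => (k₂ r hr hv).trans (k₁ r hr hv)⟩
  | ifEq e f P Q ihP ihQ =>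
    intro b σ μ hb h
    obtain ⟨σ₁, σ₂, h₁, h₂, e₁, e₂, k₂, r₂⟩ := Expr.exec_code_pair e f hb h
    by_cases hc : e.eval μ = f.eval μ
    · obtain ⟨σ₃, h₃, r₃, k₃⟩ := ihP hb r₂
      refine ⟨σ₃, ?_, by simpa [Stmt.run, Mem.ifEq, Mem.ifLt, hc] using r₃,
        fun r hr hv => (k₃ r hr hv).trans (k₂ r hr)⟩
      simp only [Stmt.time, hc, if_true]
      exact .seq h₁ (.seq h₂ (.cond_true (by simp [Test.Holds, e₁, e₂, hc]) h₃))
    · obtain ⟨σ₃, h₃, r₃, k₃⟩ := ihQ hb r₂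
      refine ⟨σ₃, ?_, by simpa [Stmt.run, Mem.ifEq, Mem.ifLt, hc] using r₃,
        fun r hr hv => (k₃ r hr hv).trans (k₂ r hr)⟩
      simp only [Stmt.time, hc, if_false]
      exact .seq h₁ (.seq h₂ (.cond_false (by simp [Test.Holds, e₁, e₂, hc]) h₃))
  | ifLt e f P Q ihP ihQ =>
    intro b σ μ hb h
    obtain ⟨σ₁, σ₂, h₁, h₂, e₁, e₂, k₂, r₂⟩ := Expr.exec_code_pair e f hb h
    by_cases hc : e.eval μ < f.eval μ
    · obtain ⟨σ₃, h₃, r₃, k₃⟩ := ihP hb r₂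
      refine ⟨σ₃, ?_, by simpa [Stmt.run, Mem.ifEq, Mem.ifLt, hc] using r₃,
        fun r hr hv => (k₃ r hr hv).trans (k₂ r hr)⟩
      simp only [Stmt.time, hc, if_true]
      exact .seq h₁ (.seq h₂ (.cond_true (by simp [Test.Holds, e₁, e₂, hc]) h₃))
    · obtain ⟨σ₃, h₃, r₃, k₃⟩ := ihQ hb r₂
      refine ⟨σ₃, ?_, by simpa [Stmt.run, Mem.ifEq, Mem.ifLt, hc] using r₃,
        fun r hr hv => (k₃ r hr hv).trans (k₂ r hr)⟩
      simp only [Stmt.time, hc, if_false]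
      exact .seq h₁ (.seq h₂ (.cond_false (by simpa [Test.Holds, e₁, e₂] using hc) h₃))
  | for_ v e P ih =>
    intro b σ μ hb h
    obtain ⟨σ₁, h₁, e₁, k₁, a₁⟩ := e.exec_code hb h
    set N := e.eval μ with hN
    let body : Program := .seq (.instr (.copy (ρ v) (b + 1))) (.seq (P.code ρ α (b + 2))
        (.seq (.instr (.const (b + 2) 1)) (.instr (.add (b + 1) (b + 1) (b + 2)))))
    have hb2 : ∀ v, ρ v < b + 2 := fun v => (hb v).trans (by omega)
    have hb0 : ∀ v, ρ v ≠ b := fun v => (hb v).ne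
    have hb1 : ∀ v, ρ v ≠ b + 1 := fun v => by have := hb v; omega
    -- Induction on the number `i` of iterations that remain. The limit and the counter sit in `b`
    -- and `b + 1`, and the body uses temporaries from `b + 2` on, so nothing it assigns changes the
    -- number of iterations.
    have key : ∀ i, i ≤ N → ∀ τ : State,
        Represents ρ α τ (iterate v P.run μ (N - i)) → τ.reg b = N → τ.reg (b + 1) = N - i →
        ∃ τ', Exec (.loop (.lt (b + 1) b) body) τ ((∑ j ∈ Finset.Ico (N - i) N,
            (P.time ((iterate v P.run μ j).setReg v j) + 4)) + 1) τ' ∧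
          Represents ρ α τ' (iterate v P.run μ N) ∧
          ∀ r < b, (∀ v, r ≠ ρ v) → τ'.reg r = τ.reg r := by
      intro i
      induction i with
      | zero =>
        intro _ τ hτ hτb hτc
        refine ⟨τ, ?_, by simpa using hτ, fun _ _ _ => rfl⟩
        simpa using Exec.loop_false (by simp [Test.Holds, hτb, hτc])
      | succ i ihi =>
        intro hi τ hτ hτb hτc
        set j := N - (i + 1) with hj
        have hjN : j < N := by omega
        have hj1 : j + 1 = N - i := by omega
        have s₁ := hτ.setReg hρ v j
        obtain ⟨τ₂, x₂, s₂, l₂⟩ := ih hb2 s₁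
        have hτ₂b : τ₂.reg b = N := by
          rw [l₂ b (by omega) fun w => (hb0 w).symm]
          simp [(hb0 v).symm, hτb]
        have hτ₂c : τ₂.reg (b + 1) = j := by
          rw [l₂ (b + 1) (by omega) fun w => (hb1 w).symm]
          simp [(hb1 v).symm, hτc]
        set τ₄ : State := Instr.apply (Instr.apply τ₂ (.const (b + 2) 1))
          (.add (b + 1) (b + 1) (b + 2)) with hτ₄
        have k₄ : ∀ r < b, τ₄.reg r = τ₂.reg r := by
          intro r hr
          simp [hτ₄, Instr.apply, show r ≠ b + 1 by omega,
            show r ≠ b + 2 by omega]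
        have s₄ : Represents ρ α τ₄ (iterate v P.run μ (j + 1)) := s₂.of_eq hb k₄ rfl
        obtain ⟨τ₅, x₅, s₅, l₅⟩ := ihi (by omega) τ₄ (hj1 ▸ s₄)
          (by simp [hτ₄, Instr.apply, hτ₂b])
          (by simp [hτ₄, Instr.apply, hτ₂c]; omega)
        refine ⟨τ₅, ?_, s₅, ?_⟩
        -- Copying the counter, loading `1` and adding take three units; the loop test is the fourth
        -- unit in the `+ 4` of `Stmt.time`.
        · have xb : Exec body τ (P.time ((iterate v P.run μ j).setReg v j) + 3) τ₄ := by
            have x₁ : Exec (.instr (.copy (ρ v) (b + 1))) τ 1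
                { τ with reg := Function.update τ.reg (ρ v) j } := by
              have := Exec.instr (.copy (ρ v) (b + 1)) τ
              simpa [Instr.apply, hτc] using this
            have := Exec.seq x₁ (.seq x₂ (.seq (.instr (.const (b + 2) 1) _)
              (.instr (.add (b + 1) (b + 1) (b + 2)) _)))
            convert this using 1
            omega
          have := Exec.loop_true (b := .lt (b + 1) b) (by simp [Test.Holds, hτb, hτc, hjN]) xb x₅
          convert this using 1
          rw [← Finset.add_sum_Ioo_eq_sum_Ico hjN, ← hj1]
          have : Finset.Ioo j N = Finset.Ico (j + 1) N := by ext; simp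
          rw [this]; ring
        · intro r hr hv
          rw [l₅ r hr hv, k₄ r hr, l₂ r (by omega) hv]
          simp [hv v]
    set σ₂ : State := Instr.apply σ₁ (.const (b + 1) 0) with hσ₂
    have k₂ : ∀ r < b, σ₂.reg r = σ₁.reg r := by
      intro r hr; simp [hσ₂, Instr.apply, show r ≠ b + 1 by omega]
    obtain ⟨σ₃, x₃, r₃, k₃⟩ := key N le_rfl σ₂
      (by simpa [iterate] using (h.of_eq hb k₁ a₁).of_eq hb k₂ rfl)
      (by simp [hσ₂, Instr.apply, e₁])
      (by simp [hσ₂, Instr.apply])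
    refine ⟨σ₃, ?_, r₃, fun r hr hv => (k₃ r hr hv).trans ((k₂ r hr).trans (k₁ r hr))⟩
    rw [Nat.sub_self, Nat.Ico_zero_eq_range] at x₃
    exact .seq h₁ (.seq (.instr _ _) x₃)

end Compile

end RAM

namespace RAM
variable {ι κ : Type}
variable [DecidableEq ι] [DecidableEq κ]

/-! ### Reasoning about statements -/

/-- Whether a statement assigns to the variable `v`. -/
def Stmt.setsReg (v : ι) : Stmt ι κ → Bool
  | .skip => false
  | .set w _ => v = w
  | .put _ _ _ => false
  | .seq P Q => P.setsReg v || Q.setsReg v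
  | .ifEq _ _ P Q => P.setsReg v || Q.setsReg v
  | .ifLt _ _ P Q => P.setsReg v || Q.setsReg v
  | .for_ w _ P => decide (v = w) || P.setsReg v

/-- Whether a statement assigns to the array `a`. -/
def Stmt.setsArr (a : κ) : Stmt ι κ → Bool
  | .skip => false
  | .set _ _ => false
  | .put b _ _ => a = b
  | .seq P Q => P.setsArr a || Q.setsArr a
  | .ifEq _ _ P Q => P.setsArr a || Q.setsArr a
  | .ifLt _ _ P Q => P.setsArr a || Q.setsArr a
  | .for_ _ _ P => P.setsArr a

/-- Whether a statement has no loops. -/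
def Stmt.loopFree : Stmt ι κ → Bool
  | .skip => true
  | .set _ _ => true
  | .put _ _ _ => true
  | .seq P Q => P.loopFree && Q.loopFree
  | .ifEq _ _ P Q => P.loopFree && Q.loopFree
  | .ifLt _ _ P Q => P.loopFree && Q.loopFree
  | .for_ _ _ _ => false

/-- A bound for the running time of a statement without loops. -/
def Stmt.bound : Stmt ι κ → ℕ
  | .skip => 1
  | .set _ e => e.cost + 1
  | .put _ i e => i.cost + (e.cost + 1)
  | .seq P Q => P.bound + Q.bound
  | .ifEq e f P Q => e.cost + (f.cost + (1 + max P.bound Q.bound))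
  | .ifLt e f P Q => e.cost + (f.cost + (1 + max P.bound Q.bound))
  | .for_ _ _ _ => 0

theorem Stmt.time_le_bound (P : Stmt ι κ) (μ : Mem ι κ) (h : P.loopFree = true) :
    P.time μ ≤ P.bound := by
  induction P generalizing μ with
  | skip => exact le_rfl
  | set v e => exact le_rfl
  | put a i e => exact le_rfl
  | seq P Q ihP ihQ =>
    simp only [Stmt.loopFree, Bool.and_eq_true] at h
    exact add_le_add (ihP _ h.1) (ihQ _ h.2)
  | ifEq e f P Q ihP ihQ =>
    simp only [Stmt.loopFree, Bool.and_eq_true] at h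
    have := ihP μ h.1
    have := ihQ μ h.2
    simp only [Stmt.time, Stmt.bound]
    split_ifs <;> omega
  | ifLt e f P Q ihP ihQ =>
    simp only [Stmt.loopFree, Bool.and_eq_true] at h
    have := ihP μ h.1
    have := ihQ μ h.2
    simp only [Stmt.time, Stmt.bound]
    split_ifs <;> omega
  | for_ v e P _ => simp [Stmt.loopFree] at h

/-- `ν` agrees with `μ` except where the statement `P` may have changed it. -/
def Frame (P : Stmt ι κ) (μ ν : Mem ι κ) : Prop :=
  (∀ v, P.setsReg v = false → ν.reg v = μ.reg v) ∧ ∀ a, P.setsArr a = false → ν.arr a = μ.arr a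

theorem Frame.refl (P : Stmt ι κ) (μ : Mem ι κ) : Frame P μ μ := ⟨fun _ _ => rfl, fun _ _ => rfl⟩

theorem Frame.trans {P : Stmt ι κ} {μ ν ξ : Mem ι κ} (h : Frame P μ ν) (h' : Frame P ν ξ) :
    Frame P μ ξ :=
  ⟨fun v hv => (h'.1 v hv).trans (h.1 v hv), fun a ha => (h'.2 a ha).trans (h.2 a ha)⟩

theorem Frame.mono {P Q : Stmt ι κ} {μ ν : Mem ι κ} (h : Frame P μ ν)
    (hr : ∀ v, Q.setsReg v = false → P.setsReg v = false)
    (ha : ∀ a, Q.setsArr a = false → P.setsArr a = false) : Frame Q μ ν :=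
  ⟨fun v hv => h.1 v (hr v hv), fun a h' => h.2 a (ha a h')⟩

theorem Frame.iterate {P : Stmt ι κ} {v : ι} {e : Expr ι κ} {μ : Mem ι κ}
    (h : ∀ ν, Frame P ν (P.run ν)) (j : ℕ) : Frame (.for_ v e P) μ (iterate v P.run μ j) := by
  induction j with
  | zero => exact Frame.refl _ _
  | succ j ih =>
    refine ih.trans ⟨fun w hw => ?_, fun a ha => ?_⟩
    · simp only [Stmt.setsReg, Bool.or_eq_false_iff, decide_eq_false_iff_not] at hw
      rw [RAM.iterate, (h _).1 w hw.2]
      simp [hw.1]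
    · rw [RAM.iterate, (h _).2 a ha]
      rfl

/-- The sets of assigned names are computed from the syntax, so preservation of an untouched
variable or array is later settled by `rfl` or `decide`. -/
theorem Stmt.frame_run (P : Stmt ι κ) (μ : Mem ι κ) : Frame P μ (P.run μ) := by
  induction P generalizing μ with
  | skip => exact Frame.refl _ _
  | set v e => exact ⟨fun w hw => by simp_all [Stmt.run, Stmt.setsReg], fun _ _ => rfl⟩
  | put b i e =>
    refine ⟨fun _ _ => rfl, fun a ha => ?_⟩
    funext j
    simp_all [Stmt.run, Stmt.setsArr]
  | seq P Q ihP ihQ =>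
    refine Frame.trans ((ihP μ).mono ?_ ?_) ((ihQ _).mono ?_ ?_) <;>
      simp +contextual [Stmt.setsReg, Stmt.setsArr]
  | ifEq e f P Q ihP ihQ =>
    simp only [Stmt.run, Mem.ifEq]
    split_ifs
    · refine (ihP μ).mono ?_ ?_ <;> simp +contextual [Stmt.setsReg, Stmt.setsArr]
    · refine (ihQ μ).mono ?_ ?_ <;> simp +contextual [Stmt.setsReg, Stmt.setsArr]
  | ifLt e f P Q ihP ihQ =>
    simp only [Stmt.run, Mem.ifLt]
    split_ifs
    · refine (ihP μ).mono ?_ ?_ <;> simp +contextual [Stmt.setsReg, Stmt.setsArr]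
    · refine (ihQ μ).mono ?_ ?_ <;> simp +contextual [Stmt.setsReg, Stmt.setsArr]
  | for_ v e P ih => exact Frame.iterate ih _

/-- Started in `μ`, the statement `P` takes time at most `T` and reaches a memory with `Q`. -/
def Tri (P : Stmt ι κ) (μ : Mem ι κ) (T : ℕ) (Q : Mem ι κ → Prop) : Prop :=
  P.time μ ≤ T ∧ Q (P.run μ)

variable {P P' : Stmt ι κ} {μ : Mem ι κ} {T T' : ℕ} {Q Q' : Mem ι κ → Prop}

theorem Tri.mono (h : Tri P μ T Q) (hT : T ≤ T') (hQ : ∀ ν, Frame P μ ν → Q ν → Q' ν) :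
    Tri P μ T' Q' :=
  ⟨h.1.trans hT, hQ _ (P.frame_run μ) h.2⟩

theorem Tri.seq (h : Tri P μ T fun ν => Frame P μ ν → Tri P' ν T' Q) :
    Tri (P ;; P') μ (T + T') Q :=
  ⟨add_le_add h.1 (h.2 (P.frame_run μ)).1, (h.2 (P.frame_run μ)).2⟩

theorem Tri.seq' (h : Tri P μ T Q') (h' : ∀ ν, Frame P μ ν → Q' ν → Tri P' ν T' Q) :
    Tri (P ;; P') μ (T + T') Q :=
  Tri.seq (h.mono le_rfl fun ν f q _ => h' ν f q)

theorem Tri.seq_le {U : ℕ} (h : Tri P μ T Q') (h' : ∀ ν, Frame P μ ν → Q' ν → Tri P' ν T' Q)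
    (hU : T + T' ≤ U) : Tri (P ;; P') μ U Q :=
  (Tri.seq' h h').mono hU fun _ _ h => h

/-- For loop-free code the time bound is a mere computation, and only the effect of the run is left
to prove. -/
theorem Tri.leaf (hQ : Q (P.run μ)) (h : P.loopFree = true := by decide)
    (hT : P.bound ≤ T := by decide) : Tri P μ T Q :=
  ⟨(P.time_le_bound μ h).trans hT, hQ⟩

theorem Tri.ifEq {e f : Expr ι κ} (h : e.eval μ = f.eval μ → Tri P μ T Q)
    (h' : e.eval μ ≠ f.eval μ → Tri P' μ T Q) :
    Tri (.ifEq e f P P') μ (e.cost + (f.cost + (1 + T))) Q := by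
  by_cases hc : e.eval μ = f.eval μ
  · have := h hc
    exact ⟨by simpa [Stmt.time, hc] using this.1, by simpa [Stmt.run, Mem.ifEq, Mem.ifLt, hc] using this.2⟩
  · have := h' hc
    exact ⟨by simpa [Stmt.time, hc] using this.1, by simpa [Stmt.run, Mem.ifEq, Mem.ifLt, hc] using this.2⟩

theorem Tri.ifLt {e f : Expr ι κ} (h : e.eval μ < f.eval μ → Tri P μ T Q)
    (h' : f.eval μ ≤ e.eval μ → Tri P' μ T Q) :
    Tri (.ifLt e f P P') μ (e.cost + (f.cost + (1 + T))) Q := by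
  by_cases hc : e.eval μ < f.eval μ
  · have := h hc
    exact ⟨by simpa [Stmt.time, hc] using this.1, by simpa [Stmt.run, Mem.ifEq, Mem.ifLt, hc] using this.2⟩
  · have := h' (not_lt.1 hc)
    exact ⟨by simpa [Stmt.time, hc] using this.1, by simpa [Stmt.run, Mem.ifEq, Mem.ifLt, hc] using this.2⟩

/-- The rule for loops whose invariant keeps track of the time spent so far. -/
theorem Tri.for_time {v : ι} {e : Expr ι κ} (I : ℕ → ℕ → Mem ι κ → Prop) (h0 : I 0 0 μ)
    (hs : ∀ j c ν, j < e.eval μ → Frame (.for_ v e P) μ ν → I j c ν →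
      ∃ T, Tri P (ν.setReg v j) T fun ξ => I (j + 1) (c + T + 4) ξ)
    (hQ : ∀ c ν, Frame (.for_ v e P) μ ν → I (e.eval μ) c ν → c + (e.cost + 2) ≤ T ∧ Q ν) :
    Tri (.for_ v e P) μ T Q := by
  have key : ∀ j ≤ e.eval μ, ∃ c, (∑ i ∈ Finset.range j,
      (P.time ((iterate v P.run μ i).setReg v i) + 4)) ≤ c ∧ I j c (iterate v P.run μ j) := by
    intro j
    induction j with
    | zero => exact fun _ => ⟨0, by simp, h0⟩
    | succ j ih =>
      intro hj
      obtain ⟨c, hc, hI⟩ := ih (by omega)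
      obtain ⟨T, hT⟩ := hs j c _ (by omega) (Frame.iterate P.frame_run j) hI
      refine ⟨c + T + 4, ?_, hT.2⟩
      rw [Finset.sum_range_succ]
      have := hT.1
      omega
  obtain ⟨c, hc, hI⟩ := key _ le_rfl
  obtain ⟨h₁, h₂⟩ := hQ c _ (Frame.iterate P.frame_run _) hI
  refine ⟨?_, h₂⟩
  simp only [Stmt.time]
  omega

/-- The rule for loops whose body takes time at most `T`. -/
theorem Tri.for {v : ι} {e : Expr ι κ} {N : ℕ} (I : ℕ → Mem ι κ → Prop) (T : ℕ)
    (hN : e.eval μ = N) (hT : N * (T + 4) + (e.cost + 2) ≤ T') (h0 : I 0 μ)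
    (hs : ∀ j ν, j < N → Frame (.for_ v e P) μ ν → I j ν → Tri P (ν.setReg v j) T (I (j + 1)))
    (hQ : ∀ ν, Frame (.for_ v e P) μ ν → I N ν → Q ν) :
    Tri (.for_ v e P) μ T' Q := by
  subst hN
  refine Tri.for_time (fun j c ν => c = j * (T + 4) ∧ I j ν) ⟨by simp, h0⟩ ?_ ?_
  · rintro j c ν hj hf ⟨rfl, hI⟩
    exact ⟨T, (hs j ν hj hf hI).mono le_rfl fun ξ _ h => ⟨by ring, h⟩⟩
  · rintro c ν hf ⟨rfl, hI⟩
    exact ⟨hT, hQ ν hf hI⟩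

end RAM

/-! ### Ramsey numbers -/

section Ramsey

/-- The Erdős–Szekeres recursion on neighbours and non-neighbours of one vertex. Finiteness has to
be shown because the infimum of the empty set would be `0`. -/
theorem exists_ramsey_bound (k l : ℕ) : ∃ N : ℕ, ∀ (V : Type) (G : SimpleGraph V) (X : Finset V),
    N ≤ X.card → (∃ A ⊆ X, G.IsNClique k A) ∨ ∃ A ⊆ X, G.IsNIndepSet l A := by
  classical
  induction k generalizing l with
  | zero => exact ⟨0, fun V G X _ => .inl ⟨∅, by simp, by simp [SimpleGraph.isNClique_iff]⟩⟩
  | succ k ihk =>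
    induction l with
    | zero => exact ⟨0, fun V G X _ => .inr ⟨∅, by simp, ⟨by simp, by simp⟩⟩⟩
    | succ l ihl =>
      obtain ⟨N₁, h₁⟩ := ihk (l + 1)
      obtain ⟨N₂, h₂⟩ := ihl
      refine ⟨N₁ + N₂ + 1, fun V G X hX => ?_⟩
      obtain ⟨v, hv⟩ : X.Nonempty := Finset.card_pos.1 (by omega)
      have hsplit := Finset.card_filter_add_card_filter_not (s := X.erase v) (G.Adj v)
      rw [Finset.card_erase_of_mem hv] at hsplit
      rcases le_or_gt N₁ ((X.erase v).filter (G.Adj v)).card with h | h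
      · rcases h₁ V G _ h with ⟨A, hA, hc⟩ | ⟨A, hA, hc⟩
        · refine .inl ⟨insert v A, ?_, hc.insert fun b hb => (Finset.mem_filter.1 (hA hb)).2⟩
          refine Finset.insert_subset hv fun x hx => ?_
          exact Finset.mem_of_mem_erase (Finset.mem_filter.1 (hA hx)).1
        · exact .inr ⟨A, fun x hx => Finset.mem_of_mem_erase (Finset.mem_filter.1 (hA hx)).1, hc⟩
      · rcases h₂ V G ((X.erase v).filter fun x => ¬ G.Adj v x) (by omega) with
          ⟨A, hA, hc⟩ | ⟨A, hA, hc⟩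
        · exact .inl ⟨A, fun x hx => Finset.mem_of_mem_erase (Finset.mem_filter.1 (hA hx)).1, hc⟩
        · refine .inr ⟨insert v A, ?_, ?_⟩
          · refine Finset.insert_subset hv fun x hx => ?_
            exact Finset.mem_of_mem_erase (Finset.mem_filter.1 (hA hx)).1
          · rw [← SimpleGraph.isNClique_compl] at hc ⊢
            refine hc.insert fun b hb => ?_
            have := Finset.mem_filter.1 (hA hb)
            exact (SimpleGraph.compl_adj _ _ _).2 ⟨(Finset.ne_of_mem_erase this.1).symm, this.2⟩

theorem ramseyNumber_mem (k l : ℕ) :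
    ramseyNumber k l ∈ {N : ℕ | ∀ n : ℕ, N ≤ n → ∀ G : SimpleGraph (Fin n),
      (∃ A : Finset (Fin n), G.IsNClique k A) ∨ (∃ A : Finset (Fin n), G.IsNIndepSet l A)} := by
  refine Nat.sInf_mem ?_
  obtain ⟨N, hN⟩ := exists_ramsey_bound k l
  refine ⟨N, fun n hn G => ?_⟩
  rcases hN _ G Finset.univ (by simpa using hn) with ⟨A, -, h⟩ | ⟨A, -, h⟩
  · exact .inl ⟨A, h⟩
  · exact .inr ⟨A, h⟩

/-- In a graph without `k`-cliques, large sets of vertices contain independent sets of size `l`. -/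
theorem exists_isNIndepSet_of_ramseyNumber_le {V : Type*} {G : SimpleGraph V} {k l : ℕ}
    (hG : G.CliqueFree k) {X : Finset V} (hX : ramseyNumber k l ≤ X.card) :
    ∃ A ⊆ X, G.IsNIndepSet l A := by
  classical
  let f : Fin X.card ↪ V := X.equivFin.symm.toEmbedding.trans (Function.Embedding.subtype _)
  have hf : ∀ i, f i ∈ X := fun i => (X.equivFin.symm i).2
  rcases ramseyNumber_mem k l X.card hX (G.comap f) with ⟨A, hA⟩ | ⟨A, hA⟩
  · refine absurd ?_ (hG (A.map f))
    refine ⟨?_, by simpa using hA.card_eq⟩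
    rintro _ hx _ hy hxy
    obtain ⟨x, hx', rfl⟩ := Finset.mem_map.1 (Finset.mem_coe.1 hx)
    obtain ⟨y, hy', rfl⟩ := Finset.mem_map.1 (Finset.mem_coe.1 hy)
    exact hA.isClique (Finset.mem_coe.2 hx') (Finset.mem_coe.2 hy') fun h => hxy (by rw [h])
  · refine ⟨A.map f, ?_, ?_, by simpa using hA.card_eq⟩
    · intro x hx
      obtain ⟨x, -, rfl⟩ := Finset.mem_map.1 hx
      exact hf x
    · rintro _ hx _ hy hxy
      obtain ⟨x, hx', rfl⟩ := Finset.mem_map.1 (Finset.mem_coe.1 hx)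
      obtain ⟨y, hy', rfl⟩ := Finset.mem_map.1 (Finset.mem_coe.1 hy)
      exact hA.isIndepSet (Finset.mem_coe.2 hx') (Finset.mem_coe.2 hy') fun h => hxy (by rw [h])

theorem lt_ramseyNumber {k l m : ℕ} {G : SimpleGraph (Fin m)} (hk : G.CliqueFree k)
    (hl : ∀ A, ¬ G.IsNIndepSet l A) : m < ramseyNumber k l := by
  by_contra! h
  rcases ramseyNumber_mem k l m h G with ⟨A, hA⟩ | ⟨A, hA⟩
  · exact hk A hA
  · exact hl A hA

theorem ramseyNumber_four_one : ramseyNumber 4 1 = 1 := by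
  refine le_antisymm (Nat.sInf_le fun n hn G => .inr ⟨{⟨0, hn⟩}, by simp, by simp⟩) ?_
  refine lt_ramseyNumber (m := 0) (G := ⊥) (fun A hA => ?_) fun A hA => ?_
  · have := hA.card_eq
    simp [Finset.eq_empty_of_isEmpty A] at this
  · have := hA.card_eq
    simp [Finset.eq_empty_of_isEmpty A] at this

theorem four_le_ramseyNumber {l : ℕ} (hl : 2 ≤ l) : 4 ≤ ramseyNumber 4 l := by
  refine lt_ramseyNumber (m := 3) (G := ⊤) (fun A hA => ?_) fun A hA => ?_
  · have := A.card_le_univ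
    simp [hA.card_eq] at this
  · obtain ⟨x, hx, y, hy, hxy⟩ := Finset.one_lt_card.1 (by rw [hA.card_eq]; omega : 1 < A.card)
    exact hA.isIndepSet hx hy hxy hxy

/-- The factor `4` is what the time analysis in `guess_time_le` consumes. The nested Ramsey number
`R` is `1` for `s = 1` and at least `4` otherwise, and for `R ≥ 4` one of the factors `1 + R` of the
right side absorbs the `4`. The summand `4` covers `R = 1` and `t ≤ 2`. -/
theorem four_mul_pow_le_domBound {s : ℕ} (hs : 1 ≤ s) (t : ℕ) :
    4 * ramseyNumber 4 (ramseyNumber 4 s) ^ (t - 3) ≤ domBound s t + 4 := by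
  unfold domBound
  set R := ramseyNumber 4 (ramseyNumber 4 s) with hR
  have h : R = 1 ∨ 4 ≤ R := by
    rcases hs.eq_or_lt with rfl | hs
    · left; rw [hR, ramseyNumber_four_one, ramseyNumber_four_one]
    · right; exact four_le_ramseyNumber (le_trans (by norm_num) (four_le_ramseyNumber hs))
  rcases h with h | h
  · simp [h]
  · rcases Nat.lt_or_ge t 3 with ht | ht
    · simp [Nat.sub_eq_zero_of_le ht.le]
    · obtain ⟨m, rfl⟩ := Nat.exists_eq_add_of_le ht
      have : R ^ m ≤ (1 + R) ^ m := Nat.pow_le_pow_left (by omega) m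
      have h2 : (1 + R) ^ (3 + m - 2) = (1 + R) ^ m * (1 + R) := by
        rw [← pow_succ]; congr 1; omega
      rw [h2, show 3 + m - 3 = m by omega, mul_comm ((1 + R) ^ m)]
      exact (Nat.mul_le_mul (by omega) this).trans (Nat.le_add_right _ _)

end Ramsey

/-! ### Minimal connected dominating sets -/

namespace SimpleGraph

variable {V : Type*} {G : SimpleGraph V} {S S' : Set V} {r u v w : V}

/-- The graph `G` with all edges removed that are not inside `S`. -/
def within (G : SimpleGraph V) (S : Set V) : SimpleGraph V where
  Adj u v := G.Adj u v ∧ u ∈ S ∧ v ∈ S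
  symm := ⟨fun _ _ h => ⟨h.1.symm, h.2.2, h.2.1⟩⟩
  loopless := ⟨fun _ h => h.1.ne rfl⟩

/-- The vertices that can be reached from `r` inside `S`. -/
def reach (G : SimpleGraph V) (S : Set V) (r : V) : Set V := {v | (G.within S).Reachable r v}

theorem self_mem_reach : r ∈ G.reach S r := Reachable.refl r

theorem reach_step (hu : u ∈ G.reach S r) (h : G.Adj u v) (hS : u ∈ S) (hS' : v ∈ S) :
    v ∈ G.reach S r :=
  Reachable.trans hu (Adj.reachable ⟨h, hS, hS'⟩)

/-- The induction principle for reachability: closed sets replace explicit walks. -/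
theorem reach_subset_of_closed {M : Set V} (hr : r ∈ M)
    (h : ∀ u ∈ M, ∀ v ∈ S, u ∈ S → G.Adj u v → v ∈ M) : G.reach S r ⊆ M := by
  rintro v ⟨p⟩
  induction p with
  | nil => exact hr
  | cons hadj _ ih => exact ih (h _ hr _ hadj.2.2 hadj.2.1 hadj.1)

theorem reach_subset (hr : r ∈ S) : G.reach S r ⊆ S :=
  reach_subset_of_closed hr fun _ _ _ h _ _ => h

theorem reach_mono (h : S ⊆ S') : G.reach S r ⊆ G.reach S' r :=
  reach_subset_of_closed self_mem_reach fun _ hu _ hv hu' ha => reach_step hu ha (h hu') (h hv)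

theorem reach_reach : G.reach (G.reach S r) r = G.reach S r :=
  (reach_subset self_mem_reach).antisymm <| reach_subset_of_closed self_mem_reach
    fun _ hu _ hv hu' ha =>
      reach_step hu ha (reach_subset self_mem_reach hu)
        (reach_step (reach_subset self_mem_reach hu) ha hu' hv)

theorem Reachable.exists_adj_dist_eq {H : SimpleGraph V} (h : H.Reachable r v) {k : ℕ}
    (hk : H.dist r v = k + 1) : ∃ u, H.Adj u v ∧ H.Reachable r u ∧ H.dist r u = k := by
  obtain ⟨p, hp⟩ := h.exists_walk_length_eq_dist
  have hq : p.reverse.length = k + 1 := by rw [Walk.length_reverse, hp, hk]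
  cases hc : p.reverse with
  | nil => rw [hc] at hq; simp at hq
  | @cons _ u _ hadj q =>
    rw [hc] at hq
    have hru : H.Reachable r u := ⟨q.reverse⟩
    refine ⟨u, hadj.symm, hru, le_antisymm ?_ ?_⟩
    · have := dist_le q.reverse
      rw [Walk.length_reverse] at this
      simp only [Walk.length_cons, Nat.add_right_cancel_iff] at hq
      omega
    · obtain ⟨q', hq'⟩ := hru.exists_walk_length_eq_dist
      have := dist_le (q'.concat hadj.symm)
      rw [Walk.length_concat] at this
      omega

/-- The set `S` dominates the set `C`. -/
def Dominates (G : SimpleGraph V) (S C : Set V) : Prop := ∀ v ∈ C, ∃ x ∈ S, x = v ∨ G.Adj v x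

theorem Dominates.mono {C : Set V} (h : G.Dominates S C) (hS : S ⊆ S') : G.Dominates S' C :=
  fun v hv => let ⟨x, hx, hxv⟩ := h v hv; ⟨x, hS hx, hxv⟩

/-- `D` is a connected dominating set of `C` containing `r`, and no connected part
of `D` that contains `r` and misses another vertex of `D` is dominating. -/
structure IsMinimalConnectedDominating (G : SimpleGraph V) (C D : Set V) (r : V) : Prop where
  mem : r ∈ D
  connected : D ⊆ G.reach D r
  subset : D ⊆ C
  dominates : G.Dominates D C
  minimal : ∀ u ∈ D, u ≠ r → ¬ G.Dominates (G.reach (D \ {u}) r) C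

namespace IsMinimalConnectedDominating

variable {C D : Set V}

/-- If `D \ {u}` stays connected, it fails to dominate some `w` by minimality, and only `u` can
dominate this `w`. If `u` separates some `x` from `r`, suppose that every neighbour of `u` is
reached or adjacent to a reached vertex. Then all neighbours of `u` in `D` are reached without `u`,
so nothing is separated, a contradiction. In the second case `w` may lie in `D`. -/
theorem exists_private (h : G.IsMinimalConnectedDominating C D r) (hu : u ∈ D) (hur : u ≠ r) :
    ∃ w, G.Adj u w ∧ ∀ x ∈ G.reach (D \ {u}) r, x ≠ w ∧ ¬ G.Adj w x := by
  by_cases hcut : D \ {u} ⊆ G.reach (D \ {u}) r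
  · have hmin := h.minimal u hu hur
    unfold Dominates at hmin
    push Not at hmin
    obtain ⟨w, hwC, hw⟩ := hmin
    obtain ⟨x, hxD, hx⟩ := h.dominates w hwC
    have hxu : x = u := by
      by_contra hxu
      rcases hx with hx | hx
      · exact (hw x (hcut ⟨hxD, hxu⟩)).1 hx
      · exact (hw x (hcut ⟨hxD, hxu⟩)).2 hx
    subst hxu
    rcases hx with rfl | hx
    -- The undominated vertex cannot be `x` itself: its predecessor on a geodesic from `r` lies in
    -- `D \ {x}` and dominates it.
    · obtain ⟨k, hk⟩ : ∃ k, (G.within D).dist r x = k + 1 :=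
        Nat.exists_eq_succ_of_ne_zero
          (by rw [Ne, Reachable.dist_eq_zero_iff (h.connected hu)]; exact hur.symm)
      obtain ⟨p, hp, -, -⟩ := Reachable.exists_adj_dist_eq (h.connected hu) hk
      exact absurd hp.1.symm (hw p (hcut ⟨hp.2.1, hp.ne⟩)).2
    · exact ⟨w, hx.symm, hw⟩
  · obtain ⟨x, hx, hx'⟩ := Set.not_subset.1 hcut
    by_contra! hno
    have key : ∀ y ∈ D, y ≠ u → G.Adj u y → y ∈ G.reach (D \ {u}) r := by
      intro y hy hyu huy
      by_contra hyr
      obtain ⟨z, hz, hz'⟩ := hno y huy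
      by_cases hzy : z = y
      · exact hyr (hzy ▸ hz)
      · refine hyr (reach_step hz (hz' hzy).symm ?_ ⟨hy, hyu⟩)
        exact reach_subset (S := D \ {u}) ⟨h.mem, hur.symm⟩ hz
    have : G.reach D r ⊆ insert u (G.reach (D \ {u}) r) := by
      refine reach_subset_of_closed (Set.mem_insert_of_mem _ self_mem_reach) ?_
      intro a ha b hb haD hab
      by_cases hbu : b = u
      · exact hbu ▸ Set.mem_insert _ _
      rcases ha with rfl | ha
      · exact Set.mem_insert_of_mem _ (key b hb hbu hab)
      · exact Set.mem_insert_of_mem _ (reach_step ha hab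
          (reach_subset (S := D \ {u}) ⟨h.mem, hur.symm⟩ ha) ⟨hb, hbu⟩)
    rcases this (h.connected hx.1) with h' | h'
    · exact hx.2 h'
    · exact hx' h'

/-- All vertices before `v` on a geodesic from `r` are strictly closer to `r` than `u`, so the
geodesic avoids `u`. -/
theorem mem_reach_diff (h : G.IsMinimalConnectedDominating C D r) (hv : v ∈ D) (hvu : v ≠ u)
    (hd : (G.within D).dist r v ≤ (G.within D).dist r u) : v ∈ G.reach (D \ {u}) r := by
  generalize hk : (G.within D).dist r v = k at hd
  induction k generalizing v with
  | zero =>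
    rw [Reachable.dist_eq_zero_iff (h.connected hv)] at hk
    exact hk ▸ self_mem_reach
  | succ k ih =>
    obtain ⟨p, hp, -, hpk⟩ := Reachable.exists_adj_dist_eq (h.connected hv) hk
    have hpu : p ≠ u := by rintro rfl; omega
    exact reach_step (ih hp.2.1 hpu hpk (by omega)) hp.1 ⟨hp.2.1, hpu⟩ ⟨hv, hvu⟩

theorem exists_geodesic (h : G.IsMinimalConnectedDominating C D r) {k : ℕ} (hv : v ∈ D)
    (hk : (G.within D).dist r v = k) : ∃ x : ℕ → V, x k = v ∧
      (∀ i ≤ k, x i ∈ D ∧ (G.within D).dist r (x i) = i) ∧ ∀ i < k, G.Adj (x i) (x (i + 1)) := by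
  induction k generalizing v with
  | zero => exact ⟨fun _ => v, rfl, fun i hi => by
      obtain rfl := Nat.le_zero.1 hi; exact ⟨hv, hk⟩, by simp⟩
  | succ k ih =>
    obtain ⟨p, hp, -, hpk⟩ := Reachable.exists_adj_dist_eq (h.connected hv) hk
    obtain ⟨x, hx, hx₁, hx₂⟩ := ih hp.2.1 hpk
    refine ⟨Function.update x (k + 1) v, by simp, fun i hi => ?_, fun i hi => ?_⟩
    · rcases hi.eq_or_lt with rfl | hi
      · simp [hv, hk]
      · simpa [hi.ne] using hx₁ i (by omega)
    · rcases Nat.lt_succ_iff_lt_or_eq.1 hi with hi' | rfl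
      · simpa [show i ≠ k + 1 by omega, show i ≠ k by omega] using hx₂ i hi'
      · simpa [hx] using hp.1

/-- A geodesic `x 0, …, x k` from `r` to `v` is induced. A private neighbour of `v` sees only its
last vertex, because the others are reachable without `v`. This gives an induced path with `k + 2`
vertices. -/
theorem dist_le_of_inducedFree (h : G.IsMinimalConnectedDominating C D r) {t : ℕ}
    (ht : InducedFree (pathGraph t) G) (hv : v ∈ D) : (G.within D).dist r v ≤ t - 3 := by
  by_cases hvr : v = r
  · subst hvr; simp
  generalize hk : (G.within D).dist r v = k
  by_contra! hlt
  obtain ⟨w, hvw, hw⟩ := h.exists_private hv hvr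
  obtain ⟨x, hxk, hx₁, hx₂⟩ := h.exists_geodesic hv hk
  have hpos : k ≠ 0 := by omega
  have hne : ∀ i j, i ≤ k → j ≤ k → x i = x j → i = j := fun i j hi hj hij => by
    rw [← (hx₁ i hi).2, ← (hx₁ j hj).2, hij]
  have hfar : ∀ i < k, x i ∈ G.reach (D \ {v}) r := fun i hi =>
    h.mem_reach_diff (hx₁ i hi.le).1 (fun he => hi.ne (hne i k hi.le le_rfl (he.trans hxk.symm)))
      (by rw [(hx₁ i hi.le).2, hk]; exact hi.le)
  have hadj : ∀ i j, i ≤ k → j ≤ k → (G.Adj (x i) (x j) ↔ i + 1 = j ∨ j + 1 = i) := by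
    intro i j hi hj
    constructor
    · intro hij
      have h' : (G.within D).Adj (x i) (x j) := ⟨hij, (hx₁ i hi).1, (hx₁ j hj).1⟩
      have := h'.diff_dist_adj (u := r)
      rw [(hx₁ i hi).2, (hx₁ j hj).2] at this
      have : i ≠ j := fun he => hij.ne (by rw [he])
      omega
    · rintro (rfl | rfl)
      · exact hx₂ i (by omega)
      · exact (hx₂ j (by omega)).symm
  have hadjw : ∀ i, i ≤ k → (G.Adj (x i) w ↔ i = k) := by
    intro i hi
    refine ⟨fun hiw => ?_, fun he => by rw [he, hxk]; exact hvw⟩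
    by_contra hik
    exact (hw _ (hfar i (by omega))).2 hiw.symm
  have hnew : ∀ i, i ≤ k → x i ≠ w := by
    intro i hi he
    rcases hi.eq_or_lt with rfl | hi
    · rw [hxk] at he; exact hvw.ne he
    · exact (hw _ (hfar i hi)).1 he
  -- As `k > t - 3` with truncated subtraction, `t ≤ k + 2` also for `t < 3`; thus only the index `k
  -- + 1` can be sent to `w`.
  let f : Fin t → V := fun i => if (i : ℕ) ≤ k then x i else w
  have hf : ∀ i, f i = if (i : ℕ) ≤ k then x i else w := fun _ => rfl
  have hfi : Function.Injective f := by
    intro i j hij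
    have := i.2
    have := j.2
    rw [hf, hf] at hij
    split_ifs at hij with h₁ h₂ h₂
    · exact Fin.ext (hne _ _ h₁ h₂ hij)
    · exact absurd hij (hnew _ h₁)
    · exact absurd hij.symm (hnew _ h₂)
    · exact Fin.ext (by omega)
  refine ht ⟨⟨⟨f, hfi⟩, ?_⟩⟩
  intro i j
  have := i.2
  have := j.2
  change G.Adj (f i) (f j) ↔ _
  rw [pathGraph_adj, hf, hf]
  split_ifs with h₁ h₂ h₂
  · exact hadj _ _ h₁ h₂
  · rw [hadjw _ h₁]; omega
  · rw [G.adj_comm, hadjw _ h₂]; omega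
  · simp only [SimpleGraph.irrefl, false_iff]; omega

end IsMinimalConnectedDominating

/-- A vertex `v` with neighbours `u i` and private neighbours `w i` of these forms an induced
subdivided star. -/
theorem isIndContained_SDK {s : ℕ} (v : V) (u w : Fin s → V) (hvu : ∀ i, G.Adj v (u i))
    (huu : ∀ i j, ¬ G.Adj (u i) (u j)) (huw : ∀ i, G.Adj (u i) (w i))
    (huw' : ∀ i j, i ≠ j → ¬ G.Adj (u i) (w j) ∧ u i ≠ w j) (hvw : ∀ i, v ≠ w i ∧ ¬ G.Adj v (w i))
    (hww : ∀ i j, ¬ G.Adj (w i) (w j)) : (SDK s).IsIndContained G := by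
  have hedge : ∀ e : (completeBipartiteGraph (Fin 1) (Fin s)).edgeSet,
      ∃ i, (e : Sym2 (Fin 1 ⊕ Fin s)) = s(Sum.inl 0, Sum.inr i) := by
    rintro ⟨e, he⟩
    induction e with
    | _ a b =>
      rw [SimpleGraph.mem_edgeSet, completeBipartiteGraph_adj] at he
      rcases a with a | a <;> rcases b with b | b <;> simp at he
      · exact ⟨b, by simp [Subsingleton.elim a 0]⟩
      · exact ⟨a, by simp [Subsingleton.elim b 0, Sym2.eq_swap]⟩
  choose idx hidx using hedge
  have hidx_inj : Function.Injective idx := fun e e' h =>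
    Subtype.ext (by rw [hidx e, hidx e', h])
  have u_inj : ∀ i j, u i = u j → i = j := fun i j h => by
    by_contra hij; exact (huw' j i (Ne.symm hij)).1 (h ▸ huw i)
  have w_inj : ∀ i j, w i = w j → i = j := fun i j h => by
    by_contra hij; exact (huw' i j hij).1 (h ▸ huw i)
  have u_ne_w : ∀ i j, u i ≠ w j := fun i j => by
    by_cases hij : i = j
    · subst hij; exact (huw i).ne
    · exact (huw' i j hij).2
  have huw_iff : ∀ i j, G.Adj (u i) (w j) ↔ i = j := fun i j =>
    ⟨fun h => by by_contra hij; exact (huw' i j hij).1 h, fun h => h ▸ huw i⟩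
  -- The edges of the star index the subdividing vertices, which go to the `u i`; the leaves go to
  -- the `w i`.
  let f : (Fin 1 ⊕ Fin s) ⊕ (completeBipartiteGraph (Fin 1) (Fin s)).edgeSet → V
    | .inl (.inl _) => v
    | .inl (.inr i) => w i
    | .inr e => u (idx e)
  have hf : Function.Injective f := by
    rintro ((a | a) | a) ((b | b) | b) h
    · rw [Subsingleton.elim a b]
    · exact absurd h (hvw b).1
    · exact absurd h (hvu _).ne
    · exact absurd h.symm (hvw a).1
    · rw [w_inj a b h]
    · exact absurd h.symm (u_ne_w _ _)
    · exact absurd h.symm (hvu _).ne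
    · exact absurd h (u_ne_w _ _)
    · rw [hidx_inj (u_inj _ _ h)]
  have hinl : ∀ x y, ¬ (SDK s).Adj (.inl x) (.inl y) := fun x y h => by
    simp [SDK, oneSubdivision] at h
  have hinr : ∀ e e', ¬ (SDK s).Adj (.inr e) (.inr e') := fun x y h => by
    simp [SDK, oneSubdivision] at h
  have hmid : ∀ x e, (SDK s).Adj (.inl x) (.inr e) ↔ x = .inl 0 ∨ x = .inr (idx e) := fun x e => by
    have : (SDK s).Adj (.inl x) (.inr e) ↔ x ∈ (e : Sym2 (Fin 1 ⊕ Fin s)) := by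
      simp only [SDK, oneSubdivision, SimpleGraph.fromRel_adj]
      constructor
      · rintro ⟨-, ⟨v, e', h₁, h₂, h⟩ | ⟨v, e', h₁, h₂, h⟩⟩
        · rwa [Sum.inl.inj h₁, Sum.inr.inj h₂]
        · simp at h₁
      · exact fun h => ⟨by simp, .inl ⟨x, e, rfl, rfl, h⟩⟩
    rw [this, hidx, Sym2.mem_iff]
  have hcenter : ∀ (a : Fin 1) e, (SDK s).Adj (.inl (.inl a)) (.inr e) := fun a e =>
    (hmid _ _).2 (.inl (by rw [Subsingleton.elim a 0]))
  have hleaf : ∀ i e, (SDK s).Adj (.inl (.inr i)) (.inr e) ↔ i = idx e := fun i e => by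
    simp [hmid]
  refine ⟨⟨⟨f, hf⟩, ?_⟩⟩
  rintro ((a | a) | a) ((b | b) | b)
  · exact iff_of_false G.irrefl (hinl _ _)
  · exact iff_of_false (hvw b).2 (hinl _ _)
  · exact iff_of_true (hvu _) (hcenter _ _)
  · exact iff_of_false (fun h => (hvw a).2 h.symm) (hinl _ _)
  · exact iff_of_false (hww _ _) (hinl _ _)
  · exact (G.adj_comm _ _).trans ((huw_iff _ _).trans (eq_comm.trans (hleaf a b).symm))
  · exact iff_of_true (hvu _).symm (hcenter _ _).symm
  · exact (huw_iff _ _).trans (eq_comm.trans ((hleaf b a).symm.trans ((SDK s).adj_comm _ _)))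
  · exact iff_of_false (huu _ _) (hinr _ _)

namespace IsMinimalConnectedDominating

variable {C : Set V} {D : Finset V}

-- This is where the nested Ramsey number arises: the outer one yields `R(4, s)` independent
-- children of `v`, the inner one `s` of them with independent private neighbours. Removing one
-- child keeps `v` and the other children reachable, as they are no farther from `r`. Hence a
-- private neighbour sees no vertex of the star but its own child, and private neighbours of
-- different children differ.
open Classical in
theorem card_children_lt (h : G.IsMinimalConnectedDominating C D r) {s : ℕ}
    (hs : InducedFree (SDK s) G) (hG : G.CliqueFree 4) (v : V) (hv : v ∈ D) :
    (D.filter fun u => G.Adj v u ∧ (G.within D).dist r u = (G.within D).dist r v + 1).card <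
      ramseyNumber 4 (ramseyNumber 4 s) := by
  by_contra! hcard
  obtain ⟨A, hA, hAi⟩ := exists_isNIndepSet_of_ramseyNumber_le hG hcard
  have hA' : ∀ u ∈ A, u ∈ D ∧ G.Adj v u ∧
      (G.within D).dist r u = (G.within D).dist r v + 1 := fun u hu => by simpa using hA hu
  have hAr : ∀ u ∈ A, u ≠ r := by
    rintro u hu rfl
    have := (hA' u hu).2.2
    simp at this
  have hpriv : ∀ u : V, ∃ w, u ∈ A →
      G.Adj u w ∧ ∀ x ∈ G.reach (D \ {u}) r, x ≠ w ∧ ¬ G.Adj w x := by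
    intro u
    by_cases hu : u ∈ A
    · obtain ⟨w, hw⟩ := h.exists_private (hA' u hu).1 (hAr u hu)
      exact ⟨w, fun _ => hw⟩
    · exact ⟨u, fun h => absurd h hu⟩
  choose w hw using hpriv
  have hvr : ∀ u ∈ A, v ∈ G.reach (D \ {u}) r := fun u hu =>
    h.mem_reach_diff hv (hA' u hu).2.1.ne (by rw [(hA' u hu).2.2]; omega)
  have hur : ∀ u ∈ A, ∀ u' ∈ A, u' ≠ u → u' ∈ G.reach (D \ {u}) r := fun u hu u' hu' hne =>
    h.mem_reach_diff (hA' u' hu').1 hne (by rw [(hA' u hu).2.2, (hA' u' hu').2.2])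
  have hwinj : Set.InjOn w A := fun u hu u' hu' he => by
    by_contra hne
    exact ((hw u hu).2 u' (hur u hu u' hu' (Ne.symm hne))).2 (he ▸ (hw u' hu').1.symm)
  obtain ⟨B, hB, hBi⟩ := exists_isNIndepSet_of_ramseyNumber_le (k := 4) (l := s) hG
    (X := A.image w) (by rw [Finset.card_image_of_injOn hwinj, hAi.card_eq])
  have hBmem : ∀ b ∈ B, ∃ u ∈ A, w u = b := fun b hb => by simpa using hB hb
  let g : Fin s ≃ B := (B.equivFinOfCardEq hBi.card_eq).symm
  choose u huA hwu using fun i : Fin s => hBmem (g i) (g i).2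
  have hne : ∀ i j, i ≠ j → u i ≠ u j := fun i j hij he =>
    hij (g.injective (Subtype.ext (by rw [← hwu i, ← hwu j, he])))
  refine hs (isIndContained_SDK v u (fun i => w (u i)) (fun i => (hA' _ (huA i)).2.1)
    (fun i j hij => hAi.isIndepSet (huA i) (huA j) hij.ne hij) (fun i => (hw _ (huA i)).1)
    (fun i j hij => ?_) (fun i => ?_) fun i j hij => ?_)
  · have := (hw _ (huA j)).2 _ (hur _ (huA j) _ (huA i) (hne i j hij))
    exact ⟨fun ha => this.2 ha.symm, this.1⟩
  · have := (hw _ (huA i)).2 _ (hvr _ (huA i))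
    exact ⟨this.1, fun ha => this.2 ha.symm⟩
  · rw [hwu i, hwu j] at hij
    exact hBi.isIndepSet (g i).2 (g j).2 hij.ne hij

/-- Minimal connected dominating sets are small. -/
theorem card_le (h : G.IsMinimalConnectedDominating C D r) {s t : ℕ}
    (hs : InducedFree (SDK s) G) (ht : InducedFree (pathGraph t) G) (hG : G.CliqueFree 4) :
    D.card ≤ ramseyNumber 4 (ramseyNumber 4 s) ^ (t - 3) := by
  classical
  set R := ramseyNumber 4 (ramseyNumber 4 s)
  -- A vertex at distance `k + 1` is a child of one at distance `k`. Each vertex of the ball of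
  -- radius `k` accounts for itself and fewer than `R` children, so the ball grows at most by the
  -- factor `R`.
  have key : ∀ k, (D.filter fun u => (G.within D).dist r u ≤ k).card ≤ R ^ k := by
    intro k
    induction k with
    | zero =>
      rw [pow_zero, Finset.card_le_one]
      intro a ha b hb
      simp only [Finset.mem_filter, Nat.le_zero] at ha hb
      rw [Reachable.dist_eq_zero_iff (h.connected ha.1)] at ha
      rw [Reachable.dist_eq_zero_iff (h.connected hb.1)] at hb
      rw [← ha.2, ← hb.2]
    | succ k ih =>
      have hsub : (D.filter fun u => (G.within D).dist r u ≤ k + 1) ⊆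
          (D.filter fun u => (G.within D).dist r u ≤ k).biUnion fun v => insert v
            (D.filter fun u => G.Adj v u ∧
              (G.within D).dist r u = (G.within D).dist r v + 1) := by
        intro x hx
        rw [Finset.mem_filter] at hx
        rw [Finset.mem_biUnion]
        rcases hx.2.lt_or_eq with hlt | heq
        · exact ⟨x, by simp [hx.1]; omega, Finset.mem_insert_self _ _⟩
        · obtain ⟨p, hp, -, hpk⟩ := Reachable.exists_adj_dist_eq (h.connected hx.1) heq
          exact ⟨p, by simpa [hpk] using hp.2.1, by simp [hx.1, hp.1, hpk, heq]⟩
      refine (Finset.card_le_card hsub).trans (Finset.card_biUnion_le.trans ?_)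
      refine (Finset.sum_le_card_nsmul _ _ R fun v hv => ?_).trans ?_
      · refine (Finset.card_insert_le _ _).trans ?_
        exact h.card_children_lt hs hG v (Finset.mem_filter.1 hv).1
      · rw [smul_eq_mul, pow_succ]
        exact Nat.mul_le_mul_right _ ih
  refine le_trans (Finset.card_le_card fun u hu => ?_) (key (t - 3))
  exact Finset.mem_filter.2 ⟨hu, h.dist_le_of_inducedFree ht hu⟩

end IsMinimalConnectedDominating

end SimpleGraph

/-! ### The program -/

namespace RAM.Coloring

open SimpleGraph

/-- The variables of the program. -/
inductive Var where
  | n | ok | w3 | acc | r | k | u | v | w | x | y | i | j | bad | has | d | q | c | a | b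
  | pw | m | found | t | z | s | sel | fine | cy
  deriving DecidableEq

/-- The arrays of the program. -/
inductive Arr where
  | adj | lst | off | off3 | done | allow | mark | vs | inD | domi | lv | lc | g | tab | ch | out
  deriving DecidableEq

/-- Names are stored at the position of their constructor. The order of the constructors matters:
`n`, `adj` and `lst` must fall on register `0` and arrays `0` and `1` of `inputState`. Temporaries
start at `29`, the number of variables. -/
theorem Var.ctorIdx_injective : Function.Injective Var.ctorIdx := fun x y h => by
  rw [← Var.ofNat_ctorIdx x, h, Var.ofNat_ctorIdx y]

theorem Arr.ctorIdx_injective : Function.Injective Arr.ctorIdx := fun x y h => by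
  rw [← Arr.ofNat_ctorIdx x, h, Arr.ofNat_ctorIdx y]

theorem Var.ctorIdx_lt (v : Var) : v.ctorIdx < 29 := by cases v <;> decide

variable {n : ℕ} {G : SimpleGraph (Fin n)} {L : Fin n → Finset (Fin 3)} {μ ν : Mem Var Arr}

/-- The memory holds the graph and the lists, and the tables of the multiples of `n` and `3 * n`. -/
structure Ctx (G : SimpleGraph (Fin n)) (L : Fin n → Finset (Fin 3)) (μ : Mem Var Arr) :
    Prop where
  n_eq : μ.reg .n = n
  adj : ∀ u v : Fin n, μ.arr .adj (u * n + v) = 1 ↔ G.Adj u v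
  lst : ∀ (v : Fin n) (c : Fin 3), μ.arr .lst (3 * v + c) = 1 ↔ c ∈ L v
  off : ∀ u < n, μ.arr .off u = u * n
  off3 : ∀ x < 3 * n, μ.arr .off3 x = x * (3 * n)

theorem Ctx.frame {P : Stmt Var Arr} (h : Ctx G L μ) (hf : Frame P μ ν)
    (hP : P.setsReg .n = false ∧ P.setsArr .adj = false ∧ P.setsArr .lst = false ∧
      P.setsArr .off = false ∧ P.setsArr .off3 = false := by decide) : Ctx G L ν := by
  obtain ⟨h₀, h₁, h₂, h₃, h₄⟩ := hP
  refine ⟨?_, ?_, ?_, ?_, ?_⟩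
  · rw [hf.1 _ h₀, h.n_eq]
  · rw [hf.2 _ h₁]; exact h.adj
  · rw [hf.2 _ h₂]; exact h.lst
  · rw [hf.2 _ h₃]; exact h.off
  · rw [hf.2 _ h₄]; exact h.off3

theorem Ctx.setReg (h : Ctx G L μ) (v : Var) (x : ℕ) (hv : v ≠ .n := by decide) :
    Ctx G L (μ.setReg v x) :=
  ⟨by simp [hv.symm, h.n_eq], h.adj, h.lst, h.off, h.off3⟩

/-- Stores the multiples of `n` in `off`. -/
def offP : Stmt Var Arr :=
  .for_ .x (.var .n)
    (.put .off (.var .x) (.var .acc) ;; .set .acc (.add (.var .acc) (.var .n)))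

/-- The machine cannot multiply, so row offsets are accumulated by addition once; afterwards access
to a matrix entry takes constant time. -/
theorem tri_offP (hn : μ.reg .n = n) (h0 : μ.reg .acc = 0) :
    Tri offP μ (20 * n + 10) fun ν => ∀ u < n, ν.arr .off u = u * n := by
  refine Tri.for (fun j ν => ν.reg .acc = j * n ∧ ∀ u < j, ν.arr .off u = u * n) 10 hn ?_
    (by simp [h0]) (fun j ν hj f h => Tri.leaf ?_) fun ν f h => h.2
  · simp only [Expr.cost]; omega
  · have hn₂ : ν.reg .n = n := (f.1 _ rfl).trans hn
    simp [hn₂, h.1]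
    refine ⟨by ring, fun u hu => ?_⟩
    split_ifs with hc
    · rw [hc]
    · exact h.2 u (by omega)

/-- Stores the multiples of `w3` in `off3`. -/
def offThreeP : Stmt Var Arr :=
  .for_ .x (.var .w3)
    (.put .off3 (.var .x) (.var .acc) ;; .set .acc (.add (.var .acc) (.var .w3)))

theorem tri_offThreeP {N : ℕ} (hn : μ.reg .w3 = N) (h0 : μ.reg .acc = 0) :
    Tri offThreeP μ (20 * N + 10) fun ν => ∀ u < N, ν.arr .off3 u = u * N := by
  refine Tri.for (fun j ν => ν.reg .acc = j * N ∧ ∀ u < j, ν.arr .off3 u = u * N) 10 hn ?_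
    (by simp [h0]) (fun j ν hj f h => Tri.leaf ?_) fun ν f h => h.2
  · simp only [Expr.cost]; omega
  · have hn₂ : ν.reg .w3 = N := (f.1 _ rfl).trans hn
    simp [hn₂, h.1]
    refine ⟨by ring, fun u hu => ?_⟩
    split_ifs with hc
    · rw [hc]
    · exact h.2 u (by omega)

/-- Computes the tables of multiples. -/
def initP : Stmt Var Arr :=
  offP ;; (.set .acc (.lit 0) ;; .set .w3 (.add (.var .n) (.add (.var .n) (.var .n))) ;;
    .set .ok (.lit 1)) ;; offThreeP

theorem tri_initP (hn : μ.reg .n = n) (h0 : μ.reg .acc = 0)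
    (hadj : ∀ u v : Fin n, μ.arr .adj (u * n + v) = 1 ↔ G.Adj u v)
    (hlst : ∀ (v : Fin n) (c : Fin 3), μ.arr .lst (3 * v + c) = 1 ↔ c ∈ L v) :
    Tri initP μ (100 * (n + 1)) fun ν => Ctx G L ν ∧ ν.reg .ok = 1 := by
  refine (Tri.seq' (tri_offP hn h0) fun ν₁ f₁ h₁ => Tri.seq'
    (Q' := fun ν => ν.reg .acc = 0 ∧ ν.reg .w3 = 3 * n ∧ ν.reg .ok = 1) (Tri.leaf (T := 20) ?_)
    fun ν₂ f₂ h₂ => (tri_offThreeP h₂.2.1 h₂.1).mono (Q' := fun ν => (∀ u < n, ν.arr .off u = u * n) ∧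
      (∀ u < 3 * n, ν.arr .off3 u = u * (3 * n)) ∧ ν.reg .ok = 1) le_rfl fun ν₃ f₃ h₃ =>
      ⟨?_, h₃, (f₃.1 _ rfl).trans h₂.2.2⟩).mono ?_
    fun ν f h => ⟨⟨(f.1 _ rfl).trans hn, ?_, ?_, h.1, h.2.1⟩, h.2.2⟩
  · have := (f₁.1 .n rfl).trans hn
    simp [this]; omega
  · rwa [f₃.2 .off rfl, f₂.2 .off rfl]
  · omega
  · rwa [f.2 .adj rfl]
  · rwa [f.2 .lst rfl]

/-! ### Reachability inside a set of vertices. -/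

/-- One step of the search: marks the neighbours of `x` inside `allow`, if `x` is marked. -/
def spreadP : Stmt Var Arr :=
  .for_ .y (.var .n)
    (.ifEq (.get .mark (.var .x)) (.lit 1)
      (.ifEq (.get .allow (.var .y)) (.lit 1)
        (.ifEq (.get .adj (.add (.get .off (.var .x)) (.var .y))) (.lit 1)
          (.put .mark (.var .y) (.lit 1)) .skip) .skip) .skip)

theorem tri_spreadP (hc : Ctx G L μ) {S M : Set (Fin n)} {x : Fin n} (hx : μ.reg .x = x)
    (hS : ∀ v : Fin n, μ.arr .allow v = 1 ↔ v ∈ S) (hM : ∀ v : Fin n, μ.arr .mark v = 1 ↔ v ∈ M) :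
    Tri spreadP μ (40 * n + 10) fun ν =>
      ∀ v : Fin n, ν.arr .mark v = 1 ↔ v ∈ M ∨ (x ∈ M ∧ v ∈ S ∧ G.Adj x v) := by
  refine Tri.for (fun j ν => ∀ v : Fin n, ν.arr .mark v = 1 ↔
    v ∈ M ∨ ((v : ℕ) < j ∧ x ∈ M ∧ v ∈ S ∧ G.Adj x v)) 36 hc.n_eq ?_ (by simpa using hM)
    (fun j ν hj f h => Tri.leaf ?_) fun ν f h v => by rw [h v]; simp
  · simp only [Expr.cost]; omega
  · have hx₁ : ν.reg .x = x := (f.1 _ rfl).trans hx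
    have hc₁ : Ctx G L ν := hc.frame f
    have hS₁ : ν.arr .allow = μ.arr .allow := f.2 _ rfl
    have e₁ := h x
    have e₂ := hS ⟨j, hj⟩
    have e₃ := hc₁.adj x ⟨j, hj⟩
    have e₄ := hc₁.off x x.2
    simp only [SimpleGraph.irrefl, and_false, or_false] at e₁
    intro v
    have := h v
    have hvj : (v : ℕ) = j ↔ v = ⟨j, hj⟩ := by rw [Fin.ext_iff]
    simp only at e₂ e₃
    have hvl : (v : ℕ) < j + 1 ↔ (v : ℕ) < j ∨ v = ⟨j, hj⟩ := by
      rw [← hvj]; exact Nat.lt_succ_iff_lt_or_eq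
    rw [hvl]
    simp [hx₁, hS₁, e₁, e₂, e₃, e₄, hvj]
    split_ifs <;> grind

/-- Array `a` holds the indicator function of the set `S`. -/
def Holds (a : Arr) (S : Set (Fin n)) (μ : Mem Var Arr) : Prop :=
  ∀ v : Fin n, μ.arr a v = 1 ↔ v ∈ S

theorem Holds.frame {P : Stmt Var Arr} {a : Arr} {S : Set (Fin n)} (h : Holds a S μ)
    (hf : Frame P μ ν) (hP : P.setsArr a = false := by decide) : Holds a S ν := by
  unfold Holds; rw [hf.2 _ hP]; exact h

theorem Holds.setReg {a : Arr} {S : Set (Fin n)} (h : Holds a S μ) (v : Var) (x : ℕ) :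
    Holds a S (μ.setReg v x) := by
  unfold Holds; rw [Mem.setReg_arr]; exact h

/-- One round of the search. -/
def roundP : Stmt Var Arr := .for_ .x (.var .n) spreadP

/-- Marks set early in a round may already spread in the same round, so the new set is not
determined by one step of the search. It is only enclosed: it contains the neighbours of `M` in `S`
and lies in every closed set containing `M`. -/
theorem tri_roundP (hc : Ctx G L μ) {S M : Set (Fin n)} (hS : Holds .allow S μ)
    (hM : Holds .mark M μ) :
    Tri roundP μ (60 * (n + 1) ^ 2) fun ν => ∃ M' : Set (Fin n), Holds .mark M' ν ∧ M ⊆ M' ∧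
      (∀ x ∈ M, ∀ y ∈ S, G.Adj x y → y ∈ M') ∧
      ∀ K : Set (Fin n), M ⊆ K → (∀ x ∈ K, ∀ y ∈ S, G.Adj x y → y ∈ K) → M' ⊆ K := by
  refine Tri.for (fun j ν => ∃ M' : Set (Fin n), Holds .mark M' ν ∧ M ⊆ M' ∧
      (∀ x ∈ M, (x : ℕ) < j → ∀ y ∈ S, G.Adj x y → y ∈ M') ∧
      ∀ K : Set (Fin n), M ⊆ K → (∀ x ∈ K, ∀ y ∈ S, G.Adj x y → y ∈ K) → M' ⊆ K)
    (40 * n + 10) hc.n_eq ?_ ⟨M, hM, subset_rfl, by simp, fun K h _ => h⟩ ?_ ?_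
  · simp only [Expr.cost]; nlinarith
  · rintro j ν hj f ⟨M', h₁, h₂, h₃, h₄⟩
    have hc' := hc.frame f
    have hS' := hS.frame f
    refine (tri_spreadP (x := ⟨j, hj⟩) (hc'.setReg .x j) (by simp) (hS'.setReg .x j)
      (h₁.setReg .x j)).mono le_rfl fun ξ _ h => ⟨_, h, fun v hv => .inl (h₂ hv), ?_, ?_⟩
    · intro x hx hxj y hy hxy
      rcases Nat.lt_succ_iff_lt_or_eq.1 hxj with hxj | hxj
      · exact .inl (h₃ x hx hxj y hy hxy)
      · obtain rfl : x = ⟨j, hj⟩ := Fin.ext hxj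
        exact .inr ⟨h₂ hx, hy, hxy⟩
    · rintro K hK hK' v (hv | ⟨hx, hy, hxy⟩)
      · exact h₄ K hK hK' hv
      · exact hK' _ (h₄ K hK hK' hx) _ hy hxy
  · rintro ν f ⟨M', h₁, h₂, h₃, h₄⟩
    exact ⟨M', h₁, h₂, fun x hx => h₃ x hx x.2, h₄⟩

/-- Clears the array `mark`. -/
def clearP : Stmt Var Arr := .for_ .x (.var .n) (.put .mark (.var .x) (.lit 0))

theorem tri_clearP (hn : μ.reg .n = n) :
    Tri clearP μ (20 * n + 10) fun ν => Holds .mark (∅ : Set (Fin n)) ν := by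
  refine Tri.for (fun j ν => ∀ v < j, ν.arr .mark v = 0) 10 hn ?_ (by simp)
    (fun j ν hj f h => Tri.leaf ?_) fun ν f h v => by simp [h v v.2]
  · simp only [Expr.cost]; omega
  · intro v hv
    simp
    intro hvj
    exact h v (by omega)

/-- Marks the vertices that can be reached from `r` inside `allow`. -/
def reachP : Stmt Var Arr :=
  clearP ;; .put .mark (.var .r) (.lit 1) ;; .for_ .i (.var .n) roundP

/-- After `j` rounds everything at distance at most `j` is marked, and a shortest path has fewer
than `n` edges. -/
theorem tri_reachP (hc : Ctx G L μ) {S : Set (Fin n)} {r : Fin n} (hr : μ.reg .r = r)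
    (hS : Holds .allow S μ) (hrS : r ∈ S) :
    Tri reachP μ (100 * (n + 1) ^ 3) (Holds .mark (G.reach S r)) := by
  have hstep : ∀ x ∈ G.reach S r, ∀ y ∈ S, G.Adj x y → y ∈ G.reach S r :=
    fun x hx y hy hxy => reach_step hx hxy (reach_subset hrS hx) hy
  refine Tri.seq_le (tri_clearP hc.n_eq) (fun ν₁ f₁ h₁ => Tri.seq' (T := 4) (T' := 70 * (n + 1) ^ 3)
    (Q' := Holds .mark ({r} : Set (Fin n))) (Tri.leaf ?_) fun ν₂ f₂ h₂ =>
    Tri.for (fun j ν => ∃ M : Set (Fin n), Holds .mark M ν ∧ M ⊆ G.reach S r ∧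
      ∀ v ∈ G.reach S r, (G.within S).dist r v ≤ j → v ∈ M) (60 * (n + 1) ^ 2)
      ((hc.frame f₁).frame f₂).n_eq ?_ ⟨_, h₂, ?_, ?_⟩ ?_ ?_) ?_
  · intro v
    have := h₁ v
    have hr₁ : ν₁.reg .r = r := (f₁.1 _ rfl).trans hr
    simp only [Set.mem_empty_iff_false, iff_false] at this
    simp [hr₁, Fin.ext_iff, this]
  · simp only [Expr.cost]; nlinarith [Nat.zero_le (n ^ 2), Nat.zero_le (n ^ 3)]
  · rintro v rfl; exact self_mem_reach
  · intro v hv hd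
    rw [Nat.le_zero, Reachable.dist_eq_zero_iff hv] at hd
    exact hd.symm
  · rintro j ν hj f ⟨M, hM, hMr, hMj⟩
    have hc' := ((hc.frame f₁).frame f₂).frame f
    have hS' := ((hS.frame f₁).frame f₂).frame f
    refine (tri_roundP (hc'.setReg .i j) (hS'.setReg .i j) (hM.setReg .i j)).mono le_rfl ?_
    rintro ξ - ⟨M', h₁, h₂, h₃, h₄⟩
    refine ⟨M', h₁, h₄ _ hMr hstep, fun v hv hd => ?_⟩
    rcases hd.lt_or_eq with hd | hd
    · exact h₂ (hMj v hv (by omega))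
    · obtain ⟨u, hu, hu', hd'⟩ := Reachable.exists_adj_dist_eq hv hd
      exact h₃ u (hMj u hu' hd'.le) v hu.2.2 hu.1
  · rintro ν f ⟨M, hM, hMr, hMj⟩
    rwa [hMr.antisymm fun v hv => hMj v hv ?_] at hM
    obtain ⟨p, hp, hpd⟩ := Reachable.exists_path_of_dist hv
    have := hp.length_lt
    rw [Fintype.card_fin] at this
    omega
  · nlinarith [Nat.zero_le (n ^ 2), Nat.zero_le (n ^ 3)]

/-! ### Enumerating a component and testing domination. -/

/-- `e 0, …, e (k - 1)` lists the elements of `C` without repetition. -/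
structure Enum (C : Set (Fin n)) (e : ℕ → Fin n) (k : ℕ) : Prop where
  inj : ∀ i < k, ∀ j < k, e i = e j → i = j
  mem : ∀ v, v ∈ C ↔ ∃ i < k, e i = v

/-- The memory holds the list `e 0, …, e (k - 1)`. -/
def HoldsEnum (e : ℕ → Fin n) (k : ℕ) (μ : Mem Var Arr) : Prop :=
  μ.reg .k = k ∧ ∀ j < k, μ.arr .vs j = e j

theorem HoldsEnum.frame {P : Stmt Var Arr} {e : ℕ → Fin n} {k : ℕ} (h : HoldsEnum e k μ)
    (hf : Frame P μ ν) (hP : P.setsReg .k = false ∧ P.setsArr .vs = false := by decide) :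
    HoldsEnum e k ν := by
  unfold HoldsEnum; rw [hf.1 _ hP.1, hf.2 _ hP.2]; exact h

theorem HoldsEnum.setReg {e : ℕ → Fin n} {k : ℕ} (h : HoldsEnum e k μ) (v : Var) (x : ℕ)
    (hv : v ≠ .k := by decide) : HoldsEnum e k (μ.setReg v x) := by
  unfold HoldsEnum; rw [Mem.setReg_arr, Mem.setReg_reg, if_neg hv.symm]; exact h

theorem Enum.le {C : Set (Fin n)} {e : ℕ → Fin n} {k : ℕ} (h : Enum C e k) : k ≤ n := by
  have := Finset.card_le_card_of_injOn (s := Finset.range k) (t := Finset.univ) e (by simp)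
    (fun i hi j hj => h.inj i (by simpa using hi) j (by simpa using hj))
  simpa using this

/-- Lists the marked vertices, and copies `mark` to `inD`. -/
def collectP : Stmt Var Arr :=
  .set .k (.lit 0) ;;
  .for_ .x (.var .n) (.ifEq (.get .mark (.var .x)) (.lit 1)
    (.put .vs (.var .k) (.var .x) ;; .set .k (.add (.var .k) (.lit 1)) ;;
      .put .inD (.var .x) (.lit 1))
    (.put .inD (.var .x) (.lit 0)))

theorem tri_collectP (hc : Ctx G L μ) {C : Set (Fin n)} (r : Fin n) (hC : Holds .mark C μ) :
    Tri collectP μ (40 * n + 10) fun ν =>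
      ∃ e k, Enum C e k ∧ HoldsEnum e k ν ∧ Holds .inD C ν := by
  refine Tri.seq_le (T' := 40 * n + 7) (Q' := fun ν => ν.reg .k = 0) (Tri.leaf (T := 3) (by simp))
    (fun ν₁ f₁ h₁ => Tri.for (fun j ν => ∃ e k, Enum {v ∈ C | (v : ℕ) < j} e k ∧ HoldsEnum e k ν ∧
      ∀ v : Fin n, (v : ℕ) < j → (ν.arr .inD v = 1 ↔ v ∈ C)) 30 (hc.frame f₁).n_eq ?_
    -- The root only serves as default value of the empty enumeration.
    ⟨fun _ => r, 0, ⟨by simp, by simp⟩, ⟨h₁, by simp⟩, by simp⟩ ?_ ?_) ?_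
  · simp only [Expr.cost]; omega
  · rintro j ν hj f ⟨e, k, he, hk, hD⟩
    have e₁ : ν.arr .mark j = 1 ↔ (⟨j, hj⟩ : Fin n) ∈ C := ((hC.frame f₁).frame f) ⟨j, hj⟩
    refine Tri.leaf ?_
    by_cases hjC : (⟨j, hj⟩ : Fin n) ∈ C
    · refine ⟨Function.update e k ⟨j, hj⟩, k + 1, ⟨?_, ?_⟩, ⟨?_, ?_⟩, ?_⟩
      · have hlt : ∀ i < k, (e i : ℕ) < j := fun i hi => ((he.mem (e i)).2 ⟨i, hi, rfl⟩).2
        intro i hi i' hi'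
        simp only [Function.update_apply]
        split_ifs with c₁ c₂ c₂
        · omega
        · intro h; have := hlt i' (by omega); rw [← h] at this; simp at this
        · intro h; have := hlt i (by omega); rw [h] at this; simp at this
        · exact he.inj i (by omega) i' (by omega)
      · intro v
        have : v ∈ {v ∈ C | (v : ℕ) < j + 1} ↔ v ∈ {v ∈ C | (v : ℕ) < j} ∨ v = ⟨j, hj⟩ := by
          simp only [Set.mem_ofPred_eq, Nat.lt_succ_iff_lt_or_eq, Fin.ext_iff]
          constructor
          · rintro ⟨h, h' | h'⟩
            · exact .inl ⟨h, h'⟩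
            · exact .inr h'
          · rintro (h | h)
            · exact ⟨h.1, .inl h.2⟩
            · obtain rfl : v = ⟨j, hj⟩ := Fin.ext h
              exact ⟨hjC, .inr rfl⟩
        rw [this, he.mem]
        constructor
        · rintro (⟨i, hi, rfl⟩ | rfl)
          · exact ⟨i, by omega, by simp [hi.ne]⟩
          · exact ⟨k, by omega, by simp⟩
        · rintro ⟨i, hi, rfl⟩
          rcases Nat.lt_succ_iff_lt_or_eq.1 hi with hi | rfl
          · exact .inl ⟨i, hi, by simp [hi.ne]⟩
          · exact .inr (by simp)
      · simp [e₁, hjC, hk.1]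
      · intro i hi
        simp [e₁, hjC, hk.1, Function.update_apply]
        split_ifs
        · rfl
        · exact hk.2 i (by omega)
      · intro v hv
        have := hD v
        by_cases hvj : (v : ℕ) = j
        · simpa [e₁, hjC, hvj] using show v ∈ C by rwa [show v = ⟨j, hj⟩ from Fin.ext hvj]
        · simpa [e₁, hjC, hvj] using this (by omega)
    · refine ⟨e, k, ⟨he.inj, fun v => ?_⟩, ⟨?_, ?_⟩, ?_⟩
      · rw [← he.mem]
        simp only [Set.mem_ofPred_eq, Nat.lt_succ_iff_lt_or_eq]
        refine ⟨?_, fun h => ⟨h.1, .inl h.2⟩⟩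
        rintro ⟨h, h' | h'⟩
        · exact ⟨h, h'⟩
        · exact absurd (show (⟨j, hj⟩ : Fin n) ∈ C by rwa [show (⟨j, hj⟩ : Fin n) = v from
            Fin.ext h'.symm]) hjC
      · simp [e₁, hjC, hk.1]
      · simpa [e₁, hjC, hk.1] using hk.2
      · intro v hv
        have := hD v
        simp [e₁, hjC]
        split_ifs with hvj
        · simpa [show v = ⟨j, hj⟩ from Fin.ext hvj] using hjC
        · exact this (by omega)
  · rintro ν f ⟨e, k, he, hk, hD⟩
    exact ⟨e, k, by simpa using he, hk, fun v => hD v v.2⟩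
  · omega

/-- Sets `has` to `1` if `v` or one of its neighbours is marked. -/
def coverP : Stmt Var Arr :=
  .for_ .x (.var .n) (.ifEq (.get .mark (.var .x)) (.lit 1)
    (.ifEq (.var .x) (.var .v) (.set .has (.lit 1))
      (.ifEq (.get .adj (.add (.get .off (.var .v)) (.var .x))) (.lit 1)
        (.set .has (.lit 1)) .skip)) .skip)

theorem tri_coverP (hc : Ctx G L μ) {S : Set (Fin n)} {v : Fin n} (hS : Holds .mark S μ)
    (hv : μ.reg .v = v) (h0 : μ.reg .has = 0) :
    Tri coverP μ (40 * n + 10) fun ν => ν.reg .has = 1 ↔ ∃ x ∈ S, x = v ∨ G.Adj v x := by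
  refine Tri.for (fun j ν => ν.reg .has = 1 ↔ ∃ x ∈ S, (x : ℕ) < j ∧ (x = v ∨ G.Adj v x)) 36
    hc.n_eq ?_ (by simp [h0]) (fun j ν hj f h => Tri.leaf ?_) fun ν f h => by rw [h]; simp
  · simp only [Expr.cost]; omega
  · have hc' := hc.frame f
    have e₁ : ν.arr .mark j = 1 ↔ (⟨j, hj⟩ : Fin n) ∈ S := (hS.frame f) ⟨j, hj⟩
    have e₂ : ν.reg .v = v := (f.1 _ rfl).trans hv
    have e₃ := hc'.adj v ⟨j, hj⟩
    have e₄ := hc'.off v v.2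
    have e₅ : j = v ↔ (⟨j, hj⟩ : Fin n) = v := by rw [Fin.ext_iff]
    have e₆ : (∃ x ∈ S, (x : ℕ) < j + 1 ∧ (x = v ∨ G.Adj v x)) ↔
        (∃ x ∈ S, (x : ℕ) < j ∧ (x = v ∨ G.Adj v x)) ∨
          ((⟨j, hj⟩ : Fin n) ∈ S ∧ ((⟨j, hj⟩ : Fin n) = v ∨ G.Adj v ⟨j, hj⟩)) := by
      simp only [Nat.lt_succ_iff_lt_or_eq]
      constructor
      · rintro ⟨x, hx, h | h, hxv⟩
        · exact .inl ⟨x, hx, h, hxv⟩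
        · obtain rfl : x = ⟨j, hj⟩ := Fin.ext h
          exact .inr ⟨hx, hxv⟩
      · rintro (⟨x, hx, h, hxv⟩ | ⟨hx, hxv⟩)
        · exact ⟨x, hx, .inl h, hxv⟩
        · exact ⟨_, hx, .inr rfl, hxv⟩
    simp only at e₃
    rw [e₆, ← h]
    simp [e₁, e₂, e₃, e₄, e₅]
    split_ifs <;> simp_all

/-- Sets `bad` to `0` if the marked vertices dominate the listed ones. -/
def dominateP : Stmt Var Arr :=
  .set .bad (.lit 0) ;;
  .for_ .i (.var .k) ((.set .has (.lit 0) ;; .set .v (.get .vs (.var .i))) ;; coverP ;;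
    .ifEq (.var .has) (.lit 1) .skip (.set .bad (.lit 1)))

theorem tri_dominateP (hc : Ctx G L μ) {S C : Set (Fin n)} {e : ℕ → Fin n} {k : ℕ}
    (he : Enum C e k) (hk : HoldsEnum e k μ) (hS : Holds .mark S μ) :
    Tri dominateP μ (80 * (n + 1) ^ 2) fun ν => ν.reg .bad = 0 ↔ G.Dominates S C := by
  refine Tri.seq_le (T' := 69 * (n + 1) ^ 2) (Q' := fun ν => ν.reg .bad = 0)
    (Tri.leaf (T := 3) (by simp)) (fun ν₁ f₁ h₁ => Tri.for
      (fun j ν => ν.reg .bad = 0 ↔ ∀ i < j, ∃ x ∈ S, x = e i ∨ G.Adj (e i) x)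
      (5 + (40 * n + 10 + 5)) (hk.frame f₁).1 ?_ (by simpa using h₁) ?_ ?_) ?_
  · simp only [Expr.cost]; nlinarith [he.le]
  · intro j ν hj f h
    refine Tri.seq' (Q' := fun ξ => ξ.reg .has = 0 ∧ ξ.reg .v = e j ∧ ξ.reg .bad = ν.reg .bad)
      (Tri.leaf ?_) fun ν₂ f₂ h₂ => Tri.seq' (tri_coverP
        (((hc.frame f₁).frame f).setReg .i j |>.frame f₂)
        (((hS.frame f₁).frame f).setReg .i j |>.frame f₂) h₂.2.1 h₂.1) fun ν₃ f₃ h₃ =>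
        Tri.leaf ?_
    · have := ((hk.frame f₁).frame f).2 j hj
      simp [this]
    · have e₁ : ν₃.reg .bad = ν.reg .bad := (f₃.1 _ rfl).trans h₂.2.2
      have e₂ : (∀ i < j + 1, ∃ x ∈ S, x = e i ∨ G.Adj (e i) x) ↔ ν₃.reg .bad = 0 ∧
          ν₃.reg .has = 1 := by
        rw [e₁, h, h₃]
        simp only [Nat.lt_succ_iff_lt_or_eq]
        exact ⟨fun h => ⟨fun i hi => h i (.inl hi), h j (.inr rfl)⟩, fun h i hi => by
          rcases hi with hi | rfl
          · exact h.1 i hi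
          · exact h.2⟩
      rw [e₂]
      simp
      split_ifs with c <;> simp [c]
  · intro ν f h
    rw [h]
    unfold Dominates
    constructor
    · intro h v hv
      obtain ⟨i, hi, rfl⟩ := (he.mem v).1 hv
      exact h i hi
    · intro h i hi
      exact h _ ((he.mem _).2 ⟨i, hi, rfl⟩)
  · have : 1 ≤ (n + 1) ^ 2 := Nat.one_le_pow _ _ (by omega)
    omega

/-- Copies the first `n` cells of array `b` to array `a`. -/
def copyP (a b : Arr) : Stmt Var Arr :=
  .for_ .x (.var .n) (.put a (.var .x) (.get b (.var .x)))

theorem tri_copyP (a b : Arr) (hab : b ≠ a) (hn : μ.reg .n = n) :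
    Tri (copyP a b) μ (20 * n + 10) fun ν => ∀ v < n, ν.arr a v = μ.arr b v := by
  refine Tri.for (fun j ν => ∀ v < j, ν.arr a v = μ.arr b v) 10 hn ?_ (by simp)
    (fun j ν hj f h => Tri.leaf ?_ rfl ?_) fun ν f h v => h v
  · simp only [Expr.cost]; omega
  · have hb : ν.arr b = μ.arr b := f.2 b (by simp [Stmt.setsArr, hab])
    intro v hv
    simp [hb]
    split_ifs with hvj
    · rw [hvj]
    · exact h v (by omega)
  · simp [Stmt.bound, Expr.cost]

/-! ### Shrinking to a minimal connected dominating set. -/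

/-- Tries to remove the vertex number `j` from the dominating set `inD`. -/
def shrinkStepP : Stmt Var Arr :=
  .set .u (.get .vs (.var .j)) ;; copyP .allow .inD ;;
    (.put .allow (.var .u) (.lit 0) ;; .put .allow (.var .r) (.lit 1)) ;; reachP ;; dominateP ;;
    .ifEq (.var .bad) (.lit 0) (copyP .inD .mark) .skip

/-- The root is put back after the removal, so the search always starts inside the allowed set, and
the step with `e j = r` removes nothing when `r ∈ D`. -/
theorem tri_shrinkStepP (hc : Ctx G L μ) {C D : Set (Fin n)} {e : ℕ → Fin n} {j k : ℕ}
    (he : Enum C e k) (hk : HoldsEnum e k μ) {r : Fin n} (hr : μ.reg .r = r)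
    (hD : Holds .inD D μ) (hj : μ.reg .j = j) (hjk : j < k) :
    Tri shrinkStepP μ (280 * (n + 1) ^ 3) fun ν =>
      (G.Dominates (G.reach (insert r (D \ {e j})) r) C ∧
        Holds .inD (G.reach (insert r (D \ {e j})) r) ν) ∨
      (¬ G.Dominates (G.reach (insert r (D \ {e j})) r) C ∧ Holds .inD D ν) := by
  set S := insert r (D \ {e j}) with hS
  refine Tri.seq_le (T := 4) (Q' := fun ν => ν.reg .u = e j) (Tri.leaf ?_) (fun ν₁ f₁ h₁ =>
    Tri.seq' (tri_copyP .allow .inD (by decide) (hc.frame f₁).n_eq) fun ν₂ f₂ h₂ =>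
    Tri.seq' (Q' := Holds .allow S) (T := 8) (Tri.leaf ?_) fun ν₃ f₃ h₃ =>
    Tri.seq' (tri_reachP (((hc.frame f₁).frame f₂).frame f₃)
      ((f₃.1 _ rfl).trans <| (f₂.1 _ rfl).trans <| (f₁.1 _ rfl).trans hr) h₃
      (Set.mem_insert _ _)) fun ν₄ f₄ h₄ =>
    Tri.seq' (tri_dominateP ((((hc.frame f₁).frame f₂).frame f₃).frame f₄) he
      ((((hk.frame f₁).frame f₂).frame f₃).frame f₄) h₄) fun ν₅ f₅ h₅ =>
    Tri.ifEq (T := 20 * n + 10) (fun hb => ?_) fun hb => ?_) ?_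
  · simp [hj, hk.2 j hjk]
  · have e₁ : ν₂.reg .u = e j := (f₂.1 _ rfl).trans h₁
    have e₂ : ν₂.reg .r = r := (f₂.1 _ rfl).trans <| (f₁.1 _ rfl).trans hr
    intro v
    have e₃ : ν₂.arr .allow v = 1 ↔ v ∈ D := by rw [h₂ v v.2]; exact (hD.frame f₁) v
    simp [e₁, e₂, ← Fin.ext_iff, hS]
    split_ifs with c₁
    · simp [c₁]
    · by_cases c₂ : v = r <;> simp_all
  · refine (tri_copyP .inD .mark (by decide)
      (((((hc.frame f₁).frame f₂).frame f₃).frame f₄).frame f₅).n_eq).mono le_rfl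
      fun ν₆ f₆ h₆ => .inl ⟨h₅.1 (by simpa using hb), fun v => ?_⟩
    rw [h₆ v v.2]
    exact (h₄.frame f₅) v
  · refine Tri.leaf (.inr ⟨fun h => hb (by simpa using h₅.2 h), ?_⟩) rfl
      (by simp [Stmt.bound])
    exact ((((hD.frame f₁).frame f₂).frame f₃).frame f₄).frame f₅
  · simp only [Expr.cost]
    nlinarith [Nat.zero_le (n ^ 2), Nat.zero_le (n ^ 3)]

/-- Shrinks the connected dominating set `inD` to a minimal one. -/
def shrinkP : Stmt Var Arr := .for_ .j (.var .k) shrinkStepP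

/-- One pass suffices. `D` only shrinks and `reach` is monotone, so a vertex that could not be
dropped once cannot be dropped later. -/
theorem tri_shrinkP (hc : Ctx G L μ) {C : Set (Fin n)} {e : ℕ → Fin n} {k : ℕ}
    (he : Enum C e k) (hk : HoldsEnum e k μ) {r : Fin n} (hr : μ.reg .r = r)
    (hC : C = G.reach Set.univ r) (hD : Holds .inD C μ) :
    Tri shrinkP μ (290 * (k * (n + 1) ^ 3) + 3) fun ν =>
      ∃ D : Set (Fin n), Holds .inD D ν ∧ G.IsMinimalConnectedDominating C D r := by
  refine Tri.for (fun j ν => ∃ D : Set (Fin n), Holds .inD D ν ∧ r ∈ D ∧ D ⊆ C ∧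
      D ⊆ G.reach D r ∧ G.Dominates D C ∧
      ∀ i < j, e i ∈ D → e i ≠ r → ¬ G.Dominates (G.reach (D \ {e i}) r) C) (280 * (n + 1) ^ 3)
    hk.1 ?_ ⟨C, hD, ?_, subset_rfl, ?_, fun v hv => ⟨v, hv, .inl rfl⟩, by simp⟩ ?_ ?_
  · simp only [Expr.cost]
    have : k ≤ k * (n + 1) ^ 3 := Nat.le_mul_of_pos_right _ (by positivity)
    nlinarith
  · rw [hC]; exact self_mem_reach
  · rw [hC, reach_reach]
  · rintro j ν hj f ⟨D, h₁, h₂, h₃, h₄, h₅, h₆⟩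
    refine (tri_shrinkStepP ((hc.frame f).setReg .j j) he ((hk.frame f).setReg .j j) (r := r)
      (by simpa using (f.1 .r rfl).trans hr) (h₁.setReg .j j) (j := j) (by simp) hj).mono le_rfl
      fun ξ _ h => ?_
    rcases h with ⟨hdom, hD'⟩ | ⟨hdom, hD'⟩
    · set S := insert r (D \ {e j}) with hS
      have hSD : S ⊆ D := Set.insert_subset h₂ Set.sdiff_subset
      have hRS : G.reach S r ⊆ S := reach_subset (Set.mem_insert _ _)
      refine ⟨_, hD', self_mem_reach, hRS.trans (hSD.trans h₃), by rw [reach_reach], hdom, ?_⟩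
      intro i hi hiD hir
      rcases Nat.lt_succ_iff_lt_or_eq.1 hi with hi | rfl
      · exact fun h => h₆ i hi (hSD (hRS hiD)) hir
          (h.mono (reach_mono (Set.sdiff_subset_sdiff_left (hRS.trans hSD))))
      · rcases hRS hiD with h | h
        · exact absurd h hir
        · exact absurd rfl h.2
    · refine ⟨D, hD', h₂, h₃, h₄, h₅, ?_⟩
      intro i hi hiD hir
      rcases Nat.lt_succ_iff_lt_or_eq.1 hi with hi | rfl
      · exact h₆ i hi hiD hir
      · rwa [Set.insert_eq_of_mem (show r ∈ D \ {e i} from ⟨h₂, fun h => hir h.symm⟩)] at hdom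
  · rintro ν f ⟨D, h₁, h₂, h₃, h₄, h₅, h₆⟩
    refine ⟨D, h₁, h₂, h₄, h₃, h₅, fun u hu hur => ?_⟩
    obtain ⟨i, hi, rfl⟩ := (he.mem u).1 (h₃ hu)
    exact h₆ i hi hu hur

/-! ### Numbering the dominating vertices and turning their colors into forbidden colors. -/

/-- Clears the array `domi`. -/
def clearDomiP : Stmt Var Arr := .for_ .x (.var .n) (.put .domi (.var .x) (.lit 0))

theorem tri_clearDomiP (hn : μ.reg .n = n) :
    Tri clearDomiP μ (20 * n + 10) fun ν => ∀ v < n, ν.arr .domi v = 0 := by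
  refine Tri.for (fun j ν => ∀ v < j, ν.arr .domi v = 0) 10 hn ?_ (by simp)
    (fun j ν hj f h => Tri.leaf ?_) fun ν f h v => h v
  · simp only [Expr.cost]; omega
  · intro v hv
    simp
    intro hvj
    exact h v (by omega)

/-- Stores `d` in the cells of `domi` that belong to neighbours of `u`. -/
def pointP : Stmt Var Arr :=
  .for_ .y (.var .n) (.ifEq (.get .adj (.add (.get .off (.var .u)) (.var .y))) (.lit 1)
    (.put .domi (.var .y) (.var .d)) .skip)

open Classical in
theorem tri_pointP (hc : Ctx G L μ) {u : Fin n} (hu : μ.reg .u = u) :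
    Tri pointP μ (30 * n + 10) fun ν =>
      ∀ w : Fin n, ν.arr .domi w = if G.Adj u w then μ.reg .d else μ.arr .domi w := by
  refine Tri.for (fun j ν => ∀ w : Fin n, ν.arr .domi w =
    if G.Adj u w ∧ (w : ℕ) < j then μ.reg .d else μ.arr .domi w) 20 hc.n_eq ?_ (by simp)
    (fun j ν hj f h => Tri.leaf ?_) fun ν f h w => by simp [h w]
  · simp only [Expr.cost]; omega
  · have hc' := hc.frame f
    have e₁ : ν.reg .u = u := (f.1 _ rfl).trans hu
    have e₂ : ν.reg .d = μ.reg .d := f.1 _ rfl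
    have e₃ := hc'.adj u ⟨j, hj⟩
    have e₄ := hc'.off u u.2
    simp only at e₃
    intro w
    have e₅ : (w : ℕ) = j ↔ w = ⟨j, hj⟩ := by rw [Fin.ext_iff]
    have e₆ : (w : ℕ) < j + 1 ↔ (w : ℕ) < j ∨ w = ⟨j, hj⟩ := by
      rw [← e₅]; exact Nat.lt_succ_iff_lt_or_eq
    simp only [e₆]
    simp [e₁, e₂, e₃, e₄, e₅, h w]
    grind

/-- Numbers the vertices of `inD` from `1` on, and stores for every vertex the number of a
neighbour in `inD`, if there is one. -/
def rankP : Stmt Var Arr :=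
  clearDomiP ;; .set .d (.lit 1) ;; .for_ .j (.var .k)
    (.set .u (.get .vs (.var .j)) ;; .ifEq (.get .inD (.var .u)) (.lit 1)
      (pointP ;; .set .d (.add (.var .d) (.lit 1))) .skip)

/-- The numbers in `domi` are less than `d`, and for every proper coloring there are `d` colors
such that no vertex `w` of `C` has the color with number `domi w`. -/
def Guides (G : SimpleGraph (Fin n)) (C : Set (Fin n)) (d : ℕ) (μ : Mem Var Arr) : Prop :=
  (∀ w ∈ C, μ.arr .domi w < d) ∧ ∀ f : Fin n → Fin 3, (∀ u v, G.Adj u v → f u ≠ f v) →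
    ∃ g : ℕ → ℕ, (∀ i, g i < 3) ∧ ∀ w ∈ C, (f w : ℕ) ≠ g (μ.arr .domi w)

/-- The color of the vertex number `domi w` is forbidden at its neighbour `w`. The number `0` marks
a vertex without neighbours in `D`; by domination and connectedness this can only be `r`. There any
color other than `f r` may be forbidden, and the next one modulo `3` is taken. -/
theorem guides_of_rank {C D : Set (Fin n)} {r : Fin n} {d : ℕ} {ρ : ℕ → Fin n}
    (hD : G.IsMinimalConnectedDominating C D r) (hd : 1 ≤ d)
    (h : ∀ w : Fin n, (μ.arr .domi w = 0 ∧ ∀ u ∈ D, ¬ G.Adj u w) ∨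
      (1 ≤ μ.arr .domi w ∧ μ.arr .domi w < d ∧ G.Adj (ρ (μ.arr .domi w)) w)) : Guides G C d μ := by
  refine ⟨fun w _ => by rcases h w with h | h <;> omega, fun f hf => ?_⟩
  refine ⟨fun i => if i = 0 then ((f r : ℕ) + 1) % 3 else f (ρ i), fun i => ?_, fun w hw => ?_⟩
  · dsimp only; split_ifs <;> omega
  rcases h w with ⟨h₀, h₁⟩ | ⟨h₁, -, h₂⟩
  · have hwr : w = r := by
      obtain ⟨x, hx, hxw⟩ := hD.dominates w hw
      have hxw : x = w := hxw.resolve_right fun h => h₁ x hx h.symm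
      subst hxw
      by_contra hne
      obtain ⟨k, hk⟩ : ∃ k, (G.within D).dist r x = k + 1 :=
        Nat.exists_eq_succ_of_ne_zero
          (by rw [Ne, Reachable.dist_eq_zero_iff (hD.connected hx)]; exact fun h => hne h.symm)
      obtain ⟨p, hp, -, -⟩ := Reachable.exists_adj_dist_eq (hD.connected hx) hk
      exact h₁ p hp.2.1 hp.1
    have h₀' : (if μ.arr .domi w = 0 then ((f r : ℕ) + 1) % 3 else f (ρ (μ.arr .domi w))) =
        ((f r : ℕ) + 1) % 3 := if_pos h₀
    change (f w : ℕ) ≠ (if μ.arr .domi w = 0 then ((f r : ℕ) + 1) % 3 else _)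
    rw [h₀', hwr]
    omega
  · change (f w : ℕ) ≠ (if μ.arr .domi w = 0 then ((f r : ℕ) + 1) % 3 else _)
    rw [if_neg (by omega)]
    exact fun h => hf _ _ h₂ (Fin.ext h.symm)

/-- Overwriting `domi` is harmless, as any neighbour in `D` will do. In the invariant `ρ` is the
inverse of the numbering, and `d` exceeds the number of vertices of `D` met so far by one, because
`0` is reserved. -/
theorem tri_rankP (hc : Ctx G L μ) {C D : Set (Fin n)} {e : ℕ → Fin n} {k : ℕ}
    (he : Enum C e k) (hk : HoldsEnum e k μ) {r : Fin n} (hD : Holds .inD D μ)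
    (hmin : G.IsMinimalConnectedDominating C D r) :
    Tri rankP μ (100 * (n + 1) ^ 2) fun ν => ∃ d, ν.reg .d = d ∧ 1 ≤ d ∧ d ≤ k + 1 ∧
      d ≤ D.ncard + 1 ∧ Guides G C d ν := by
  classical
  refine Tri.seq_le (tri_clearDomiP hc.n_eq) (fun ν₁ f₁ h₁ => Tri.seq' (T := 3)
    (T' := 80 * (n + 1) ^ 2)
    (Q' := fun ν => ν.reg .d = 1 ∧ ∀ v < n, ν.arr .domi v = 0) (Tri.leaf ?_) fun ν₂ f₂ h₂ =>
    Tri.for (fun j ν => ∃ (d : ℕ) (ρ : ℕ → Fin n), ν.reg .d = d ∧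
        d = ((Finset.range j).filter fun i => e i ∈ D).card + 1 ∧
        ∀ w : Fin n, (ν.arr .domi w = 0 ∧ ∀ i < j, e i ∈ D → ¬ G.Adj (e i) w) ∨
          (1 ≤ ν.arr .domi w ∧ ν.arr .domi w < d ∧ G.Adj (ρ (ν.arr .domi w)) w))
      (4 + (2 + (1 + (1 + ((30 * n + 10) + 4))))) ((hk.frame f₁).frame f₂).1 ?_
      ⟨1, fun _ => r, h₂.1, by simp, fun w => .inl ⟨h₂.2 w w.2, by simp⟩⟩ ?_ ?_) ?_
  · simpa using h₁
  · simp only [Expr.cost]; nlinarith [he.le]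
  · rintro j ν hj f ⟨d, ρ, hd, hcard, hρ⟩
    have hc₃ := ((hc.frame f₁).frame f₂).frame f
    have hk₃ := ((hk.frame f₁).frame f₂).frame f
    have hD₃ := ((hD.frame f₁).frame f₂).frame f
    refine Tri.seq' (Q' := fun ξ => ξ.reg .u = e j ∧ ξ.reg .d = d ∧ ξ.arr .domi = ν.arr .domi)
      (Tri.leaf ?_) fun ν₄ f₄ h₄ => Tri.ifEq (fun hb => ?_) fun hb => ?_
    · have := hk₃.2 j hj
      simp [this, hd]
    · have hb : e j ∈ D := by
        simp [h₄.1] at hb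
        exact (((hD₃.setReg .j j).frame f₄) (e j)).1 hb
      refine Tri.seq' (tri_pointP ((hc₃.setReg .j j).frame f₄) h₄.1) fun ν₅ f₅ h₅ => Tri.leaf ?_
      have e₁ : ν₅.reg .d = d := (f₅.1 _ rfl).trans h₄.2.1
      refine ⟨d + 1, Function.update ρ d (e j), by simp [e₁], ?_, ?_⟩
      · rw [Finset.range_add_one, Finset.filter_insert, if_pos hb, Finset.card_insert_of_notMem
          (by simp), ← hcard]
      · intro w
        have := h₅ w
        simp only [Stmt.run_set, Mem.setReg_arr]
        rw [this, h₄.2.1, h₄.2.2]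
        split_ifs with hadj
        · exact .inr ⟨by omega, by omega, by simpa using hadj⟩
        · rcases hρ w with ⟨h0, h'⟩ | ⟨h0, h', h''⟩
          · refine .inl ⟨h0, fun i hi => ?_⟩
            rcases Nat.lt_succ_iff_lt_or_eq.1 hi with hi | rfl
            · exact h' i hi
            · exact fun _ => hadj
          · exact .inr ⟨h0, by omega, by simpa [h'.ne] using h''⟩
    · have hb : e j ∉ D := fun h => by
        simp [h₄.1] at hb
        exact hb ((((hD₃.setReg .j j).frame f₄) (e j)).2 h)
      refine Tri.leaf ?_ rfl (by simp [Stmt.bound])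
      refine ⟨d, ρ, h₄.2.1, ?_, ?_⟩
      · rw [Finset.range_add_one, Finset.filter_insert, if_neg hb, hcard]
      · intro w
        simp only [Stmt.run_skip, h₄.2.2]
        refine (hρ w).imp (fun h => ⟨h.1, fun i hi => ?_⟩) id
        rcases Nat.lt_succ_iff_lt_or_eq.1 hi with hi | rfl
        · exact h.2 i hi
        · exact fun h => absurd h hb
  · rintro ν f ⟨d, ρ, hd, hcard, hρ⟩
    refine ⟨d, hd, by omega, ?_, ?_, guides_of_rank (ρ := ρ) hmin (by omega) fun w => ?_⟩
    · have := (Finset.card_filter_le (Finset.range k) fun i => e i ∈ D)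
      rw [Finset.card_range] at this
      omega
    · rw [hcard, Set.ncard_eq_toFinset_card']
      refine Nat.add_le_add_right (Finset.card_le_card_of_injOn e (fun i hi => ?_) ?_) 1
      · simpa using (Finset.mem_filter.1 hi).2
      · intro i hi i' hi'
        exact he.inj i (by simp at hi; exact hi.1) i' (by simp at hi'; exact hi'.1)
    · refine (hρ w).imp (fun h => ⟨h.1, fun u hu => ?_⟩) id
      obtain ⟨i, hi, rfl⟩ := (he.mem u).1 (hmin.subset hu)
      exact h.2 i hi hu
  · nlinarith [Nat.zero_le (n ^ 2)]

/-! ### Constraint satisfaction by variable elimination -/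

/-- Every compatible pair of literals below block `j` is compatible with some literal of it. -/
def ClosedAt (R : ℕ → ℕ → Prop) (j : ℕ) : Prop :=
  ∀ x < 3 * j, ∀ y < 3 * j, R x y →
    ∃ c < 3, R x (3 * j + c) ∧ R y (3 * j + c) ∧ R (3 * j + c) (3 * j + c)

/-- `ch` chooses pairwise compatible literals from the blocks below `j`. -/
def Good (R : ℕ → ℕ → Prop) (ch : ℕ → ℕ) (j : ℕ) : Prop :=
  ∀ i < j, (3 * i ≤ ch i ∧ ch i < 3 * i + 3) ∧ R (ch i) (ch i) ∧ ∀ i' < i, R (ch i') (ch i)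

/-- `ch` is a choice for the blocks below `j` that cannot be extended to block `j`. -/
def Stuck (R : ℕ → ℕ → Prop) (ch : ℕ → ℕ) (j : ℕ) : Prop :=
  Good R ch j ∧ ∀ c < 3, ¬ (R (3 * j + c) (3 * j + c) ∧ ∀ i < j, R (ch i) (3 * j + c))

/-- As at most two literals of a block are allowed, pairwise compatibility suffices. -/
theorem not_stuck {R : ℕ → ℕ → Prop} {ch : ℕ → ℕ} {j c₀ b : ℕ} (hR : ClosedAt R j)
    (hc₀ : c₀ < 3) (hj₀ : R (3 * j + c₀) (3 * j + c₀)) (hb : b < 3)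
    (hbR : ¬ R (3 * j + b) (3 * j + b)) : ¬ Stuck R ch j := by
  rintro ⟨hg, hs⟩
  rcases Nat.eq_zero_or_pos j with rfl | hj
  · exact hs c₀ hc₀ ⟨hj₀, by simp⟩
  -- An earlier choice that rejects the color `c`; the index `0` is a dummy for colors that are not
  -- admissible at all.
  have hw : ∀ c, ∃ i < j, c < 3 → R (3 * j + c) (3 * j + c) → ¬ R (ch i) (3 * j + c) := by
    intro c
    by_cases h : c < 3 ∧ R (3 * j + c) (3 * j + c)
    · have := hs c h.1
      push Not at this
      obtain ⟨i, hi, h'⟩ := this h.2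
      exact ⟨i, hi, fun _ _ => h'⟩
    · exact ⟨0, hj, fun h₁ h₂ => absurd ⟨h₁, h₂⟩ h⟩
  choose i hi hiR using hw
  have hpair : ∀ p < j, ∀ q < j, ∃ c < 3, R (ch p) (3 * j + c) ∧ R (ch q) (3 * j + c) ∧
      R (3 * j + c) (3 * j + c) := by
    intro p hp q hq
    have hp' := (hg p hp).1
    have hq' := (hg q hq).1
    rcases lt_trichotomy p q with h | rfl | h
    · exact hR _ (by omega) _ (by omega) ((hg q hq).2.2 p h)
    · exact hR _ (by omega) _ (by omega) (hg p hp).2.1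
    · obtain ⟨c, h₁, h₂, h₃, h₄⟩ := hR _ (by omega) _ (by omega) ((hg p hp).2.2 q h)
      exact ⟨c, h₁, h₃, h₂, h₄⟩
  -- Closedness is applied to the two choices that reject the two colors other than `b`. The common
  -- color it yields is not `b`, so one of the two choices does reject it.
  obtain ⟨c, hc, h₁, h₂, h₃⟩ := hpair _ (hi ((b + 1) % 3)) _ (hi ((b + 2) % 3))
  have hcb : c ≠ b := by rintro rfl; exact hbR h₃
  rcases (by omega : c = (b + 1) % 3 ∨ c = (b + 2) % 3) with h | h
  · rw [← h] at h₁; exact hiR c hc h₃ h₁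
  · rw [← h] at h₂; exact hiR c hc h₃ h₂

/-- The relation `R` after the elimination of the block that starts with literal `z`. -/
def elimRel (R : ℕ → ℕ → Prop) (z x y : ℕ) : Prop :=
  R x y ∧ (x < z → y < z → ∃ c < 3, R x (z + c) ∧ R y (z + c) ∧ R (z + c) (z + c))

theorem ClosedAt.elimRel_self (R : ℕ → ℕ → Prop) (j : ℕ) : ClosedAt (elimRel R (3 * j)) j := by
  rintro x hx y hy ⟨-, h⟩
  obtain ⟨c, hc, h₁, h₂, h₃⟩ := h hx hy
  exact ⟨c, hc, ⟨h₁, by omega⟩, ⟨h₂, by omega⟩, ⟨h₃, by omega⟩⟩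

/-- An elimination only thins out pairs of literals below the eliminated block, and the literals of
a later block are not among them. This is why the blocks are eliminated from last to first. -/
theorem ClosedAt.elimRel {R : ℕ → ℕ → Prop} {i j : ℕ} (h : ClosedAt R j) (hij : i < j) :
    ClosedAt (elimRel R (3 * i)) j := by
  rintro x hx y hy ⟨h', -⟩
  obtain ⟨c, hc, h₁, h₂, h₃⟩ := h x hx y hy h'
  exact ⟨c, hc, ⟨h₁, by omega⟩, ⟨h₂, by omega⟩, ⟨h₃, by omega⟩⟩

/-- The entry of the table `tab` for the literals `x` and `y`. -/
def entry (μ : Mem Var Arr) (x y : ℕ) : Prop := μ.arr .tab (μ.arr .off3 x + y) = 1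

/-- The table `tab` holds the relation `R` on the literals below `N`. -/
def Tab (N : ℕ) (R : ℕ → ℕ → Prop) (μ : Mem Var Arr) : Prop :=
  ∀ x < N, ∀ y < N, entry μ x y ↔ R x y

theorem entry_frame {P : Stmt Var Arr} (hf : Frame P μ ν)
    (hP : P.setsArr .tab = false ∧ P.setsArr .off3 = false := by decide) : entry ν = entry μ := by
  unfold entry; rw [hf.2 _ hP.1, hf.2 _ hP.2]

@[simp] theorem entry_setReg (v : Var) (x : ℕ) : entry (μ.setReg v x) = entry μ := by
  unfold entry; rw [Mem.setReg_arr]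

theorem Ctx.index_eq_iff (hc : Ctx G L μ) {x y x' y' : ℕ} (hx : x < 3 * n) (hx' : x' < 3 * n)
    (hy : y < 3 * n) (hy' : y' < 3 * n) :
    μ.arr .off3 x' + y' = μ.arr .off3 x + y ↔ x' = x ∧ y' = y := by
  rw [hc.off3 x hx, hc.off3 x' hx']
  refine ⟨fun h => ?_, by rintro ⟨rfl, rfl⟩; rfl⟩
  have h₁ : x' = x := by
    have := congrArg (· / (3 * n)) h
    simpa [Nat.mul_comm _ (3 * n), Nat.mul_add_div (by omega : 0 < 3 * n), Nat.div_eq_of_lt hy,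
      Nat.div_eq_of_lt hy'] using this
  subst h₁
  exact ⟨rfl, by omega⟩

/-- One check of an elimination step. -/
def elimTestP (c : ℕ) : Stmt Var Arr :=
  .ifEq (.get .tab (.add (.get .off3 (.var .x)) (.add (.var .z) (.lit c)))) (.lit 1)
    (.ifEq (.get .tab (.add (.get .off3 (.var .y)) (.add (.var .z) (.lit c)))) (.lit 1)
      (.ifEq (.get .tab (.add (.get .off3 (.add (.var .z) (.lit c)))
        (.add (.var .z) (.lit c)))) (.lit 1) (.set .s (.lit 1)) .skip) .skip) .skip

/-- Updates the entry for the literals `x` and `y` in an elimination step. -/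
def elimCellP : Stmt Var Arr :=
  .set .s (.lit 0) ;; elimTestP 0 ;; elimTestP 1 ;; elimTestP 2 ;;
    .ifEq (.var .s) (.lit 1) .skip
      (.put .tab (.add (.get .off3 (.var .x)) (.var .y)) (.lit 0))

theorem run_elimCellP (hc : Ctx G L μ) {N x y : ℕ} (hN : N ≤ 3 * n)
    (hx : μ.reg .x = x) (hy : μ.reg .y = y) (hxN : x < N) (hyN : y < N) :
    ∀ x' < N, ∀ y' < N, entry (elimCellP.run μ) x' y' ↔ entry μ x' y' ∧
      (x' = x → y' = y → ∃ c < 3, entry μ x (μ.reg .z + c) ∧ entry μ y (μ.reg .z + c) ∧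
        entry μ (μ.reg .z + c) (μ.reg .z + c)) := by
  intro x' hx' y' hy'
  have hi := hc.index_eq_iff (x := x) (y := y) (x' := x') (y' := y') (by omega) (by omega)
    (by omega) (by omega)
  have h3 : ∀ p : ℕ → Prop, (∃ c < 3, p c) ↔ p 0 ∨ p 1 ∨ p 2 := fun p =>
    ⟨fun ⟨c, hc, h⟩ => by interval_cases c <;> simp [h], by
      rintro (h | h | h)
      exacts [⟨0, by norm_num, h⟩, ⟨1, by norm_num, h⟩, ⟨2, by norm_num, h⟩]⟩
  rw [h3]
  unfold entry elimCellP elimTestP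
  simp [hx, hy, hi]
  grind

/-- Updates the row of `x` in an elimination step. -/
def elimRowP : Stmt Var Arr := .for_ .y (.var .z) elimCellP

theorem tri_elimRowP (hc : Ctx G L μ) {N x z : ℕ} {R : ℕ → ℕ → Prop} (hN : N ≤ 3 * n)
    (hz : μ.reg .z = z) (hzN : z + 3 ≤ N) (hx : μ.reg .x = x) (hxz : x < z)
    (hR : Tab N (fun x' y' => R x' y' ∧ (x' < x ∧ y' < z →
      ∃ c < 3, R x' (z + c) ∧ R y' (z + c) ∧ R (z + c) (z + c))) μ) :
    Tri elimRowP μ (140 * (N + 1)) (Tab N fun x' y' => R x' y' ∧ (x' < x + 1 ∧ y' < z →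
      ∃ c < 3, R x' (z + c) ∧ R y' (z + c) ∧ R (z + c) (z + c))) := by
  refine Tri.for (fun j => Tab N fun x' y' => R x' y' ∧
      ((x' < x ∧ y' < z) ∨ (x' = x ∧ y' < j) →
        ∃ c < 3, R x' (z + c) ∧ R y' (z + c) ∧ R (z + c) (z + c))) 130 hz ?_ ?_
    (fun j ν hj f h => Tri.leaf ?_) fun ν f h x' hx' y' hy' => ?_
  · simp only [Expr.cost]; omega
  · intro x' hx' y' hy'
    simpa using hR x' hx' y' hy'
  · intro x' hx' y' hy'
    have e₁ : ν.reg .x = x := (f.1 _ rfl).trans hx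
    have e₂ : ν.reg .z = z := (f.1 _ rfl).trans hz
    rw [run_elimCellP ((hc.frame f).setReg .y j) hN (x := x) (y := j) (by simpa using e₁) (by simp)
      (by omega) (by omega) x' hx' y' hy']
    simp only [entry_setReg, Mem.setReg_reg, reduceCtorEq, if_false, e₂]
    -- The entries consulted have second index at least `z`, outside the region being overwritten,
    -- so the update in place still reads the values of `R`.
    have hcol : ∀ x' < N, ∀ c < 3, (entry ν x' (z + c) ↔ R x' (z + c)) := by
      intro x' hx' c hc'
      rw [h x' hx' (z + c) (by omega)]
      exact and_iff_left fun h' => by omega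
    have hW : (∃ c < 3, entry ν x (z + c) ∧ entry ν j (z + c) ∧ entry ν (z + c) (z + c)) ↔
        ∃ c < 3, R x (z + c) ∧ R j (z + c) ∧ R (z + c) (z + c) := by
      refine exists_congr fun c => and_congr_right fun hc' => ?_
      rw [hcol x (by omega) c hc', hcol j (by omega) c hc', hcol (z + c) (by omega) c hc']
    rw [hW, h x' hx' y' hy']
    constructor
    · rintro ⟨⟨h₁, h₂⟩, h₃⟩
      refine ⟨h₁, fun h' => ?_⟩
      rcases h' with h' | ⟨rfl, h'⟩
      · exact h₂ (.inl h')
      · rcases Nat.lt_succ_iff_lt_or_eq.1 h' with h' | rfl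
        · exact h₂ (.inr ⟨rfl, h'⟩)
        · exact h₃ rfl rfl
    · rintro ⟨h₁, h₂⟩
      refine ⟨⟨h₁, fun h' => h₂ (h'.imp id fun h => ⟨h.1, by omega⟩)⟩, ?_⟩
      rintro rfl rfl
      exact h₂ (.inr ⟨rfl, by omega⟩)
  · rw [h x' hx' y' hy']; beta_reduce; rw [Nat.lt_succ_iff_lt_or_eq, or_and_right]

/-- Eliminates the block that starts with the literal `z`. -/
def elimStepP : Stmt Var Arr := .for_ .x (.var .z) elimRowP

theorem tri_elimStepP (hc : Ctx G L μ) {N z : ℕ} {R : ℕ → ℕ → Prop} (hN : N ≤ 3 * n)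
    (hz : μ.reg .z = z) (hzN : z + 3 ≤ N) (hR : Tab N R μ) :
    Tri elimStepP μ (150 * (N + 1) ^ 2) (Tab N (elimRel R z)) := by
  refine Tri.for (fun j => Tab N fun x' y' => R x' y' ∧ (x' < j ∧ y' < z →
      ∃ c < 3, R x' (z + c) ∧ R y' (z + c) ∧ R (z + c) (z + c))) (140 * (N + 1)) hz ?_ ?_
    (fun j ν hj f h => ?_) fun ν f h x' hx' y' hy' => ?_
  · simp only [Expr.cost]; nlinarith
  · intro x' hx' y' hy'
    simpa using hR x' hx' y' hy'
  · exact tri_elimRowP ((hc.frame f).setReg .x j) hN (by simpa using (f.1 .z rfl).trans hz) hzN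
      (by simp) hj h
  · rw [h x' hx' y' hy']; beta_reduce; rw [elimRel, and_imp]

/-- Eliminates all blocks, from the last to the first. -/
def elimP : Stmt Var Arr :=
  .for_ .i (.var .k) ((.set .j (.sub (.sub (.var .k) (.lit 1)) (.var .i)) ;;
    .set .z (.add (.var .j) (.add (.var .j) (.var .j)))) ;; elimStepP)

/-- No solution is lost: the literal that a solution `φ` takes in the eliminated block is a witness
for every pair of its other literals. -/
theorem tri_elimP (hc : Ctx G L μ) {k : ℕ} {R₀ : ℕ → ℕ → Prop} (hk : μ.reg .k = k) (hkn : k ≤ n)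
    (hR : Tab (3 * k) R₀ μ) :
    Tri elimP μ (170 * (3 * k + 1) ^ 3) fun ν => ∃ R, Tab (3 * k) R ν ∧ (∀ x y, R x y → R₀ x y) ∧
      (∀ j < k, ClosedAt R j) ∧ ∀ φ : ℕ → ℕ, (∀ j < k, φ j < 3) →
        (∀ i < k, ∀ j < k, R₀ (3 * i + φ i) (3 * j + φ j)) →
        ∀ i < k, ∀ j < k, R (3 * i + φ i) (3 * j + φ j) := by
  refine Tri.for (fun s ν => ∃ R, Tab (3 * k) R ν ∧ (∀ x y, R x y → R₀ x y) ∧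
      (∀ j < k, k - s ≤ j → ClosedAt R j) ∧ ∀ φ : ℕ → ℕ, (∀ j < k, φ j < 3) →
        (∀ i < k, ∀ j < k, R₀ (3 * i + φ i) (3 * j + φ j)) →
        ∀ i < k, ∀ j < k, R (3 * i + φ i) (3 * j + φ j)) (13 + 150 * (3 * k + 1) ^ 2) hk ?_
    ⟨R₀, hR, fun _ _ h => h, fun j hj hj' => by omega, fun _ _ h => h⟩ ?_ ?_
  · simp only [Expr.cost]; nlinarith [Nat.zero_le (k ^ 2), Nat.zero_le (k ^ 3)]
  · rintro s ν hs f ⟨R, h₁, h₂, h₃, h₄⟩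
    refine Tri.seq' (Q' := fun ν => ν.reg .z = 3 * (k - 1 - s)) (Tri.leaf ?_) fun ν₂ f₂ h₂' =>
      (tri_elimStepP (R := R) (((hc.frame f).setReg .i s).frame f₂) (N := 3 * k) (by omega) h₂'
        (by omega) ?_).mono le_rfl fun ξ _ hξ => ⟨_, hξ, fun x y h => h₂ x y h.1, ?_, ?_⟩
    · have := (f.1 .k rfl).trans hk
      simp [this]; omega
    · intro x hx y hy
      rw [entry_frame f₂, entry_setReg]
      exact h₁ x hx y hy
    · intro j hj hj'
      rcases (by omega : j = k - 1 - s ∨ k - s ≤ j) with rfl | hj''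
      · exact ClosedAt.elimRel_self _ _
      · exact (h₃ j hj hj'').elimRel (by omega)
    · intro φ hφ h₀ i hi j hj
      have := h₄ φ hφ h₀
      exact ⟨this i hi j hj, fun _ _ => ⟨φ (k - 1 - s), hφ _ (by omega), this _ hi _ (by omega),
        this _ hj _ (by omega), this _ (by omega) _ (by omega)⟩⟩
  · rintro ν f ⟨R, h₁, h₂, h₃, h₄⟩
    exact ⟨R, h₁, h₂, fun j hj => h₃ j hj (by omega), h₄⟩

/-- Clears `t` if the literal `z + c` is not compatible with an earlier choice. -/
def checkP : Stmt Var Arr :=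
  .for_ .i (.var .j) (.ifEq (.get .tab (.add (.get .off3 (.get .ch (.var .i)))
    (.add (.var .z) (.var .c)))) (.lit 1) .skip (.set .t (.lit 0)))

theorem tri_checkP {j z c : ℕ} (hj : μ.reg .j = j) (hz : μ.reg .z = z) (hc : μ.reg .c = c) :
    Tri checkP μ (30 * j + 10) fun ν =>
      ν.reg .t = 1 ↔ μ.reg .t = 1 ∧ ∀ i < j, entry μ (μ.arr .ch i) (z + c) := by
  refine Tri.for (fun j ν => ν.reg .t = 1 ↔ μ.reg .t = 1 ∧ ∀ i < j, entry μ (μ.arr .ch i) (z + c))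
    20 hj ?_ (by simp) (fun j ν hj f h => Tri.leaf ?_) fun ν f h => h
  · simp only [Expr.cost]; omega
  · have e₁ : ν.reg .z = z := (f.1 _ rfl).trans hz
    have e₂ : ν.reg .c = c := (f.1 _ rfl).trans hc
    have e₃ : ν.arr .ch = μ.arr .ch := f.2 _ rfl
    have e₄ : entry μ (μ.arr .ch j) (z + c) ↔ ν.arr .tab (ν.arr .off3 (ν.arr .ch j) + (z + c)) = 1 := by
      rw [← entry_frame f, e₃]; rfl
    have e₅ : (∀ i < j + 1, entry μ (μ.arr .ch i) (z + c)) ↔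
        (∀ i < j, entry μ (μ.arr .ch i) (z + c)) ∧ entry μ (μ.arr .ch j) (z + c) := by
      simp only [Nat.lt_succ_iff_lt_or_eq]
      exact ⟨fun h => ⟨fun i hi => h i (.inl hi), h j (.inr rfl)⟩, fun h i hi => by
        rcases hi with hi | rfl
        · exact h.1 i hi
        · exact h.2⟩
    rw [e₅, ← and_assoc, ← h, e₄]
    simp [e₁, e₂]
    split_ifs with hh <;> simp [hh]

/-- Looks for a literal of the block that is compatible with the earlier choices. -/
def selectP : Stmt Var Arr :=
  .for_ .c (.lit 3) ((.set .t (.lit 1) ;; .ifEq (.get .tab (.add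
      (.get .off3 (.add (.var .z) (.var .c))) (.add (.var .z) (.var .c)))) (.lit 1)
      .skip (.set .t (.lit 0))) ;; checkP ;;
    .ifEq (.var .t) (.lit 1)
      (.set .sel (.lit 1) ;; .put .ch (.var .j) (.add (.var .z) (.var .c))) .skip)

theorem tri_selectP {j : ℕ} (hj : μ.reg .j = j) (hz : μ.reg .z = 3 * j) (hs : μ.reg .sel = 0) :
    Tri selectP μ (100 * j + 150) fun ν => (∀ i < j, ν.arr .ch i = μ.arr .ch i) ∧
      ((ν.reg .sel = 1 ∧ ∃ c < 3, ν.arr .ch j = 3 * j + c ∧ entry μ (3 * j + c) (3 * j + c) ∧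
        ∀ i < j, entry μ (μ.arr .ch i) (3 * j + c)) ∨
      (ν.reg .sel = 0 ∧ ∀ c < 3, ¬ (entry μ (3 * j + c) (3 * j + c) ∧
        ∀ i < j, entry μ (μ.arr .ch i) (3 * j + c)))) := by
  refine Tri.for (N := 3) (fun s ν => (∀ i < j, ν.arr .ch i = μ.arr .ch i) ∧
      ((ν.reg .sel = 1 ∧ ∃ c < 3, ν.arr .ch j = 3 * j + c ∧ entry μ (3 * j + c) (3 * j + c) ∧
        ∀ i < j, entry μ (μ.arr .ch i) (3 * j + c)) ∨
      (ν.reg .sel = 0 ∧ ∀ c < s, ¬ (entry μ (3 * j + c) (3 * j + c) ∧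
        ∀ i < j, entry μ (μ.arr .ch i) (3 * j + c)))))
    (18 + ((30 * j + 10) + 12)) rfl ?_ ⟨by simp, .inr ⟨hs, by simp⟩⟩ ?_ fun ν f h => h
  · simp only [Expr.cost]; omega
  · rintro s ν hs₃ f ⟨hch, h⟩
    have e₁ : ν.reg .z = 3 * j := (f.1 _ rfl).trans hz
    have e₂ : ν.reg .j = j := (f.1 _ rfl).trans hj
    refine Tri.seq' (Q' := fun ξ => ξ.reg .t = 1 ↔ entry μ (3 * j + s) (3 * j + s)) (Tri.leaf ?_)
      fun ν₂ f₂ h₂ => Tri.seq' (tri_checkP (j := j) (z := 3 * j) (c := s)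
        ((f₂.1 _ rfl).trans (by simpa using e₂)) ((f₂.1 _ rfl).trans (by simpa using e₁))
        ((f₂.1 _ rfl).trans (by simp))) fun ν₃ f₃ h₃ => Tri.leaf ?_
    · rw [← entry_frame f]
      unfold entry
      simp [e₁]
    · have e₃ : ν₃.arr .ch = ν.arr .ch := (f₃.2 _ rfl).trans <| (f₂.2 _ rfl).trans (by simp)
      have e₄ : entry ν₂ = entry μ := by rw [entry_frame f₂, entry_setReg, entry_frame f]
      have e₅ : ν₂.arr .ch = ν.arr .ch := (f₂.2 _ rfl).trans (by simp)
      have e₆ : ν₃.reg .z = 3 * j := (f₃.1 _ rfl).trans <| (f₂.1 _ rfl).trans (by simpa using e₁)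
      have e₇ : ν₃.reg .j = j := (f₃.1 _ rfl).trans <| (f₂.1 _ rfl).trans (by simpa using e₂)
      have e₈ : ν₃.reg .c = s := (f₃.1 _ rfl).trans <| (f₂.1 _ rfl).trans (by simp)
      have e₉ : ν₃.reg .sel = ν.reg .sel :=
        (f₃.1 _ rfl).trans <| (f₂.1 _ rfl).trans (by simp)
      rw [h₂, e₄, e₅] at h₃
      have hall : (∀ i < j, entry μ (ν.arr .ch i) (3 * j + s)) ↔
          ∀ i < j, entry μ (μ.arr .ch i) (3 * j + s) :=
        forall₂_congr fun i hi => by rw [hch i hi]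
      rw [hall] at h₃
      by_cases ht : ν₃.reg .t = 1
      · refine ⟨fun i hi => ?_, .inl ⟨by simp [ht], s, hs₃, by simp [ht, e₆, e₇, e₈], h₃.1 ht⟩⟩
        simp [ht, e₆, e₇, e₈, hi.ne, e₃, hch i hi]
      · refine ⟨fun i hi => by simp [ht, e₃, hch i hi], ?_⟩
        simp only [Stmt.run_ifEq, Mem.ifEq_reg, Mem.ifEq_arr, Expr.eval_var, Expr.eval_lit, ht,
          if_false, Stmt.run_skip, e₉, e₃]
        refine h.imp id fun h => ⟨h.1, fun c hc => ?_⟩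
        rcases Nat.lt_succ_iff_lt_or_eq.1 hc with hc | rfl
        · exact h.2 c hc
        · exact fun h => ht (h₃.2 h)

/-- Chooses literals greedily, block by block. -/
def greedyP : Stmt Var Arr :=
  .set .fine (.lit 1) ;; .for_ .j (.var .k)
    ((.set .z (.add (.var .j) (.add (.var .j) (.var .j))) ;; .set .sel (.lit 0)) ;; selectP ;;
      .ifEq (.var .sel) (.lit 1) .skip (.set .fine (.lit 0)))

theorem Good.congr {R : ℕ → ℕ → Prop} {ch ch' : ℕ → ℕ} {j : ℕ} (h : Good R ch j)
    (hch : ∀ i < j, ch' i = ch i) : Good R ch' j := by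
  intro i hi
  have := h i hi
  rw [hch i hi]
  exact ⟨this.1, this.2.1, fun i' hi' => by rw [hch i' (by omega)]; exact this.2.2 i' hi'⟩

/-- The loop continues after a failure, but `fine` is never set back to `1`, and the choices made up
to the first failure remain a witness of it. -/
theorem tri_greedyP {k : ℕ} (hk : μ.reg .k = k) :
    Tri greedyP μ (200 * (k + 1) ^ 2) fun ν =>
      (ν.reg .fine = 1 ∧ Good (entry μ) (ν.arr .ch) k) ∨
      (ν.reg .fine = 0 ∧ ∃ ch, ∃ j < k, Stuck (entry μ) ch j) := by
  refine Tri.seq_le (T := 2) (T' := 190 * (k + 1) ^ 2) (Q' := fun ν => ν.reg .fine = 1)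
    (Tri.leaf (by simp)) (fun ν₁ f₁ h₁ =>
    Tri.for (fun j ν => (ν.reg .fine = 1 ∧ Good (entry μ) (ν.arr .ch) j) ∨
      (ν.reg .fine = 0 ∧ ∃ ch, ∃ j < k, Stuck (entry μ) ch j))
      (9 + ((100 * k + 150) + 6)) ((f₁.1 _ rfl).trans hk) ?_
      (.inl ⟨h₁, fun i hi => by omega⟩) ?_ fun ν f h => h) ?_
  · simp only [Expr.cost]; nlinarith
  · intro j ν hj f h
    refine Tri.seq' (Q' := fun ξ => ξ.reg .z = 3 * j ∧ ξ.reg .sel = 0 ∧ ξ.reg .j = j) (Tri.leaf ?_)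
      fun ν₂ f₂ h₂ => Tri.seq' ((tri_selectP h₂.2.2 h₂.1 h₂.2.1).mono (T' := 100 * k + 150)
        (by omega) fun _ _ h => h) fun ν₃ f₃ h₃ => Tri.leaf ?_
    · simp; omega
    · have e₁ : entry ν₂ = entry μ := by rw [entry_frame f₂, entry_setReg, entry_frame f,
        entry_frame f₁]
      have e₂ : ν₂.arr .ch = ν.arr .ch := (f₂.2 _ rfl).trans (by simp)
      have e₃ : ν₃.reg .fine = ν.reg .fine := (f₃.1 _ rfl).trans <| (f₂.1 _ rfl).trans (by simp)
      rw [e₁, e₂] at h₃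
      obtain ⟨hch, hs⟩ := h₃
      simp only [Stmt.run_ifEq, Mem.ifEq_reg, Expr.eval_var, Expr.eval_lit,
        Stmt.run_skip]
      rcases h with ⟨hf, hg⟩ | ⟨hf, hg⟩
      · rcases hs with ⟨hs, c, hc, hj', h₁, h₂⟩ | ⟨hs, hs'⟩
        · have hg' : Good (entry μ) (ν₃.arr .ch) (j + 1) := by
            intro i hi
            rcases Nat.lt_succ_iff_lt_or_eq.1 hi with hi | rfl
            · exact hg.congr hch i hi
            · rw [hj']
              exact ⟨by omega, h₁, fun i' hi' => by rw [hch i' hi']; exact h₂ i' hi'⟩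
          exact .inl ⟨by simp [hs, e₃, hf], hg'.congr fun i _ => by simp [hs]⟩
        · exact .inr ⟨by simp [hs], _, j, hj, hg, hs'⟩
      · refine .inr ⟨?_, hg⟩
        simp [e₃, hf]
  · have : 1 ≤ (k + 1) ^ 2 := Nat.one_le_pow _ _ (by omega)
    omega

/-! ### Coloring with one forbidden color per vertex as a constraint problem on literals. -/

/-- `f` is a coloring of the part of `(G, L)` on the set `C`. -/
def ColorsOn (G : SimpleGraph (Fin n)) (L : Fin n → Finset (Fin 3)) (C : Set (Fin n))
    (f : Fin n → Fin 3) : Prop :=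
  (∀ u ∈ C, ∀ v ∈ C, G.Adj u v → f u ≠ f v) ∧ ∀ v ∈ C, f v ∈ L v

/-- The literals `3 * j + c`, for the color `c` of the vertex `e j`, are listed in `lv` and `lc`. -/
def HoldsLits (e : ℕ → Fin n) (k : ℕ) (μ : Mem Var Arr) : Prop :=
  μ.reg .q = 3 * k ∧ ∀ x < 3 * k, μ.arr .lv x = e (x / 3) ∧ μ.arr .lc x = x % 3

theorem HoldsLits.frame {P : Stmt Var Arr} {e : ℕ → Fin n} {k : ℕ} (h : HoldsLits e k μ)
    (hf : Frame P μ ν)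
    (hP : P.setsReg .q = false ∧ P.setsArr .lv = false ∧ P.setsArr .lc = false := by decide) :
    HoldsLits e k ν := by
  unfold HoldsLits; rw [hf.1 _ hP.1, hf.2 _ hP.2.1, hf.2 _ hP.2.2]; exact h

theorem HoldsLits.setReg {e : ℕ → Fin n} {k : ℕ} (h : HoldsLits e k μ) (v : Var) (x : ℕ)
    (hv : v ≠ .q := by decide) : HoldsLits e k (μ.setReg v x) := by
  unfold HoldsLits; rw [Mem.setReg_arr, Mem.setReg_reg, if_neg hv.symm]; exact h

/-- Appends the literal of color `c` to the list of literals. -/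
def appendP (c : ℕ) : Stmt Var Arr :=
  .put .lv (.var .q) (.get .vs (.var .j)) ;; .put .lc (.var .q) (.lit c) ;;
    .set .q (.add (.var .q) (.lit 1))

/-- Lists the literals. -/
def litP : Stmt Var Arr :=
  .set .q (.lit 0) ;; .for_ .j (.var .k) (appendP 0 ;; appendP 1 ;; appendP 2)

theorem tri_litP {e : ℕ → Fin n} {k : ℕ} (hk : HoldsEnum e k μ) :
    Tri litP μ (50 * k + 10) (HoldsLits e k) := by
  refine Tri.seq_le (T := 2) (T' := 50 * k + 8) (Q' := fun ν => ν.reg .q = 0) (Tri.leaf (by simp))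
    (fun ν₁ f₁ h₁ => Tri.for (fun j ν => HoldsLits e j ν) 40 (hk.frame f₁).1 ?_
    ⟨h₁, by simp⟩ (fun j ν hj f h => Tri.leaf ?_) fun ν f h => h) (by omega)
  · simp only [Expr.cost]; omega
  · have hv := ((hk.frame f₁).frame f).2 j hj
    unfold HoldsLits appendP
    simp [h.1, hv]
    refine ⟨by omega, fun x hx => ?_⟩
    rcases (by omega : x < 3 * j ∨ x = 3 * j ∨ x = 3 * j + 1 ∨ x = 3 * j + 1 + 1) with
      hx | rfl | rfl | rfl
    · have := h.2 x hx
      simp [this, show x ≠ 3 * j by omega, show x ≠ 3 * j + 1 by omega,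
        show x ≠ 3 * j + 1 + 1 by omega]
    · simp [show 3 * j ≠ 3 * j + 1 + 1 by omega]
    · simp [show (3 * j + 1) / 3 = j by omega]
    · simp [show (3 * j + 1 + 1) / 3 = j by omega]; omega

/-- The literals `x` and `y` are compatible, if the color `fb v` is forbidden for each `v`. -/
def litRel (G : SimpleGraph (Fin n)) (L : Fin n → Finset (Fin 3)) (e : ℕ → Fin n) (fb : Fin n → ℕ)
    (x y : ℕ) : Prop :=
  (Fin.ofNat 3 x ∈ L (e (x / 3)) ∧ Fin.ofNat 3 y ∈ L (e (y / 3))) ∧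
    (fb (e (x / 3)) ≠ x % 3 ∧ fb (e (y / 3)) ≠ y % 3) ∧
    (e (x / 3) = e (y / 3) → x % 3 = y % 3) ∧ (G.Adj (e (x / 3)) (e (y / 3)) → x % 3 ≠ y % 3)

/-- Clears `t` if the color of the variable `b` is not allowed at the vertex of the variable `v`. -/
def allowP (v b : Var) : Stmt Var Arr :=
  .ifEq (.get .lst (.add (.var v) (.add (.var v) (.add (.var v) (.var b))))) (.lit 1)
    (.ifEq (.get .g (.get .domi (.var v))) (.var b) (.set .t (.lit 0)) .skip) (.set .t (.lit 0))

/-- Computes the table entry of the literals `x` and `y`. -/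
def cellP : Stmt Var Arr :=
  .set .u (.get .lv (.var .x)) ;; .set .a (.get .lc (.var .x)) ;;
  .set .w (.get .lv (.var .y)) ;; .set .b (.get .lc (.var .y)) ;; .set .t (.lit 1) ;;
  allowP .u .a ;; allowP .w .b ;;
  .ifEq (.var .u) (.var .w) (.ifEq (.var .a) (.var .b) .skip (.set .t (.lit 0)))
    (.ifEq (.var .a) (.var .b) (.ifEq (.get .adj (.add (.get .off (.var .u)) (.var .w))) (.lit 1)
      (.set .t (.lit 0)) .skip) .skip) ;;
  .put .tab (.add (.get .off3 (.var .x)) (.var .y)) (.var .t)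

/-- The color that is forbidden by the guess `g`. -/
def forbidden (n : ℕ) (μ : Mem Var Arr) (v : Fin n) : ℕ := μ.arr .g (μ.arr .domi v)

theorem run_cellP (hc : Ctx G L μ) {e : ℕ → Fin n} {k x y : ℕ} (hk : k ≤ n) (hl : HoldsLits e k μ)
    (hx : μ.reg .x = x) (hy : μ.reg .y = y) (hxN : x < 3 * k) (hyN : y < 3 * k) :
    ∀ x' < 3 * k, ∀ y' < 3 * k, entry (cellP.run μ) x' y' ↔
      if x' = x ∧ y' = y then litRel G L e (forbidden n μ) x y else entry μ x' y' := by
  intro x' hx' y' hy'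
  have hi := hc.index_eq_iff (x := x) (y := y) (x' := x') (y' := y') (by omega) (by omega)
    (by omega) (by omega)
  have e₁ := hl.2 x hxN
  have e₂ := hl.2 y hyN
  have e₃ := hc.lst (e (x / 3)) (Fin.ofNat 3 x)
  have e₄ := hc.lst (e (y / 3)) (Fin.ofNat 3 y)
  have e₅ := hc.adj (e (x / 3)) (e (y / 3))
  have e₆ := hc.off (e (x / 3)) (e (x / 3)).2
  have e₇ : ∀ v c : ℕ, v + (v + (v + c)) = 3 * v + c := fun v c => by ring
  have e₈ : (e (x / 3) : ℕ) = e (y / 3) → ¬ G.Adj (e (x / 3)) (e (y / 3)) := fun h h' =>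
    h'.ne (Fin.ext h)
  simp only [Fin.val_ofNat] at e₃ e₄
  unfold entry cellP allowP litRel forbidden
  simp [hx, hy, hi, e₁, e₂, e₅, e₆, e₇, e₃, e₄, Fin.ext_iff]
  split_ifs <;> grind

/-- Computes the table of the compatible pairs of literals. -/
def buildP : Stmt Var Arr := .for_ .x (.var .q) (.for_ .y (.var .q) cellP)

theorem tri_buildP (hc : Ctx G L μ) {e : ℕ → Fin n} {k : ℕ} (hk : k ≤ n) (hl : HoldsLits e k μ) :
    Tri buildP μ (100 * (3 * k + 1) ^ 2) (Tab (3 * k) (litRel G L e (forbidden n μ))) := by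
  refine Tri.for (fun i ν => ∀ x < 3 * k, ∀ y < 3 * k, x < i →
    (entry ν x y ↔ litRel G L e (forbidden n μ) x y)) (100 * (3 * k) + 3) hl.1 ?_
    (fun x _ y _ h => by omega) (fun i ν hi f h => ?_) fun ν f h x hx y hy => h x hx y hy hx
  · simp only [Expr.cost]; nlinarith
  · refine Tri.for (fun j ν => ∀ x < 3 * k, ∀ y < 3 * k, x < i ∨ x = i ∧ y < j →
      (entry ν x y ↔ litRel G L e (forbidden n μ) x y)) 96
      (((hl.frame f).setReg .x i).1) ?_ ?_ (fun j ξ hj f₂ h₂ => Tri.leaf ?_) ?_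
    · simp only [Expr.cost]; omega
    · intro x hx y hy hxy
      rw [entry_setReg]
      exact h x hx y hy (by omega)
    · intro x hx y hy hxy
      have e₁ : ξ.reg .x = i := (f₂.1 _ rfl).trans (by simp)
      have e₂ : forbidden n (ξ.setReg .y j) = forbidden n μ := by
        unfold forbidden
        simp only [Mem.setReg_arr]
        rw [f₂.2 .g rfl, f₂.2 .domi rfl]
        simp only [Mem.setReg_arr]
        rw [f.2 .g rfl, f.2 .domi rfl]
      rw [run_cellP ((((hc.frame f).setReg .x i).frame f₂).setReg .y j) hk
        ((((hl.frame f).setReg .x i).frame f₂).setReg .y j) (x := i) (y := j) (by simpa using e₁)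
        (by simp) hi hj x hx y hy, e₂, entry_setReg]
      split_ifs with hh
      · rw [hh.1, hh.2]
      · exact h₂ x hx y hy (by omega)
    · intro ξ f₂ h₂ x hx y hy hxy
      exact h₂ x hx y hy (by omega)

/-- Looks for a coloring that avoids the guess. -/
def solveP : Stmt Var Arr := buildP ;; elimP ;; greedyP

theorem litRel_of_colorsOn {C : Set (Fin n)} {e : ℕ → Fin n} {k : ℕ} {fb : Fin n → ℕ}
    {f : Fin n → Fin 3} (he : Enum C e k) (hf : ColorsOn G L C f) (hfb : ∀ v ∈ C, (f v : ℕ) ≠ fb v)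
    {i j : ℕ} (hi : i < k) (hj : j < k) : litRel G L e fb (3 * i + f (e i)) (3 * j + f (e j)) := by
  have hmem : ∀ i < k, e i ∈ C := fun i hi => (he.mem _).2 ⟨i, hi, rfl⟩
  have h₁ : ∀ i, (3 * i + (f (e i) : ℕ)) / 3 = i := fun i => by omega
  have h₂ : ∀ i, (3 * i + (f (e i) : ℕ)) % 3 = f (e i) := fun i => by omega
  have h₃ : ∀ i, Fin.ofNat 3 (3 * i + (f (e i) : ℕ)) = f (e i) := fun i => Fin.ext (h₂ i)
  unfold litRel
  rw [h₁, h₁, h₂, h₂, h₃, h₃]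
  exact ⟨⟨hf.2 _ (hmem i hi), hf.2 _ (hmem j hj)⟩,
    ⟨(hfb _ (hmem i hi)).symm, (hfb _ (hmem j hj)).symm⟩, fun h => by rw [h],
    fun h h' => hf.1 _ (hmem i hi) _ (hmem j hj) h (Fin.ext h')⟩

theorem exists_colorsOn_of_good {C : Set (Fin n)} {e : ℕ → Fin n} {k : ℕ} {fb : Fin n → ℕ}
    (he : Enum C e k) {ch : ℕ → ℕ} (h : Good (litRel G L e fb) ch k) :
    ∃ f, ColorsOn G L C f ∧ ∀ j < k, (f (e j) : ℕ) = ch j % 3 := by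
  classical
  have hf : ∀ v, ∃ c : Fin 3, ∀ j < k, e j = v → c = Fin.ofNat 3 (ch j) := by
    intro v
    by_cases hv : ∃ j < k, e j = v
    · obtain ⟨j, hj, hjv⟩ := hv
      exact ⟨_, fun i hi hiv => by rw [he.inj i hi j hj (hiv.trans hjv.symm)]⟩
    · exact ⟨0, fun j hj hjv => absurd ⟨j, hj, hjv⟩ hv⟩
  choose f hf using hf
  have hdiv : ∀ j < k, ch j / 3 = j := fun j hj => by have := (h j hj).1; omega
  have hadj : ∀ i < k, ∀ j < k, i < j → G.Adj (e i) (e j) → f (e i) ≠ f (e j) := by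
    intro i hi j hj hij ha
    have := ((h j hj).2.2 i hij).2.2.2
    rw [hdiv i hi, hdiv j hj] at this
    rw [hf _ i hi rfl, hf _ j hj rfl]
    exact fun h => this ha (by simpa [Fin.ext_iff] using h)
  refine ⟨f, ⟨fun u hu v hv ha => ?_, fun v hv => ?_⟩, fun j hj => ?_⟩
  · obtain ⟨i, hi, rfl⟩ := (he.mem u).1 hu
    obtain ⟨j, hj, rfl⟩ := (he.mem v).1 hv
    rcases lt_trichotomy i j with h | rfl | h
    · exact hadj i hi j hj h ha
    · exact absurd ha G.irrefl
    · exact (hadj j hj i hi h ha.symm).symm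
  · obtain ⟨j, hj, rfl⟩ := (he.mem v).1 hv
    rw [hf _ j hj rfl]
    have := (h j hj).2.1.1.1
    rwa [hdiv j hj] at this
  · rw [hf _ j hj rfl]; rfl

/-- A success is a genuine coloring, whatever the guess was. If some coloring avoids the guess, its
literals survive the elimination, so every block keeps an admissible literal, while the forbidden
one is not admissible; then `not_stuck` rules out failure. -/
theorem tri_solveP (hc : Ctx G L μ) {C : Set (Fin n)} {e : ℕ → Fin n} {k : ℕ} (he : Enum C e k)
    (hk : μ.reg .k = k) (hl : HoldsLits e k μ) (hfb : ∀ v ∈ C, forbidden n μ v < 3) :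
    Tri solveP μ (500 * (3 * k + 1) ^ 3) fun ν =>
      (ν.reg .fine = 1 ∧ ∃ f, ColorsOn G L C f ∧ ∀ j < k, μ.arr .lc (ν.arr .ch j) = f (e j)) ∨
      (ν.reg .fine = 0 ∧
        ∀ f, ColorsOn G L C f → ∃ v ∈ C, (f v : ℕ) = forbidden n μ v) := by
  have hkn := he.le
  refine Tri.seq_le (tri_buildP hc hkn hl) (fun ν₁ f₁ h₁ => Tri.seq'
    (tri_elimP (hc.frame f₁) ((f₁.1 _ rfl).trans hk) hkn h₁) fun ν₂ f₂ h₂ =>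
    (tri_greedyP ((f₂.1 _ rfl).trans <| (f₁.1 _ rfl).trans hk)).mono le_rfl fun ν₃ f₃ h₃ => ?_) ?_
  · obtain ⟨R, hR, hR₀, hcl, hpres⟩ := h₂
    refine h₃.imp (fun ⟨hfine, hg⟩ => ⟨hfine, ?_⟩) fun ⟨hfine, ch, j, hj, hst⟩ => ⟨hfine, ?_⟩
    · have hg' : Good (litRel G L e (forbidden n μ)) (ν₃.arr .ch) k := by
        intro j hj
        have hb : ∀ i < k, ν₃.arr .ch i < 3 * k := fun i hi => by have := (hg i hi).1; omega
        obtain ⟨h₁, h₂, h₃⟩ := hg j hj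
        exact ⟨h₁, hR₀ _ _ ((hR _ (hb j hj) _ (hb j hj)).1 h₂), fun i hi =>
          hR₀ _ _ ((hR _ (hb i (hi.trans hj)) _ (hb j hj)).1 (h₃ i hi))⟩
      obtain ⟨f, hf, hf'⟩ := exists_colorsOn_of_good he hg'
      refine ⟨f, hf, fun j hj => ?_⟩
      rw [hf' j hj]
      exact (hl.2 _ (by have := (hg j hj).1; omega)).2
    · intro f hf
      by_contra! hno
      have hφ := hpres (fun j => f (e j)) (fun j _ => (f (e j)).2)
        fun i hi j hj => litRel_of_colorsOn he hf hno hi hj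
      have hlt := (f (e j)).2
      have hbl := hfb (e j) ((he.mem _).2 ⟨j, hj, rfl⟩)
      refine not_stuck (R := entry ν₂) (c₀ := f (e j)) (b := forbidden n μ (e j)) ?_ hlt
        ((hR _ (by omega) _ (by omega)).2 (hφ j hj j hj)) hbl (fun h => ?_) hst
      · intro x hx y hy hxy
        rw [hR x (by omega) y (by omega)] at hxy
        obtain ⟨c, hc, h₁, h₂, h₃⟩ := hcl j hj x hx y hy hxy
        exact ⟨c, hc, (hR _ (by omega) _ (by omega)).2 h₁, (hR _ (by omega) _ (by omega)).2 h₂,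
          (hR _ (by omega) _ (by omega)).2 h₃⟩
      · rw [hR _ (by omega) _ (by omega)] at h
        have := (hR₀ _ _ h).2.1.1
        rw [show (3 * j + forbidden n μ (e j)) / 3 = j by omega] at this
        omega
  · nlinarith [Nat.zero_le (k ^ 2), Nat.zero_le (k ^ 3)]

/-! ### The loop over all guesses -/

/-- Every guess is the ternary expansion of some number below `3 ^ d`, so counting exhausts the
guesses. -/
theorem exists_digits {g : ℕ → ℕ} (hg : ∀ i, g i < 3) (d : ℕ) :
    ∃ m < 3 ^ d, ∀ i < d, m / 3 ^ i % 3 = g i := by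
  induction d with
  | zero => exact ⟨0, by simp⟩
  | succ d ih =>
    obtain ⟨m, hm, h⟩ := ih
    refine ⟨g d * 3 ^ d + m, ?_, fun i hi => ?_⟩
    · have := hg d
      rw [pow_succ]; nlinarith
    · rcases Nat.lt_succ_iff_lt_or_eq.1 hi with hi | rfl
      · rw [← h i hi]
        obtain ⟨b, rfl⟩ : ∃ b, d = i + b + 1 := ⟨d - i - 1, by omega⟩
        rw [show g (i + b + 1) * 3 ^ (i + b + 1) + m = 3 ^ i * (3 * (g (i + b + 1) * 3 ^ b)) + m by
          ring, Nat.mul_add_div (by positivity), Nat.mul_add_mod]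
      · rw [mul_comm, Nat.mul_add_div (by positivity), Nat.div_eq_of_lt hm, add_zero,
          Nat.mod_eq_of_lt (hg i)]

/-- The array `g` holds the first `d` ternary digits of `m`. -/
def HoldsDigits (d m : ℕ) (μ : Mem Var Arr) : Prop := ∀ i < d, μ.arr .g i = m / 3 ^ i % 3

/-- Starts with the guess whose digits are all `0`, and computes the number of guesses. -/
def firstP : Stmt Var Arr :=
  (.set .pw (.lit 1) ;; .set .found (.lit 0)) ;; .for_ .x (.var .d) (.put .g (.var .x) (.lit 0) ;;
    .set .pw (.add (.var .pw) (.add (.var .pw) (.var .pw))))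

theorem tri_firstP {d : ℕ} (hd : μ.reg .d = d) :
    Tri firstP μ (20 * d + 10) fun ν => ν.reg .pw = 3 ^ d ∧ ν.reg .found = 0 ∧ HoldsDigits d 0 ν := by
  refine Tri.seq_le (T := 4) (T' := 20 * d + 6) (Q' := fun ν => ν.reg .pw = 1 ∧ ν.reg .found = 0)
    (Tri.leaf (by simp)) (fun ν₁ f₁ h₁ => Tri.for
      (fun j ν => ν.reg .pw = 3 ^ j ∧ ν.reg .found = 0 ∧ HoldsDigits j 0 ν) 10
      ((f₁.1 _ rfl).trans hd) ?_ ⟨h₁.1, h₁.2, fun i hi => by omega⟩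
      (fun j ν hj f h => Tri.leaf ?_) fun ν f h => h) (by omega)
  · simp only [Expr.cost]; omega
  · obtain ⟨h₁, h₂, h₃⟩ := h
    refine ⟨by simp [h₁]; ring, by simpa using h₂, fun i hi => ?_⟩
    have := h₃ i
    simp only [Nat.zero_div, Nat.zero_mod] at this ⊢
    simp
    intro hij
    exact this (by omega)

/-- Moves on to the next guess. -/
def nextP : Stmt Var Arr :=
  .set .cy (.lit 1) ;; .for_ .x (.var .d) (.set .t (.add (.get .g (.var .x)) (.var .cy)) ;;
    .ifEq (.var .t) (.lit 3) (.put .g (.var .x) (.lit 0) ;; .set .cy (.lit 1))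
      (.put .g (.var .x) (.var .t) ;; .set .cy (.lit 0)))

/-- Addition of `1` with carry: `cy` is the difference between the quotients of `m + 1` and `m` by
`3 ^ j`. -/
theorem tri_nextP {d m : ℕ} (hd : μ.reg .d = d) (hm : HoldsDigits d m μ) :
    Tri nextP μ (30 * d + 10) (HoldsDigits d (m + 1)) := by
  refine Tri.seq_le (T := 2) (T' := 30 * d + 6) (Q' := fun ν => ν.reg .cy = 1)
    (Tri.leaf (by simp)) (fun ν₁ f₁ h₁ => Tri.for
      (fun j ν => HoldsDigits j (m + 1) ν ∧ (∀ i < d, j ≤ i → ν.arr .g i = m / 3 ^ i % 3) ∧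
        ν.reg .cy ≤ 1 ∧ (m + 1) / 3 ^ j = m / 3 ^ j + ν.reg .cy) 20
      ((f₁.1 _ rfl).trans hd) ?_ ⟨fun i hi => by omega, fun i hi _ => ?_, by omega, by simp [h₁]⟩
      (fun j ν hj f h => Tri.leaf ?_) fun ν f h => h.1) (by omega)
  · simp only [Expr.cost]; omega
  · rw [f₁.2 .g rfl]; exact hm i hi
  · obtain ⟨h₁, h₂, h₃, h₄⟩ := h
    have e₁ := h₂ j hj le_rfl
    have e₂ : m / 3 ^ (j + 1) = m / 3 ^ j / 3 := by rw [pow_succ, Nat.div_div_eq_div_mul]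
    have e₃ : (m + 1) / 3 ^ (j + 1) = (m + 1) / 3 ^ j / 3 := by
      rw [pow_succ, Nat.div_div_eq_div_mul]
    by_cases ht : m / 3 ^ j % 3 + ν.reg .cy = 3
    · refine ⟨fun i hi => ?_, fun i hi hji => ?_, by simp [e₁, ht], by simp [e₁, ht]; omega⟩
      · rcases Nat.lt_succ_iff_lt_or_eq.1 hi with hi | rfl
        · simpa [e₁, ht, hi.ne] using h₁ i hi
        · simp [e₁, ht]; omega
      · simpa [e₁, ht, show i ≠ j by omega] using h₂ i hi (by omega)
    · refine ⟨fun i hi => ?_, fun i hi hji => ?_, by simp [e₁, ht], by simp [e₁, ht]; omega⟩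
      · rcases Nat.lt_succ_iff_lt_or_eq.1 hi with hi | rfl
        · simpa [e₁, ht, hi.ne] using h₁ i hi
        · simp [e₁, ht]; omega
      · simpa [e₁, ht, show i ≠ j by omega] using h₂ i hi (by omega)

/-- Stores the coloring that has been found in `out`. -/
def emitP : Stmt Var Arr :=
  .set .found (.lit 1) ;; .for_ .x (.var .k)
    (.put .out (.get .vs (.var .x)) (.get .lc (.get .ch (.var .x))))

theorem tri_emitP {C : Set (Fin n)} {e : ℕ → Fin n} {k : ℕ} {f : Fin n → Fin 3}
    (he : Enum C e k) (hk : HoldsEnum e k μ) (hf : ∀ j < k, μ.arr .lc (μ.arr .ch j) = f (e j)) :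
    Tri emitP μ (20 * k + 10) fun ν => ν.reg .found = 1 ∧ (∀ v ∈ C, ν.arr .out v = f v) ∧
      ∀ v ∉ C, ν.arr .out v = μ.arr .out v := by
  refine Tri.seq_le (T := 2) (T' := 20 * k + 6) (Q' := fun ν => ν.reg .found = 1)
    (Tri.leaf (by simp)) (fun ν₁ f₁ h₁ => Tri.for
      (fun j ν => ν.reg .found = 1 ∧ (∀ i < j, ν.arr .out (e i) = f (e i)) ∧
        ∀ v ∉ C, ν.arr .out v = μ.arr .out v) 12
      (hk.frame f₁).1 ?_ ⟨h₁, by simp, fun v _ => by rw [f₁.2 .out rfl]⟩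
      (fun j ν hj f' h => Tri.leaf ?_) fun ν f' h => ⟨h.1, fun v hv => ?_, h.2.2⟩) (by omega)
  · simp only [Expr.cost]; omega
  · obtain ⟨h₁, h₂, h₃⟩ := h
    have e₁ := ((hk.frame f₁).frame f').2 j hj
    have e₂ := hf j hj
    rw [← f₁.2 .lc rfl, ← f₁.2 .ch rfl, ← f'.2 .lc rfl, ← f'.2 .ch rfl] at e₂
    refine ⟨by simpa using h₁, fun i hi => ?_, fun v hv => ?_⟩
    · simp [e₁, e₂]
      split_ifs with hij
      · rw [Fin.ext hij]
      · rcases Nat.lt_succ_iff_lt_or_eq.1 hi with hi | rfl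
        · exact h₂ i hi
        · exact absurd rfl hij
    · have : (v : ℕ) ≠ e j := fun h => hv ((he.mem v).2 ⟨j, hj, (Fin.ext h).symm⟩)
      simpa [e₁, this] using h₃ v hv
  · obtain ⟨j, hj, rfl⟩ := (he.mem v).1 hv
    exact h.2.1 j hj

/-- Tries one guess. -/
def tryP : Stmt Var Arr := solveP ;; .ifEq (.var .fine) (.lit 1) emitP .skip ;; nextP

theorem tri_tryP (hc : Ctx G L μ) {C : Set (Fin n)} {e : ℕ → Fin n} {k d m : ℕ} (he : Enum C e k)
    (hk : HoldsEnum e k μ) (hl : HoldsLits e k μ) (hd : μ.reg .d = d) (hdk : d ≤ k + 1)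
    (hm : HoldsDigits d m μ) (hdomi : ∀ v ∈ C, μ.arr .domi v < d) :
    Tri tryP μ (600 * (3 * k + 1) ^ 3) fun ν => HoldsDigits d (m + 1) ν ∧
      (∀ v ∉ C, ν.arr .out v = μ.arr .out v) ∧
      ((ν.reg .found = 1 ∧ ∃ f, ColorsOn G L C f ∧ ∀ v ∈ C, ν.arr .out v = f v) ∨
      (ν.reg .found = μ.reg .found ∧ ν.arr .out = μ.arr .out ∧
        ∀ f, ColorsOn G L C f → ∃ v ∈ C, (f v : ℕ) = m / 3 ^ μ.arr .domi v % 3)) := by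
  have hfb : ∀ v ∈ C, forbidden n μ v = m / 3 ^ μ.arr .domi v % 3 := fun v hv => hm _ (hdomi v hv)
  refine Tri.seq_le (tri_solveP hc he hk.1 hl fun v hv => by rw [hfb v hv]; omega)
    (fun ν₁ f₁ h₁ => Tri.seq' (Tri.ifEq (T := 20 * k + 10) (Q := fun ν =>
      (∀ v ∉ C, ν.arr .out v = μ.arr .out v) ∧
      ((ν.reg .found = 1 ∧ ∃ f, ColorsOn G L C f ∧ ∀ v ∈ C, ν.arr .out v = f v) ∨
      (ν.reg .found = μ.reg .found ∧ ν.arr .out = μ.arr .out ∧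
        ∀ f, ColorsOn G L C f → ∃ v ∈ C, (f v : ℕ) = m / 3 ^ μ.arr .domi v % 3)))
      (fun hfine => ?_) fun hfine => ?_)
    fun ν₂ f₂ h₂ => (tri_nextP (d := d) (m := m) ?_ ?_).mono le_rfl fun ν₃ f₃ h₃ => ?_) ?_
  · rcases h₁ with ⟨-, f, hf, hf'⟩ | ⟨hfine', -⟩
    · rw [← f₁.2 .lc rfl] at hf'
      refine (tri_emitP he (hk.frame f₁) hf').mono le_rfl fun ν f₂ h => ⟨?_, .inl ⟨h.1, f, hf, h.2.1⟩⟩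
      rw [← f₁.2 .out rfl]
      exact h.2.2
    · simp [hfine'] at hfine
  · rcases h₁ with ⟨hfine', -⟩ | ⟨-, h⟩
    · simp [hfine'] at hfine
    · refine Tri.leaf ?_ rfl (by simp [Stmt.bound])
      rw [Stmt.run_skip, f₁.2 .out rfl, f₁.1 .found rfl]
      refine ⟨fun _ _ => rfl, .inr ⟨rfl, rfl, fun f hf => ?_⟩⟩
      obtain ⟨v, hv, h⟩ := h f hf
      exact ⟨v, hv, h.trans (hfb v hv)⟩
  · exact (f₂.1 _ rfl).trans <| (f₁.1 _ rfl).trans hd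
  · unfold HoldsDigits; rw [f₂.2 .g rfl, f₁.2 .g rfl]; exact hm
  · rw [f₃.2 .out rfl, f₃.1 .found rfl]
    exact ⟨h₃, h₂⟩
  · simp only [Expr.cost]; nlinarith [Nat.zero_le (k ^ 2), Nat.zero_le (k ^ 3)]

/-- Tries all guesses. -/
def guessP : Stmt Var Arr :=
  firstP ;; .for_ .m (.var .pw) tryP ;; .ifEq (.var .found) (.lit 1) .skip (.set .ok (.lit 0))

theorem _root_.IsListColoring.colorsOn {f : Fin n → Fin 3} (h : IsListColoring G L f) (C : Set (Fin n)) :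
    ColorsOn G L C f :=
  ⟨fun _ _ _ _ ha => h.1 _ _ ha, fun _ _ => h.2 _⟩

/-- A coloring of `(G, L)` determines, by `Guides`, a guess that it avoids on `C`. If every guess
fails, so does this one, which is a contradiction. -/
theorem tri_guessP (hc : Ctx G L μ) {C : Set (Fin n)} {e : ℕ → Fin n} {k d : ℕ} (he : Enum C e k)
    (hk : HoldsEnum e k μ) (hl : HoldsLits e k μ) (hd : μ.reg .d = d) (hdk : d ≤ k + 1)
    (hg : Guides G C d μ) :
    Tri guessP μ (700 * (3 ^ d * (3 * k + 1) ^ 3)) fun ν =>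
      (∀ v ∉ C, ν.arr .out v = μ.arr .out v) ∧
      ((ν.reg .ok = μ.reg .ok ∧ ∃ f, ColorsOn G L C f ∧ ∀ v ∈ C, ν.arr .out v = f v) ∨
      (ν.reg .ok = 0 ∧ ∀ f, ¬ IsListColoring G L f)) := by
  refine Tri.seq_le (tri_firstP hd) (fun ν₁ f₁ h₁ => Tri.seq'
    (T := 3 ^ d * (600 * (3 * k + 1) ^ 3 + 4) + 3) (T' := 5) (Q' := fun ν =>
      (∀ v ∉ C, ν.arr .out v = μ.arr .out v) ∧
      ((ν.reg .found = 1 ∧ ∃ f, ColorsOn G L C f ∧ ∀ v ∈ C, ν.arr .out v = f v) ∨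
      (ν.reg .found = 0 ∧ ∀ f, ¬ IsListColoring G L f)))
    (Tri.for (fun m ν => HoldsDigits d m ν ∧ (∀ v ∉ C, ν.arr .out v = μ.arr .out v) ∧
      ((ν.reg .found = 1 ∧ ∃ f, ColorsOn G L C f ∧ ∀ v ∈ C, ν.arr .out v = f v) ∨
      (ν.reg .found = 0 ∧ ∀ m' < m, ∀ f, ColorsOn G L C f →
        ∃ v ∈ C, (f v : ℕ) = m' / 3 ^ μ.arr .domi v % 3)))
      (600 * (3 * k + 1) ^ 3) h₁.1 ?_ ?_ ?_ ?_) fun ν₂ f₂ h₂ => Tri.leaf ?_) ?_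
  · simp only [Expr.cost]; omega
  · rw [f₁.2 .out rfl]
    exact ⟨h₁.2.2, fun _ _ => rfl, .inr ⟨h₁.2.1, by simp⟩⟩
  · rintro m ν hm f ⟨h₁, h₂, h₃⟩
    have e₁ : (ν.setReg .m m).arr .domi = μ.arr .domi := by
      rw [Mem.setReg_arr]; exact (f.2 .domi rfl).trans (f₁.2 .domi rfl)
    refine (tri_tryP (m := m) (((hc.frame f₁).frame f).setReg .m m) he
      (((hk.frame f₁).frame f).setReg .m m) (((hl.frame f₁).frame f).setReg .m m) ?_ hdk h₁
      (by rw [e₁]; exact hg.1)).mono le_rfl fun ξ f' h => ⟨h.1, fun v hv => (h.2.1 v hv).trans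
        (h₂ v hv), ?_⟩
    · simpa using (f.1 .d rfl).trans <| (f₁.1 .d rfl).trans hd
    · rcases h.2.2 with h' | ⟨h', ho, hf⟩
      · exact .inl h'
      · rw [h', ho]
        rw [e₁] at hf
        refine h₃.imp id fun h₃ => ⟨h₃.1, fun m' hm' => ?_⟩
        rcases Nat.lt_succ_iff_lt_or_eq.1 hm' with hm' | rfl
        · exact h₃.2 m' hm'
        · exact hf
  · rintro ν f ⟨-, h₂, h₃⟩
    refine ⟨h₂, h₃.imp id fun h => ⟨h.1, fun f hf => ?_⟩⟩
    obtain ⟨g, hg₁, hg₂⟩ := hg.2 f hf.1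
    obtain ⟨m, hm, hmg⟩ := exists_digits hg₁ d
    obtain ⟨v, hv, h'⟩ := h.2 m hm f (hf.colorsOn C)
    exact hg₂ v hv (h'.trans (hmg _ (hg.1 v hv)))
  · have e₁ : ν₂.reg .ok = μ.reg .ok := (f₂.1 _ rfl).trans (f₁.1 _ rfl)
    rcases h₂ with ⟨h, ⟨h', h''⟩ | ⟨h', h''⟩⟩
    · simp only [Stmt.run_ifEq, Expr.eval_var, Expr.eval_lit, h', Mem.ifEq_reg, Mem.ifEq_arr,
        Stmt.run_skip, if_true, e₁]
      exact ⟨h, .inl ⟨trivial, h''⟩⟩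
    · simp only [Stmt.run_ifEq, Expr.eval_var, Expr.eval_lit, h', Mem.ifEq_reg, Mem.ifEq_arr,
        Stmt.run_set, if_false, zero_ne_one]
      exact ⟨by simpa using h, .inr ⟨by simp, h''⟩⟩
  · have h₁ : 1 ≤ 3 ^ d := Nat.one_le_pow _ _ (by omega)
    have h₂ : 3 * k + 1 ≤ (3 * k + 1) ^ 3 := Nat.le_self_pow (by omega) _
    nlinarith [Nat.mul_le_mul h₁ h₂]

/-! ### The treatment of one component -/

/-- Allows all vertices. -/
def allowAllP : Stmt Var Arr := .for_ .x (.var .n) (.put .allow (.var .x) (.lit 1))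

theorem tri_allowAllP (hn : μ.reg .n = n) :
    Tri allowAllP μ (20 * n + 10) (Holds .allow (Set.univ : Set (Fin n))) := by
  refine Tri.for (fun j ν => ∀ v < j, ν.arr .allow v = 1) 10 hn ?_ (by simp)
    (fun j ν hj f h => Tri.leaf ?_) fun ν f h v => by simp [h v v.2]
  · simp only [Expr.cost]; omega
  · intro v hv
    simp
    intro hvj
    exact h v (by omega)

/-- Marks the listed vertices as done. -/
def doneP : Stmt Var Arr := .for_ .x (.var .k) (.put .done (.get .vs (.var .x)) (.lit 1))

theorem tri_doneP {C S : Set (Fin n)} {e : ℕ → Fin n} {k : ℕ} (he : Enum C e k)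
    (hk : HoldsEnum e k μ) (hS : Holds .done S μ) :
    Tri doneP μ (20 * k + 10) (Holds .done (S ∪ C)) := by
  refine Tri.for (fun j ν => ∀ v : Fin n, ν.arr .done v = 1 ↔ v ∈ S ∨ ∃ i < j, e i = v) 10 hk.1 ?_
    (fun v => by simpa using hS v) (fun j ν hj f h => Tri.leaf ?_) fun ν f h v => ?_
  · simp only [Expr.cost]; omega
  · intro v
    have e₁ := (hk.frame f).2 j hj
    have e₂ : (∃ i < j + 1, e i = v) ↔ (∃ i < j, e i = v) ∨ e j = v := by
      simp only [Nat.lt_succ_iff_lt_or_eq, or_and_right, exists_or, exists_eq_left]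
    rw [e₂, ← or_assoc, ← h v]
    by_cases hv : e j = v
    · simp [e₁, hv]
    · simp [e₁, hv, show (v : ℕ) ≠ e j from fun h => hv (Fin.ext h).symm]
  · rw [h v, ← he.mem, Set.mem_union]

theorem Enum.ncard {C : Set (Fin n)} {e : ℕ → Fin n} {k : ℕ} (h : Enum C e k) : C.ncard = k := by
  have : C = e '' (Finset.range k : Set ℕ) := by
    ext v; rw [h.mem]; simp
  rw [this, Set.InjOn.ncard_image, Set.ncard_coe_finset, Finset.card_range]
  intro i hi j hj hij
  exact h.inj i (by simpa using hi) j (by simpa using hj) hij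

/-- The product `3 ^ B * k ^ 3` is at most the fourth power of the larger of `3 ^ B` and `k`. This
separates the exponential factor from the size of the component and leaves `k * (n + 1) ^ 3`, which
can be summed over components. -/
theorem guess_time_le {B M d k : ℕ} (hB : 4 * B ≤ M + 4) (hd : d ≤ B + 1) (hk : 1 ≤ k)
    (hkn : k ≤ n) : 3 ^ d * (3 * k + 1) ^ 3 ≤ 192 * (81 * 3 ^ M + k * (n + 1) ^ 3) := by
  have h₁ : 3 ^ d ≤ 3 * 3 ^ B := by
    rw [← pow_succ']; exact Nat.pow_le_pow_right (by norm_num) hd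
  have h₂ : (3 * k + 1) ^ 3 ≤ 64 * k ^ 3 := by
    calc (3 * k + 1) ^ 3 ≤ (4 * k) ^ 3 := Nat.pow_le_pow_left (by omega) _
      _ = 64 * k ^ 3 := by ring
  have h₃ : (3 ^ B) ^ 4 ≤ 81 * 3 ^ M := by
    rw [← pow_mul, show 81 * 3 ^ M = 3 ^ (M + 4) by ring]
    exact Nat.pow_le_pow_right (by norm_num) (by omega)
  have h₄ : k ^ 4 ≤ k * (n + 1) ^ 3 := by
    rw [show k ^ 4 = k * k ^ 3 by ring]
    exact Nat.mul_le_mul_left _ (Nat.pow_le_pow_left (by omega) _)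
  have h₅ : 3 ^ B * k ^ 3 ≤ (3 ^ B) ^ 4 + k ^ 4 := by
    rcases le_total (3 ^ B) k with h | h
    · calc 3 ^ B * k ^ 3 ≤ k * k ^ 3 := Nat.mul_le_mul_right _ h
        _ = k ^ 4 := by ring
        _ ≤ _ := Nat.le_add_left _ _
    · calc 3 ^ B * k ^ 3 ≤ 3 ^ B * (3 ^ B) ^ 3 := Nat.mul_le_mul_left _ (Nat.pow_le_pow_left h _)
        _ = (3 ^ B) ^ 4 := by ring
        _ ≤ _ := Nat.le_add_right _ _
  calc 3 ^ d * (3 * k + 1) ^ 3 ≤ (3 * 3 ^ B) * (64 * k ^ 3) := Nat.mul_le_mul h₁ h₂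
    _ = 192 * (3 ^ B * k ^ 3) := by ring
    _ ≤ _ := Nat.mul_le_mul_left _ (by omega)

theorem _root_.IsListColoring.cliqueFree {f : Fin n → Fin 3} (h : IsListColoring G L f) :
    G.CliqueFree 4 := by
  have : G.Colorable 3 := ⟨Coloring.mk f fun {u v} ha => h.1 u v ha⟩
  exact this.cliqueFree (by norm_num)

/-- Colors the component of `r`, provided that it has a connected dominating set with at most `B`
vertices. -/
def componentP (B : ℕ) : Stmt Var Arr :=
  allowAllP ;; reachP ;; collectP ;; shrinkP ;; rankP ;; litP ;;
    .ifLt (.lit (B + 1)) (.var .d) (.set .ok (.lit 0)) guessP ;; doneP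

/-- The graph is never tested for a `K₄`. As `d` is at most one more than the size of the dominating
set, `d > B + 1` refutes the size bound for `K₄`-free graphs, and `ok := 0` is right. The time is
stated as a multiple of the size of the component, for the sake of the sum over all components. -/
theorem tri_componentP (hc : Ctx G L μ) {B M : ℕ} (hBM : 4 * B ≤ M + 4)
    (hB : G.CliqueFree 4 → ∀ (C : Set (Fin n)) (D : Finset (Fin n)) (r : Fin n),
      G.IsMinimalConnectedDominating C D r → D.card ≤ B)
    {r : Fin n} (hr : μ.reg .r = r) {S : Set (Fin n)} (hS : Holds .done S μ) :
    Tri (componentP B) μ ((G.reach Set.univ r).ncard * (11000000 * ((n + 1) ^ 3 + 3 ^ M))) fun ν =>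
      Holds .done (S ∪ G.reach Set.univ r) ν ∧
      (∀ v ∉ G.reach Set.univ r, ν.arr .out v = μ.arr .out v) ∧
      ((ν.reg .ok = μ.reg .ok ∧ ∃ f, ColorsOn G L (G.reach Set.univ r) f ∧
        ∀ v ∈ G.reach Set.univ r, ν.arr .out v = f v) ∨
      (ν.reg .ok = 0 ∧ ∀ f, ¬ IsListColoring G L f)) := by
  set C := G.reach Set.univ r with hC
  set k := C.ncard with hk
  have hk₁ : 1 ≤ k := (Set.ncard_pos C.toFinite).2 ⟨r, self_mem_reach⟩
  have hkn : k ≤ n := by simpa using Set.ncard_le_card C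
  refine Tri.seq_le (tri_allowAllP hc.n_eq) (fun ν₁ f₁ h₁ => Tri.seq'
    (tri_reachP (hc.frame f₁) ((f₁.1 _ rfl).trans hr) h₁ (Set.mem_univ r)) fun ν₂ f₂ h₂ => Tri.seq'
    (tri_collectP ((hc.frame f₁).frame f₂) r h₂) fun ν₃ f₃ h₃ => Tri.seq'
    (T := 290 * (k * (n + 1) ^ 3) + 3) (T' := 100 * (n + 1) ^ 2 + ((50 * k + 10) +
      ((1 + (1 + (1 + 700 * (192 * (81 * 3 ^ M + k * (n + 1) ^ 3))))) + (20 * k + 10))))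
    (Q' := fun ν => ∃ e, Enum C e k ∧ HoldsEnum e k ν ∧
      ∃ D : Set (Fin n), Holds .inD D ν ∧ G.IsMinimalConnectedDominating C D r) ?_
    fun ν₄ f₄ h₄ => ?_) ?_
  · obtain ⟨e, k', he, hk', hD⟩ := h₃
    obtain rfl : k' = k := he.ncard.symm
    refine (tri_shrinkP (((hc.frame f₁).frame f₂).frame f₃) he hk' ?_ hC hD).mono le_rfl
      fun ν f h => ⟨e, he, hk'.frame f, h⟩
    exact (f₃.1 _ rfl).trans <| (f₂.1 _ rfl).trans <| (f₁.1 _ rfl).trans hr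
  · obtain ⟨e, he, hk', D, hD, hmin⟩ := h₄
    have hc₄ := (((hc.frame f₁).frame f₂).frame f₃).frame f₄
    have hS₄ := (((hS.frame f₁).frame f₂).frame f₃).frame f₄
    have ho₄ : ν₄.arr .out = μ.arr .out := (f₄.2 _ rfl).trans <| (f₃.2 _ rfl).trans <|
      (f₂.2 _ rfl).trans (f₁.2 _ rfl)
    have hok₄ : ν₄.reg .ok = μ.reg .ok := (f₄.1 _ rfl).trans <| (f₃.1 _ rfl).trans <|
      (f₂.1 _ rfl).trans (f₁.1 _ rfl)
    refine Tri.seq' (tri_rankP hc₄ he hk' hD hmin) fun ν₅ f₅ h₅ => Tri.seq'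
      (tri_litP (hk'.frame f₅)) fun ν₆ f₆ h₆ => ?_
    obtain ⟨d, hd, -, hdk, hdD, hg⟩ := h₅
    have hd₆ : ν₆.reg .d = d := (f₆.1 _ rfl).trans hd
    have hg₆ : Guides G C d ν₆ := by unfold Guides; rw [f₆.2 .domi rfl]; exact hg
    have ho₆ : ν₆.arr .out = μ.arr .out := (f₆.2 _ rfl).trans <| (f₅.2 _ rfl).trans ho₄
    have hok₆ : ν₆.reg .ok = μ.reg .ok := (f₆.1 _ rfl).trans <| (f₅.1 _ rfl).trans hok₄
    refine Tri.seq' (Tri.ifLt (Q := fun ν => (∀ v ∉ C, ν.arr .out v = μ.arr .out v) ∧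
      ((ν.reg .ok = μ.reg .ok ∧ ∃ f, ColorsOn G L C f ∧ ∀ v ∈ C, ν.arr .out v = f v) ∨
      (ν.reg .ok = 0 ∧ ∀ f, ¬ IsListColoring G L f))) (fun hlt => Tri.leaf ?_ rfl ?_)
      fun hle => ?_) fun ν₇ f₇ h₇ =>
      (tri_doneP he (((hk'.frame f₅).frame f₆).frame f₇ ⟨rfl, rfl⟩)
        (((hS₄.frame f₅).frame f₆).frame f₇ rfl)).mono le_rfl fun ν₈ f₈ h₈ => ⟨h₈, ?_⟩
    · simp only [Expr.eval_lit, Expr.eval_var, hd₆] at hlt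
      simp only [Stmt.run_set, Mem.setReg_arr, Mem.setReg_reg, ho₆, Expr.eval_lit, if_true]
      refine ⟨fun _ _ => trivial, .inr ⟨trivial, fun f hf => ?_⟩⟩
      obtain ⟨D, rfl⟩ := D.toFinite.exists_finset_coe
      have := hB hf.cliqueFree C D r hmin
      rw [Set.ncard_coe_finset] at hdD
      omega
    · have : 1 ≤ 3 ^ M := Nat.one_le_pow _ _ (by norm_num)
      simp only [Stmt.bound, Expr.cost]; omega
    · simp only [Expr.eval_lit, Expr.eval_var, hd₆] at hle
      refine (tri_guessP ((hc₄.frame f₅).frame f₆) he ((hk'.frame f₅).frame f₆) h₆ hd₆ hdk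
        hg₆).mono (Nat.mul_le_mul_left _ (guess_time_le hBM hle hk₁ hkn)) fun ν _ h => ?_
      rwa [ho₆, hok₆] at h
    · rw [f₈.2 .out rfl, f₈.1 .ok rfl]
      exact h₇
  · have h₀ : 1 ≤ 3 ^ M := Nat.one_le_pow _ _ (by norm_num)
    have h₁ : n + 1 ≤ (n + 1) ^ 3 := Nat.le_self_pow (by omega) _
    have h₂ : (n + 1) ^ 2 ≤ (n + 1) ^ 3 := Nat.pow_le_pow_right (by omega) (by omega)
    have h₃ : (n + 1) ^ 3 ≤ k * (n + 1) ^ 3 := Nat.le_mul_of_pos_left _ hk₁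
    have h₄ : 3 ^ M ≤ k * 3 ^ M := Nat.le_mul_of_pos_left _ hk₁
    rw [show k * (11000000 * ((n + 1) ^ 3 + 3 ^ M)) =
      11000000 * (k * (n + 1) ^ 3) + 11000000 * (k * 3 ^ M) by ring]
    omega

/-! ### The whole program -/

/-- The whole program. -/
def colorP (B : ℕ) : Stmt Var Arr :=
  initP ;; .for_ .r (.var .n) (.ifEq (.get .done (.var .r)) (.lit 1) .skip (componentP B)) ;;
    copyP .adj .out ;; .set .n (.var .ok)

/-- No edge leaves `S`, so the two colorings never meet along an edge. -/
theorem ColorsOn.union {S C : Set (Fin n)} {f g : Fin n → Fin 3} (hf : ColorsOn G L S f)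
    (hg : ColorsOn G L C g) (hS : ∀ u ∈ S, ∀ v, G.Adj u v → v ∈ S) (hSC : Disjoint S C)
    [DecidablePred (· ∈ C)] : ColorsOn G L (S ∪ C) (fun v => if v ∈ C then g v else f v) := by
  have hCS : ∀ u ∈ C, u ∉ S := fun u hu hu' => Set.disjoint_left.1 hSC hu' hu
  refine ⟨fun u hu v hv ha => ?_, fun v hv => ?_⟩
  · by_cases hu' : u ∈ C
    · have hv' : v ∈ C := hv.resolve_left fun h => hCS u hu' (hS v h u ha.symm)
      simpa [hu', hv'] using hg.1 u hu' v hv' ha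
    · have hu₁ := hu.resolve_right hu'
      have hv₁ := hS u hu₁ v ha
      simpa [hu', show v ∉ C from fun h => hCS v h hv₁] using hf.1 u hu₁ v hv₁ ha
  · by_cases hv' : v ∈ C
    · simpa [hv'] using hg.2 v hv'
    · simpa [hv'] using hf.2 v (hv.resolve_right hv')

theorem tri_colorP {B M : ℕ} (hBM : 4 * B ≤ M + 4)
    (hB : G.CliqueFree 4 → ∀ (C : Set (Fin n)) (D : Finset (Fin n)) (r : Fin n),
      G.IsMinimalConnectedDominating C D r → D.card ≤ B)
    (hn : μ.reg .n = n) (hacc : μ.reg .acc = 0) (hdone : ∀ v, μ.arr .done v = 0)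
    (hadj : ∀ u v : Fin n, μ.arr .adj (u * n + v) = 1 ↔ G.Adj u v)
    (hlst : ∀ (v : Fin n) (c : Fin 3), μ.arr .lst (3 * v + c) = 1 ↔ c ∈ L v) :
    Tri (colorP B) μ (90000000 * (1 + n ^ 4 + 3 ^ M * n)) fun ν =>
      (ν.reg .n = 1 ∧ ∃ f, IsListColoring G L f ∧ ∀ v : Fin n, ν.arr .adj v = f v) ∨
      (ν.reg .n = 0 ∧ ¬ ∃ f, IsListColoring G L f) := by
  classical
  set A := 11000000 * ((n + 1) ^ 3 + 3 ^ M) with hA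
  refine Tri.seq_le (tri_initP hn hacc hadj hlst) (fun ν₁ f₁ h₁ => Tri.seq'
    (T := 20 * n + n * A + 3) (T' := (20 * n + 10) + 2) (Q' := fun ν =>
      (ν.reg .ok = 1 ∧ ∃ f, IsListColoring G L f ∧ ∀ v : Fin n, ν.arr .out v = f v) ∨
      (ν.reg .ok = 0 ∧ ∀ f, ¬ IsListColoring G L f))
    -- The set `S` is the union of the components treated so far. The cost is charged to its size: a
    -- root already in `S` takes constant time, and a new component pays in proportion to the
    -- vertices it adds.
    (Tri.for_time (fun j c ν => ∃ S : Set (Fin n), Holds .done S ν ∧ (∀ v : Fin n, (v : ℕ) < j → v ∈ S) ∧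
      (∀ u ∈ S, ∀ v, G.Adj u v → v ∈ S) ∧ c ≤ 20 * j + S.ncard * A ∧
      ((ν.reg .ok = 1 ∧ ∃ f, ColorsOn G L S f ∧ ∀ v ∈ S, ν.arr .out v = f v) ∨
      (ν.reg .ok = 0 ∧ ∀ f, ¬ IsListColoring G L f))) ?_ ?_ ?_) fun ν₂ f₂ h₂ =>
      Tri.seq' (tri_copyP .adj .out (by decide)
        ((f₂.1 .n rfl).trans <| (f₁.1 _ rfl).trans hn)) fun ν₃ f₃ h₃ => Tri.leaf ?_) ?_
  · refine ⟨∅, fun v => ?_, by simp, by simp, by simp, .inl ⟨h₁.2, 0, by simp [ColorsOn]⟩⟩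
    rw [f₁.2 .done rfl, hdone]
    simp
  · rintro j c ν hj f ⟨S, hS, hSj, hcl, hc, h⟩
    have hctx := h₁.1.frame f ⟨rfl, rfl, rfl, rfl, rfl⟩
    simp only [Expr.eval_var, h₁.1.n_eq] at hj
    by_cases hjS : (⟨j, hj⟩ : Fin n) ∈ S
    · refine ⟨2 + (1 + (1 + 1)), Tri.ifEq (fun _ => Tri.leaf ?_) fun hne => ?_⟩
      · refine ⟨S, hS, fun v hv => ?_, hcl, by omega, h⟩
        rcases Nat.lt_succ_iff_lt_or_eq.1 hv with hv | hv
        · exact hSj v hv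
        · rwa [show v = ⟨j, hj⟩ from Fin.ext hv]
      · exact absurd ((hS ⟨j, hj⟩).2 hjS) (by simpa using hne)
    · set C := G.reach Set.univ (⟨j, hj⟩ : Fin n) with hC
      have hCcl : ∀ u ∈ C, ∀ v, G.Adj u v → v ∈ C := fun u hu v ha =>
        reach_step hu ha (Set.mem_univ _) (Set.mem_univ _)
      have hSC : Disjoint S C := by
        rw [Set.disjoint_right]
        exact reach_subset_of_closed (M := Sᶜ) hjS fun u hu v _ _ ha hv => hu (hcl v hv u ha.symm)
      refine ⟨2 + (1 + (1 + C.ncard * A)), Tri.ifEq (fun heq => ?_) fun _ =>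
        (tri_componentP (hctx.setReg .r j) hBM hB (r := ⟨j, hj⟩) (by simp)
          (hS.setReg .r j)).mono le_rfl fun ξ _ ⟨g₁, g₂, g₃⟩ => ⟨S ∪ C, g₁, fun v hv => ?_, ?_, ?_, ?_⟩⟩
      · exact absurd ((hS ⟨j, hj⟩).1 (by simpa using heq)) hjS
      · rcases Nat.lt_succ_iff_lt_or_eq.1 hv with hv | hv
        · exact .inl (hSj v hv)
        · rw [show v = ⟨j, hj⟩ from Fin.ext hv]
          exact .inr self_mem_reach
      · rintro u (hu | hu) v ha
        · exact .inl (hcl u hu v ha)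
        · exact .inr (hCcl u hu v ha)
      · rw [Set.ncard_union_eq hSC, add_mul]
        omega
      · rcases g₃ with ⟨g₃, g, hg, hgo⟩ | g₃
        · rw [g₃]
          refine h.imp (fun ⟨h₁, f, hf, hfo⟩ => ⟨h₁, _, hf.union hg hcl hSC, fun v hv => ?_⟩) id
          by_cases hv' : v ∈ C
          · rw [hgo v hv', if_pos hv']
          · rw [g₂ v hv', if_neg hv']
            exact hfo v (hv.resolve_right hv')
        · exact .inr g₃
  · rintro c ν f ⟨S, hS, hSj, hcl, hc, h⟩
    simp only [Expr.eval_var, h₁.1.n_eq] at hSj hc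
    obtain rfl : S = Set.univ := Set.eq_univ_of_forall fun v => hSj v v.2
    rw [Set.ncard_univ, Nat.card_eq_fintype_card, Fintype.card_fin] at hc
    refine ⟨by simp only [Expr.cost]; omega, h.imp (fun ⟨h₁, f, hf, hfo⟩ => ⟨h₁, f, ⟨?_, ?_⟩, ?_⟩) id⟩
    · exact fun u v => hf.1 u trivial v trivial
    · exact fun v => hf.2 v trivial
    · exact fun v => hfo v trivial
  · have hok : ν₃.reg .ok = ν₂.reg .ok := f₃.1 _ rfl
    refine h₂.imp (fun ⟨h₁, f, hf, hfo⟩ => ⟨by simp [hok, h₁], f, hf, fun v => ?_⟩)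
      fun ⟨h₁, h⟩ => ⟨by simp [hok, h₁], by simpa using h⟩
    rw [Stmt.run_set, Mem.setReg_arr, h₃ v v.2, hfo]
  · have h₁ : n ≤ n ^ 4 := Nat.le_self_pow (by omega) _
    -- For `n = 0` both sides vanish; otherwise `n + 1 ≤ 2 * n`, which avoids a multiple of `n ^ 3`
    -- for each vertex of a small graph.
    have h₂ : n * (n + 1) ^ 3 ≤ 8 * n ^ 4 := by
      rcases Nat.eq_zero_or_pos n with rfl | hpos
      · simp
      calc n * (n + 1) ^ 3 ≤ n * (2 * n) ^ 3 :=
            Nat.mul_le_mul_left _ (Nat.pow_le_pow_left (by omega) _)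
        _ = 8 * n ^ 4 := by ring
    have h₃ : n * A = 11000000 * (n * (n + 1) ^ 3) + 11000000 * (3 ^ M * n) := by rw [hA]; ring
    omega

/-- The memory that holds the input. -/
noncomputable def inputMem (G : SimpleGraph (Fin n)) (L : Fin n → Finset (Fin 3)) : Mem Var Arr where
  reg v := (inputState G L).reg v.ctorIdx
  arr a := (inputState G L).arr a.ctorIdx

theorem inputMem_adj (u v : Fin n) : (inputMem G L).arr .adj (u * n + v) = 1 ↔ G.Adj u v := by
  have : (∃ u' v' : Fin n, (u : ℕ) * n + v = u' * n + v' ∧ G.Adj u' v') ↔ G.Adj u v := by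
    refine ⟨?_, fun h => ⟨u, v, rfl, h⟩⟩
    rintro ⟨u', v', h, ha⟩
    have hn : 0 < n := u.pos
    have h₁ : u = u' := by
      have := congrArg (· / n) h
      simpa [Nat.mul_comm _ n, Nat.mul_add_div hn, Nat.div_eq_of_lt, Fin.ext_iff] using this
    subst h₁
    rwa [show v = v' from Fin.ext (by omega)]
  change (inputState G L).arr 0 _ = 1 ↔ _
  simp [inputState, this]

theorem inputMem_lst (v : Fin n) (c : Fin 3) :
    (inputMem G L).arr .lst (3 * v + c) = 1 ↔ c ∈ L v := by
  have : (∃ (v' : Fin n) (c' : Fin 3), 3 * (v : ℕ) + c = 3 * v' + c' ∧ c' ∈ L v') ↔ c ∈ L v := by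
    refine ⟨?_, fun h => ⟨v, c, rfl, h⟩⟩
    rintro ⟨v', c', h, hm⟩
    have h₁ : v = v' := Fin.ext (by omega)
    have h₂ : c = c' := Fin.ext (by omega)
    rwa [h₁, h₂]
  change (inputState G L).arr 1 _ = 1 ↔ _
  simp [inputState, this]

theorem exists_solvesIn {B M : ℕ} (hBM : 4 * B ≤ M + 4)
    (hB : G.CliqueFree 4 → ∀ (C : Set (Fin n)) (D : Finset (Fin n)) (r : Fin n),
      G.IsMinimalConnectedDominating C D r → D.card ≤ B) (L : Fin n → Finset (Fin 3)) :
    ∃ T, SolvesIn ((colorP B).code Var.ctorIdx Arr.ctorIdx 29) G L T ∧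
      T ≤ 90000000 * (1 + n ^ 4 + 3 ^ M * n) := by
  -- The initial machine state represents `inputMem` by definition, so the compiled code inherits
  -- the triple of `colorP`.
  obtain ⟨σ, hσ, hr, -⟩ := (colorP B).exec_code Var.ctorIdx_injective Arr.ctorIdx_injective
    Var.ctorIdx_lt (σ := inputState G L) (μ := inputMem G L) ⟨fun _ => rfl, fun _ => rfl⟩
  obtain ⟨hT, hQ⟩ := tri_colorP (μ := inputMem G L) hBM hB rfl rfl (fun _ => rfl) inputMem_adj inputMem_lst
  refine ⟨_, ⟨σ, hσ, ?_⟩, hT⟩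
  have h₀ := hr.1 .n
  have h₁ := hr.2 .adj
  rw [← h₀, ← h₁] at hQ
  exact hQ

end RAM.Coloring

theorem mainTheorem1 :
    ∃ C : ℕ, ∀ s t : ℕ, 1 ≤ s → 1 ≤ t →
      ∃ (P : RAM.Program) (p : Polynomial ℕ),
        ∀ (n : ℕ) (G : SimpleGraph (Fin n)) (L : Fin n → Finset (Fin 3)),
          InducedFree (SimpleGraph.pathGraph t) G → InducedFree (SDK s) G →
            ∃ T : ℕ, RAM.SolvesIn P G L T ∧
              T ≤ C * (1 + n ^ 4 + t * n ^ 2 + 3 ^ domBound s t * (n + G.edgeSet.ncard)) ∧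
              T ≤ p.eval n := by
  -- The bound on the dominating set is a literal of the program, which therefore depends on `s` and
  -- `t`. The constant is the one of `tri_colorP`, and for fixed `s` and `t` the factor `3 ^
  -- domBound s t` is a coefficient of the polynomial.
  refine ⟨90000000, fun s t hs _ => ⟨(RAM.Coloring.colorP
    (ramseyNumber 4 (ramseyNumber 4 s) ^ (t - 3))).code RAM.Coloring.Var.ctorIdx
    RAM.Coloring.Arr.ctorIdx 29, .C 90000000 * (1 + .X ^ 4 + .C (3 ^ domBound s t) * .X),
    fun n G L ht hS => ?_⟩⟩
  obtain ⟨T, h, hT⟩ := RAM.Coloring.exists_solvesIn (four_mul_pow_le_domBound hs t)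
    (fun hG C D r hD => hD.card_le hS ht hG) L
  refine ⟨T, h, hT.trans (Nat.mul_le_mul_left _ ?_), by simpa using hT⟩
  rw [Nat.mul_add]
  omega
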